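/- Let $M,m,A,A_1,B,B_1>0$, let $C,h\in\mathbb R$, and put $\mu=\frac{2M+m}{m}$. In the isosceles Schwarzschild three body problem two masses $M$ attract each other with the potential $-A/d-B/d^3$ at distance $d$ and lie symmetrically about an axis on which a mass $m$ moves, attracted by each of them with the potential $-A_1/d-B_1/d^3$; the angular momentum is $C$ and the energy is $h$. Let $$V(\theta)=\Big(\tfrac M2\Big)^{1/2}\Big(\tfrac{A}{\cos\theta}+\tfrac{4A_1}{(\cos^2\theta+\mu\sin^2\theta)^{1/2}}\Big),\quad W(\theta)=\Big(\tfrac M2\Big)^{3/2}\Big(\tfrac{B}{\cos^3\theta}+\tfrac{16B_1}{(\cos^2\theta+\mu\sin^2\theta)^{3/2}}\Big),\quad U(\theta)=W(\theta)\cos^3\theta,$$ where $U$ is extended continuously to $\theta=\pm\pi/2$. In McGehee-type coordinates $(r,v,\theta,w)\in[0,\infty)\times\mathbb R\times[-\frac\pi2,\frac\pi2]\times\mathbb R$ the energy surface is the set $\Sigma_h=\{F=0\}$ with $$F=U(\theta)w^2+(v^2\cos^3\theta-2U(\theta))\cos^3\theta+(C^2-2rV(\theta)\cos^2\theta)\,r\cos^4\theta-2hr^3\cos^6\theta,$$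 and the regularized equations of motion on it are $$r'=rv\tfrac{\cos^3\theta}{\sqrt{U}},\qquad v'=\tfrac{\cos^3\theta}{2\sqrt U}v^2-\sqrt U+r^2(2hr+V)\tfrac{\cos^3\theta}{\sqrt U},\qquad \theta'=w,$$ $$w'=\tfrac12vw\tfrac{\cos^3\theta}{\sqrt U}+r^2V'\tfrac{\cos^6\theta}{U}+\tfrac{U'}{U}\Big(\cos^3\theta-\tfrac{w^2}2\Big)+3\sin\theta\cos^2\theta-\tfrac{C^2r\sin\theta\cos^3\theta}{U}-3\sin\theta\,\Omega ,$$ where $$\Omega=2\cos^2\theta+\tfrac1U\big(2hr^3\cos^5\theta-v^2\cos^5\theta-C^2r\cos^3\theta+2r^2V\cos^5\theta\big),$$ which on $\Sigma_h$ is equal to $w^2/\cos\theta$ wherever $\cos\theta\neq0$ (terms with $V$ and $V'$ are extended continuously to $\theta=\pm\pi/2$). The triple collision manifold is $$\Delta=\Big\{(r,v,\theta,w)\,:\,r=0,\ |\theta|\le\tfrac{\pi}{2},\ w^2+\tfrac{\cos^6\theta}{U(\theta)}v^2=2\cos^3\theta\Big\}.$$ Assume that $$\mu>1+\frac{A}{4A_1},\qquad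 \mu>1+\frac{B}{16B_1},\qquad (\mu-1)^{4/15}\Big(\frac{4A_1}{A}\Big)^{2/3}\ne\Big(\frac{16B_1}{B}\Big)^{2/5},$$ and let $$\theta_w=\arccos\sqrt{\frac{\mu}{(\mu-1)+(\mu-1)^{2/5}(16B_1/B)^{2/5}}}\,.$$ Then $0<\theta_w<\pi/2$, and the equilibria of the regularized equations on $\Delta$ are exactly $$Q=(0,\sqrt{2W(0)},0,0),\quad Q^*=(0,-\sqrt{2W(0)},0,0),\quad E_\pm=(0,\sqrt{2W(\theta_w)},\pm\theta_w,0),\quad E_\pm^*=(0,-\sqrt{2W(\theta_w)},\pm\theta_w,0).$$ They lie on $\Sigma_h$ and $dF\ne0$ there. For the flow on the ($3$-dimensional) energy surface $\Sigma_h$ (eigenvalues being those of the linearization restricted to $\ker dF$, and the stable and unstable manifolds $\mathcal W_s,\mathcal W_u$ being those in $\Sigma_h$, which near the equilibrium are $C^1$ embedded disks, or half-disks because of the boundary $r\ge0$): * $Q$ is a source (all eigenvalues have positive real part) with $\dim\mathcal W_u(Q)=3$, and $Q^*$ is a sink (all eigenvalues have negative real part) with $\dim\mathcal W_s(Q^*)=3$;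 * if moreover $\mu$ is so large that $\mu>1+\frac{25B+16B_1}{24\cdot16B_1}$, then $Q$ and $Q^*$ are spirals, i.e. they have non-real eigenvalues; * $E_\pm$ and $E_\pm^*$ are saddles (no eigenvalue on the imaginary axis, and eigenvalues on both sides of it) with $\dim\mathcal W_u(E_\pm)=2$, $\dim\mathcal W_s(E_\pm)=1$, $\dim\mathcal W_s(E_\pm^*)=2$, $\dim\mathcal W_u(E_\pm^*)=1$. -/

import Mathlib

open Topology Filter

noncomputable section

/-! ### Local stable and unstable manifolds, linearization along a hypersurface -/

section Dynamics

variable {E : Type*} [NormedAddCommGroup E] [NormedSpace ℝ E]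

/-- The local stable set of `P` relative to `N`, for the field `X` on the phase space `S`: the
points `p` whose forward orbit under `X` exists for all times `t ≥ 0`, stays in `S ∩ N`, and
converges to `P`. -/
def localStableSet (X : E → E) (S N : Set E) (P : E) : Set E :=
  {p | ∃ γ : ℝ → E, γ 0 = p ∧
    (∀ t : ℝ, 0 ≤ t → γ t ∈ S ∩ N ∧ HasDerivWithinAt γ (X (γ t)) (Set.Ici 0) t) ∧
    Tendsto γ atTop (𝓝 P)}

/-- `φ` is a `C¹` embedding (an immersion and a homeomorphism onto its image) of the open unit ball
of `ℝᵏ` into `E`, which sends the centre to `P`. -/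
def IsEmbeddedDisk {k : ℕ} (φ : EuclideanSpace ℝ (Fin k) → E) (P : E) : Prop :=
  φ 0 = P ∧ ContDiffOn ℝ 1 φ (Metric.ball 0 1) ∧
  (∀ x ∈ Metric.ball (0 : EuclideanSpace ℝ (Fin k)) 1, Function.Injective (fderiv ℝ φ x)) ∧
  IsEmbedding ((Metric.ball (0 : EuclideanSpace ℝ (Fin k)) 1).domRestrict φ)

/-- The stable manifold of `P` (for the field `X` on the phase space `S`) has dimension `k`: for all
sufficiently small neighbourhoods `N` of `P`, the local stable set relative to `N` coincides near
`P` with a `C¹` embedded `k`-dimensional disk centred at `P` (the case `ℓ = 0`) or, `S` being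
allowed to have a boundary through `P`, with a `C¹` embedded `k`-dimensional half-disk with `P` on
its flat face (the case `ℓ ≠ 0`). As every orbit that converges to `P` ends in the local stable
set, this is the dimension of the global stable manifold. -/
def StableManifoldHasDim (X : E → E) (S : Set E) (P : E) (k : ℕ) : Prop :=
  ∃ (φ : EuclideanSpace ℝ (Fin k) → E) (ℓ : EuclideanSpace ℝ (Fin k) →ₗ[ℝ] ℝ),
    IsEmbeddedDisk φ P ∧
    ∃ O ∈ 𝓝 P, ∀ N ∈ 𝓝 P, N ⊆ O →
      ∀ᶠ p in 𝓝 P,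
        p ∈ localStableSet X S N P ↔ p ∈ φ '' (Metric.ball 0 1 ∩ {x | 0 ≤ ℓ x})

/-- The unstable manifold of `P` has dimension `k`: the same in reversed time. -/
def UnstableManifoldHasDim (X : E → E) (S : Set E) (P : E) (k : ℕ) : Prop :=
  StableManifoldHasDim (fun p => -X p) S P k

/-- `lam` is an eigenvalue of the linearization of `X` at `P`, restricted to the tangent space
`ker dF(P)` of the level set of `F` through `P`. The complex eigenvector is written `a + i b`, with
`a` and `b` real tangent vectors. -/
def IsTangentEigenvalue (X : E → E) (F : E → ℝ) (P : E) (lam : ℂ) : Prop :=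
  ∃ a b : E, (a ≠ 0 ∨ b ≠ 0) ∧ fderiv ℝ F P a = 0 ∧ fderiv ℝ F P b = 0 ∧
    fderiv ℝ X P a = lam.re • a - lam.im • b ∧
    fderiv ℝ X P b = lam.im • a + lam.re • b

/-- All eigenvalues along the level set have positive real part. -/
def IsSource (X : E → E) (F : E → ℝ) (P : E) : Prop :=
  X P = 0 ∧ ∀ lam : ℂ, IsTangentEigenvalue X F P lam → 0 < lam.re

/-- All eigenvalues along the level set have negative real part. -/
def IsSink (X : E → E) (F : E → ℝ) (P : E) : Prop :=
  X P = 0 ∧ ∀ lam : ℂ, IsTangentEigenvalue X F P lam → lam.re < 0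

/-- A hyperbolic equilibrium with eigenvalues on both sides of the imaginary axis. -/
def IsSaddle (X : E → E) (F : E → ℝ) (P : E) : Prop :=
  X P = 0 ∧ (∀ lam : ℂ, IsTangentEigenvalue X F P lam → lam.re ≠ 0) ∧
  (∃ lam : ℂ, IsTangentEigenvalue X F P lam ∧ 0 < lam.re) ∧
  (∃ lam : ℂ, IsTangentEigenvalue X F P lam ∧ lam.re < 0)

/-- There is a pair of non-real eigenvalues along the level set. -/
def IsSpiral (X : E → E) (F : E → ℝ) (P : E) : Prop :=
  ∃ lam : ℂ, IsTangentEigenvalue X F P lam ∧ lam.im ≠ 0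

end Dynamics

/-! ### The isosceles Schwarzschild problem in regularized coordinates -/

/-- Masses and force constants of the isosceles Schwarzschild three body problem: two equal masses
`M` attract each other with the potential `-A/d - B/d³`, at mutual distance `d`; the mass `m` is
attracted by each of them with the potential `-A₁/d - B₁/d³`. All the
constants are positive. -/
structure IsoscelesParams where
  M : ℝ
  m : ℝ
  A : ℝ
  A₁ : ℝ
  B : ℝ
  B₁ : ℝ
  M_pos : 0 < M
  m_pos : 0 < m
  A_pos : 0 < A
  A₁_pos : 0 < A₁
  B_pos : 0 < B
  B₁_pos : 0 < B₁

namespace IsoscelesParams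

/-- States `(r, v, θ, w)`. -/
abbrev State : Type := ℝ × ℝ × ℝ × ℝ

variable (c : IsoscelesParams)

/-- The mass parameter `μ = (2M + m)/m`. -/
def μ : ℝ := (2 * c.M + c.m) / c.m

def V (θ : ℝ) : ℝ :=
  (c.M / 2) ^ (1 / 2 : ℝ) *
    (c.A / Real.cos θ +
      4 * c.A₁ / (Real.cos θ ^ 2 + c.μ * Real.sin θ ^ 2) ^ (1 / 2 : ℝ))

def W (θ : ℝ) : ℝ :=
  (c.M / 2) ^ (3 / 2 : ℝ) *
    (c.B / Real.cos θ ^ 3 +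
      16 * c.B₁ / (Real.cos θ ^ 2 + c.μ * Real.sin θ ^ 2) ^ (3 / 2 : ℝ))

/-- The regularized potential `U(θ) = W(θ) cos³ θ`, written so that it also has the right value
at `θ = ± π/2`. -/
def U (θ : ℝ) : ℝ :=
  (c.M / 2) ^ (3 / 2 : ℝ) *
    (c.B + 16 * c.B₁ * Real.cos θ ^ 3 /
      (Real.cos θ ^ 2 + c.μ * Real.sin θ ^ 2) ^ (3 / 2 : ℝ))

theorem U_eq (θ : ℝ) (hθ : Real.cos θ ≠ 0) : c.U θ = c.W θ * Real.cos θ ^ 3 := by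
  unfold U W
  field_simp

/-- The energy function: the level of energy `h` is `energyFn = 0`. -/
def energyFn (C h : ℝ) : State → ℝ := fun (r, v, θ, w) =>
  c.U θ * w ^ 2 + (v ^ 2 * Real.cos θ ^ 3 - 2 * c.U θ) * Real.cos θ ^ 3
    + (C ^ 2 - 2 * r * c.V θ * Real.cos θ ^ 2) * r * Real.cos θ ^ 4
    - 2 * h * r ^ 3 * Real.cos θ ^ 6

/-- The phase space at energy `h` and angular momentum `C`, with the triple collision `r = 0` and
the double collisions `θ = ± π/2` included. -/
def energySurface (C h : ℝ) : Set State :=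
  {p | 0 ≤ p.1 ∧ p.2.2.1 ∈ Set.Icc (-(Real.pi / 2)) (Real.pi / 2) ∧ c.energyFn C h p = 0}

/-- The value of `w² / cos θ` on the energy surface, in a form that is analytic up to
`θ = ± π/2` (the energy relation is solved for `w²`). -/
def wSqDivCos (C h r v θ : ℝ) : ℝ :=
  2 * Real.cos θ ^ 2 +
    (2 * h * r ^ 3 * Real.cos θ ^ 5 - v ^ 2 * Real.cos θ ^ 5 - C ^ 2 * r * Real.cos θ ^ 3
      + 2 * r ^ 2 * c.V θ * Real.cos θ ^ 5) / c.U θ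

theorem wSqDivCos_eq (C h r v θ w : ℝ) (hθ : Real.cos θ ≠ 0) (hU : c.U θ ≠ 0)
    (hE : c.energyFn C h (r, v, θ, w) = 0) :
    c.wSqDivCos C h r v θ = w ^ 2 / Real.cos θ := by
  unfold wSqDivCos
  simp only [energyFn] at hE
  field_simp
  linear_combination -hE

/-- The regularized vector field on the energy surface. It is the image of
`r' = r v`, `v' = (3/2) v² + u² + C² r / cos² θ - r² V - 3 W`, `θ' = u`,
`u' = u v / 2 - C² r sin θ / cos³ θ + r² V' + W'` under `w = u cos³ θ / √U` and the change of time
by the factor `cos³ θ / √U`; the energy relation is used to remove the term in `C²` from `v'`, and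
the quotient `w² / cos θ` from the term `- 3 tan θ w²` of `w'`. -/
def field (C h : ℝ) : State → State := fun (r, v, θ, w) =>
  ( r * v * (Real.cos θ ^ 3 / √(c.U θ)),
    (Real.cos θ ^ 3 / (2 * √(c.U θ)) * v ^ 2 - √(c.U θ))
      + r ^ 2 * (2 * h * r + c.V θ) * (Real.cos θ ^ 3 / √(c.U θ)),
    w,
    1 / 2 * v * w * (Real.cos θ ^ 3 / √(c.U θ))
      + r ^ 2 * deriv c.V θ * (Real.cos θ ^ 6 / c.U θ)
      + deriv c.U θ / c.U θ * (Real.cos θ ^ 3 - w ^ 2 / 2)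
      + 3 * Real.sin θ * Real.cos θ ^ 2
      - C ^ 2 * r * Real.sin θ * Real.cos θ ^ 3 / c.U θ
      - 3 * Real.sin θ * c.wSqDivCos C h r v θ )

/-- The triple collision manifold. -/
def collisionManifold : Set State :=
  {p | p.1 = 0 ∧ p.2.2.1 ∈ Set.Icc (-(Real.pi / 2)) (Real.pi / 2) ∧
    p.2.2.2 ^ 2 + Real.cos p.2.2.1 ^ 6 / c.U p.2.2.1 * p.2.1 ^ 2 = 2 * Real.cos p.2.2.1 ^ 3}

/-- The positive critical point of `W`. -/
def θw : ℝ :=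
  Real.arccos √(c.μ / ((c.μ - 1) +
    (c.μ - 1) ^ (2 / 5 : ℝ) * (16 * c.B₁ / c.B) ^ (2 / 5 : ℝ)))

def Q : State := (0, √(2 * c.W 0), 0, 0)

def Qstar : State := (0, -√(2 * c.W 0), 0, 0)

/-- `E₊`. -/
def Eplus : State := (0, √(2 * c.W c.θw), c.θw, 0)

/-- `E₋`. -/
def Eminus : State := (0, √(2 * c.W c.θw), -c.θw, 0)

/-- `E₊*`. -/
def EplusStar : State := (0, -√(2 * c.W c.θw), c.θw, 0)

/-- `E₋*`. -/
def EminusStar : State := (0, -√(2 * c.W c.θw), -c.θw, 0)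

end IsoscelesParams

end

/-!
On the collision manifold `r = 0` the regularized field does not involve `V`. An equilibrium there
has `w = 0`, the equation `v' = 0` gives `v² = 2 W(θ)` and keeps `θ` away from `± π/2`, and
`w' = 0` becomes `W'(θ) = 0`. Now `cos⁴ θ · W'(θ)` is a positive multiple of
`sin θ · (B - 16 B₁ (μ - 1) (cos² θ / (cos² θ + μ sin² θ))^{5/2})` (`deriv_U_mul_cos_add`), and the
second factor vanishes exactly at `± θ_w`, which gives the list of equilibria (`isCrit_iff`,
`eq_critPoint_of_equilibrium`).

At an equilibrium with `v = ± √(2 W)` the linearization is block triangular along the energy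
surface (`eigenvalue_cases`). The radial direction has the eigenvalue `l = v cos³ θ / √U`, with
`l² = 2 cos³ θ`, and the `(θ, w)`-block has the characteristic polynomial `λ² - (l/2) λ - κ`, where
`κ = cos³ θ · W''/W`. As `W` has a local maximum at `0` and minima at `± θ_w`, `κ` is negative at
`0` (a source or a sink, according to the sign of `l`; a spiral if `1/2 + 4 κ < 0`) and positive at
`± θ_w` (saddles).

The invariant manifolds come from a local stable manifold theorem, `exists_localStableManifold`,
proved by the Lyapunov-Perron method: orbits converging to the equilibrium solve a `C¹` equation in
the Banach space of curves on `[0, ∞)` that vanish at infinity, and the inverse function theorem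
applies. To use it on the energy surface, the surface is written near an equilibrium as a graph
`v = ± √(v²(r, θ, w))` (`graphChart`). The field is tangent to the graph, and after a rescaling of
`r`, which makes the coupling of the radial direction to the block small, it is close to a split
linear field (`stableManifoldHasDim_critPoint`). The boundary `r ≥ 0` is invariant, as
`r' = r · rate` with a rate of the sign of `v`. If `v < 0`, `r` decays without changing sign, so
the stable manifold in the phase space is the half-disk `r ≥ 0`; if `v > 0`, an orbit that
converges to the equilibrium has `r = 0` throughout, so the stable manifold is a disk inside the
collision manifold. The reversor `(r, v, θ, w) ↦ (r, -v, θ, -w)` turns these results into results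
on unstable manifolds.
-/

noncomputable section

open scoped ZeroAtInfty NNReal

/-! ### Inhomogeneous linear equations on the half-line -/

section LinearEquations

variable {E : Type*} [NormedAddCommGroup E] [NormedSpace ℝ E]

/-- `γ` solves the non-autonomous equation `γ' = Y t γ` for all times `t ≥ 0`. -/
def IsForwardSolution (Y : ℝ → E → E) (γ : ℝ → E) : Prop :=
  ∀ t : ℝ, 0 ≤ t → HasDerivWithinAt γ (Y t (γ t)) (Set.Ici 0) t

/-- The semigroup generated by `A` contracts at the exponential rate `α`. -/
def ExpContracting (A : E →L[ℝ] E) (α : ℝ) : Prop :=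
  ∀ t : ℝ, 0 ≤ t → ‖NormedSpace.exp (t • A)‖ ≤ Real.exp (-(α * t))

theorem exp_zero_smul (A : E →L[ℝ] E) : NormedSpace.exp ((0 : ℝ) • A) = 1 := by
  rw [zero_smul, NormedSpace.exp_zero]

variable [CompleteSpace E]

theorem exp_add_smul (A : E →L[ℝ] E) (s t : ℝ) :
    NormedSpace.exp ((s + t) • A) = NormedSpace.exp (s • A) * NormedSpace.exp (t • A) := by
  let _ : NormedAlgebra ℚ (E →L[ℝ] E) := .restrictScalars ℚ ℝ _
  rw [add_smul]
  exact NormedSpace.exp_add_of_commute (((Commute.refl A).smul_left s).smul_right t)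

theorem exp_smul_exp_neg_smul (A : E →L[ℝ] E) (t : ℝ) (x : E) :
    NormedSpace.exp (t • A) (NormedSpace.exp ((-t) • A) x) = x := by
  rw [← mul_apply_eq_comp, ← exp_add_smul, add_neg_cancel, exp_zero_smul]
  rfl

theorem continuous_exp_smul (A : E →L[ℝ] E) :
    Continuous fun t : ℝ => NormedSpace.exp (t • A) :=
  continuous_iff_continuousAt.2 fun t => (hasDerivAt_exp_smul_const A t).continuousAt

/-- Variation of constants in differential form: transported by the semigroup, a solution of the
forced equation changes only through the forcing. -/
theorem HasDerivWithinAt.exp_smul_apply {A : E →L[ℝ] E} {γ : ℝ → E} {u : E} {s : Set ℝ} {t : ℝ}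
    (h : HasDerivWithinAt γ (A (γ t) + u) s t) (a : ℝ) :
    HasDerivWithinAt (fun τ => NormedSpace.exp ((a - τ) • A) (γ τ))
      (NormedSpace.exp ((a - t) • A) u) s t := by
  have h1 : HasDerivWithinAt (fun τ : ℝ => NormedSpace.exp ((a - τ) • A))
      (-(NormedSpace.exp ((a - t) • A) * A)) s t := by
    have := (hasDerivAt_exp_smul_const A (a - t)).scomp t ((hasDerivAt_id t).const_sub a)
    simpa [Function.comp_def] using this.hasDerivWithinAt
  have h2 := h1.clm_apply h
  refine h2.congr_deriv ?_
  simp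

/-- The initial value decays at the rate `α`, and a forcing of size `ε` contributes at most
`∫ ε exp (-α s) ds = ε / α`. -/
theorem norm_le_of_forced_linear {A : E →L[ℝ] E} {α : ℝ} (hα : 0 < α) (hA : ExpContracting A α)
    {y u : ℝ → E} {t₀ ε : ℝ} (ht₀ : 0 ≤ t₀)
    (hy : IsForwardSolution (fun t x => A x + u t) y) (hu : ∀ t, t₀ ≤ t → ‖u t‖ ≤ ε)
    {t : ℝ} (ht : t₀ ≤ t) :
    ‖y t‖ ≤ Real.exp (-(α * (t - t₀))) * ‖y t₀‖ + ε / α := by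
  have hε : 0 ≤ ε := (norm_nonneg _).trans (hu t₀ le_rfl)
  have hd : ∀ s, t₀ ≤ s → HasDerivWithinAt (fun τ => NormedSpace.exp ((t - τ) • A) (y τ))
      (NormedSpace.exp ((t - s) • A) (u s)) (Set.Ici s) s := fun s hs =>
    ((hy s (ht₀.trans hs)).exp_smul_apply t).mono (Set.Ici_subset_Ici.2 (ht₀.trans hs))
  have hd' : ∀ s, t₀ ≤ s → ContinuousWithinAt (fun τ => NormedSpace.exp ((t - τ) • A) (y τ))
      (Set.Icc t₀ t) s := fun s hs =>
    (((hy s (ht₀.trans hs)).exp_smul_apply t).mono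
      (Set.Icc_subset_Ici_self.trans (Set.Ici_subset_Ici.2 ht₀))).continuousWithinAt
  have hB : ∀ s, HasDerivAt (fun s => Real.exp (-(α * (t - t₀))) * ‖y t₀‖
      + ε / α * (Real.exp (-(α * (t - s))) - Real.exp (-(α * (t - t₀)))))
      (ε * Real.exp (-(α * (t - s)))) s := by
    intro s
    have := (((((hasDerivAt_id s).const_sub t).const_mul α).neg.exp.sub_const
      (Real.exp (-(α * (t - t₀))))).const_mul (ε / α)).const_add
        (Real.exp (-(α * (t - t₀))) * ‖y t₀‖)
    refine this.congr_deriv ?_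
    simp only [Pi.neg_apply, id]
    field_simp
  have key := image_norm_le_of_norm_deriv_right_le_deriv_boundary' (a := t₀) (b := t)
    (fun s hs => hd' s hs.1) (fun s hs => hd s hs.1)
    (B := fun s => Real.exp (-(α * (t - t₀))) * ‖y t₀‖
      + ε / α * (Real.exp (-(α * (t - s))) - Real.exp (-(α * (t - t₀)))))
    (B' := fun s => ε * Real.exp (-(α * (t - s))))
    (by
      simp only [sub_self, mul_zero, add_zero]
      exact (ContinuousLinearMap.le_opNorm _ _).trans
        (mul_le_mul_of_nonneg_right (hA _ (sub_nonneg.2 ht)) (norm_nonneg _)))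
    (fun s _ => (hB s).continuousAt.continuousWithinAt)
    (fun s _ => (hB s).hasDerivWithinAt)
    (fun s hs => by
      rw [mul_comm ε]
      exact (ContinuousLinearMap.le_opNorm _ _).trans
        (mul_le_mul (hA _ (sub_nonneg.2 hs.2.le)) (hu s hs.1) (norm_nonneg _)
          (Real.exp_pos _).le))
    (Set.right_mem_Icc.2 ht)
  simp only [sub_self, zero_smul, NormedSpace.exp_zero, one_apply_eq_self, mul_zero,
    neg_zero, Real.exp_zero] at key
  have h1 : ε / α * (1 - Real.exp (-(α * (t - t₀)))) ≤ ε / α :=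
    mul_le_of_le_one_right (by positivity) (by linarith [Real.exp_pos (-(α * (t - t₀)))])
  linarith

theorem tendsto_exp_neg_mul_atTop {α : ℝ} (hα : 0 < α) (t₀ : ℝ) :
    Tendsto (fun t : ℝ => Real.exp (-(α * (t - t₀)))) atTop (𝓝 0) :=
  Real.tendsto_exp_neg_atTop_nhds_zero.comp
    ((tendsto_atTop_add_const_right _ (-t₀) tendsto_id).const_mul_atTop hα)

/-- A contracting linear equation with a forcing term that vanishes at infinity: the solution with
prescribed initial value vanishes at infinity. -/
theorem exists_forced_solution_of_contracting {A : E →L[ℝ] E} {α : ℝ} (hα : 0 < α)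
    (hA : ExpContracting A α) {u : ℝ → E} (hu : Continuous u) (hu0 : Tendsto u atTop (𝓝 0))
    {b : ℝ} (hb : ∀ t, ‖u t‖ ≤ b) (ξ : E) :
    ∃ y : ℝ → E, y 0 = ξ ∧ IsForwardSolution (fun t x => A x + u t) y ∧
      (∀ t, 0 ≤ t → ‖y t‖ ≤ ‖ξ‖ + b / α) ∧ Tendsto y atTop (𝓝 0) := by
  set G : ℝ → E := fun s => NormedSpace.exp ((-s) • A) (u s) with hG
  have hGc : Continuous G := ((continuous_exp_smul A).comp continuous_neg).clm_apply hu
  set y : ℝ → E := fun t => NormedSpace.exp (t • A) (ξ + ∫ s in (0 : ℝ)..t, G s) with hy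
  have hy0 : y 0 = ξ := by simp [hy]
  have hsol : IsForwardSolution (fun t x => A x + u t) y := by
    intro t _
    have h1 := (hasDerivAt_exp_smul_const' A t).clm_apply
      ((hGc.integral_hasStrictDerivAt 0 t).hasDerivAt.const_add ξ)
    refine (h1.congr_deriv ?_).hasDerivWithinAt
    simp only [hy, hG, mul_apply_eq_comp, exp_smul_exp_neg_smul]
  refine ⟨y, hy0, hsol, fun t ht => ?_, ?_⟩
  · have := norm_le_of_forced_linear hα hA le_rfl hsol (fun t _ => hb t) ht
    rw [hy0] at this
    refine this.trans ?_
    gcongr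
    exact mul_le_of_le_one_left (norm_nonneg _) (Real.exp_le_one_iff.2 (by simp; positivity))
  · rw [Metric.tendsto_atTop]
    intro ε hε
    -- from `t₁` on the forcing contributes at most `ε / 4`; from `t₂` on the value at `t₁` has
    -- decayed below `ε / 2`
    obtain ⟨t₀, ht₀⟩ := Metric.tendsto_atTop.1 hu0 (ε / 2 * α / 2) (by positivity)
    set t₁ := max t₀ 0
    have hlim := (tendsto_exp_neg_mul_atTop hα t₁).mul_const ‖y t₁‖
    rw [zero_mul] at hlim
    obtain ⟨t₂, ht₂⟩ := Metric.tendsto_atTop.1 hlim (ε / 2) (by positivity)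
    refine ⟨max t₁ t₂, fun t ht => ?_⟩
    have h1 := norm_le_of_forced_linear hα hA (le_max_right t₀ 0) hsol (ε := ε / 2 * α / 2)
      (fun s hs => by
        have := ht₀ s ((le_max_left _ _).trans hs)
        rw [dist_zero_right] at this
        exact this.le) ((le_max_left _ _).trans ht)
    have h2 := ht₂ t ((le_max_right _ _).trans ht)
    rw [dist_zero_right] at h2 ⊢
    have h3 := (le_abs_self _).trans_lt h2
    have h4 : ε / 2 * α / 2 / α = ε / 4 := by field_simp; norm_num
    rw [h4] at h1
    linarith

/-- An expanding linear equation with a forcing term that vanishes at infinity has a solution that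
vanishes at infinity: the forcing is integrated backwards from `t = ∞`. -/
theorem exists_forced_solution_of_expanding {A : E →L[ℝ] E} {α : ℝ} (hα : 0 < α)
    (hA : ExpContracting (-A) α) {u : ℝ → E} (hu : Continuous u) (hu0 : Tendsto u atTop (𝓝 0))
    {b : ℝ} (hb : ∀ t, ‖u t‖ ≤ b) :
    ∃ y : ℝ → E, IsForwardSolution (fun t x => A x + u t) y ∧
      (∀ t, 0 ≤ t → ‖y t‖ ≤ b / α) ∧ Tendsto y atTop (𝓝 0) := by
  set G : ℝ → E := fun s => NormedSpace.exp ((-s) • A) (u s) with hG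
  have hGc : Continuous G := ((continuous_exp_smul A).comp continuous_neg).clm_apply hu
  have hexp : ∀ r : ℝ, 0 ≤ r → ‖NormedSpace.exp ((-r) • A)‖ ≤ Real.exp (-(α * r)) := by
    intro r hr
    have := hA r hr
    rwa [smul_neg, ← neg_smul] at this
  have hintexp : ∀ t : ℝ, MeasureTheory.IntegrableOn (fun s => Real.exp (-α * s)) (Set.Ioi t) :=
    fun t => exp_neg_integrableOn_Ioi t hα
  have hGi : MeasureTheory.IntegrableOn G (Set.Ioi 0) := by
    refine ((hintexp 0).const_mul b).mono' hGc.aestronglyMeasurable ?_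
    refine (MeasureTheory.ae_restrict_mem measurableSet_Ioi).mono fun s hs => ?_
    rw [mul_comm b, neg_mul]
    exact (ContinuousLinearMap.le_opNorm _ _).trans
      (mul_le_mul (hexp s hs.le) (hb s) (norm_nonneg _) (Real.exp_pos _).le)
  set y : ℝ → E := fun t => -(NormedSpace.exp (t • A) (∫ s in Set.Ioi t, G s)) with hy
  -- only the forcing after time `t` enters `y t`, which gives both the bound and the limit
  have hbound : ∀ t, 0 ≤ t → ∀ ε, (∀ s, t ≤ s → ‖u s‖ ≤ ε) → ‖y t‖ ≤ ε / α := by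
    intro t ht ε hε
    have h1 : y t = -∫ s in Set.Ioi t, NormedSpace.exp (t • A) (G s) := by
      rw [hy]
      simp only
      rw [ContinuousLinearMap.integral_comp_comm]
      exact hGi.mono_set (Set.Ioi_subset_Ioi ht)
    have h2 : ∀ s, NormedSpace.exp (t • A) (G s) = NormedSpace.exp ((-(s - t)) • A) (u s) := by
      intro s
      rw [hG, neg_sub, sub_eq_add_neg, exp_add_smul]
      rfl
    rw [h1, norm_neg]
    have h3 : ∫ s in Set.Ioi t, ε * Real.exp (α * t) * Real.exp (-α * s) = ε / α := by
      rw [MeasureTheory.integral_const_mul, integral_exp_mul_Ioi (neg_lt_zero.2 hα)]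
      rw [neg_div_neg_eq, mul_div_assoc', mul_assoc, ← Real.exp_add]
      simp
    rw [← h3]
    refine MeasureTheory.norm_integral_le_of_norm_le ((hintexp t).const_mul _) ?_
    refine (MeasureTheory.ae_restrict_mem measurableSet_Ioi).mono fun s hs => ?_
    rw [h2, mul_assoc, ← Real.exp_add, mul_comm ε]
    refine (ContinuousLinearMap.le_opNorm _ _).trans
      (mul_le_mul ((hexp _ (sub_nonneg.2 (le_of_lt hs))).trans_eq ?_) (hε s (le_of_lt hs))
        (norm_nonneg _) (Real.exp_pos _).le)
    ring_nf
  refine ⟨y, fun t ht => ?_, fun t ht => hbound t ht b fun s _ => hb s, ?_⟩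
  · have h1 := ((hasDerivAt_exp_smul_const' A t).clm_apply
      ((hGc.integral_hasStrictDerivAt 0 t).hasDerivAt.const_sub
        (∫ s in Set.Ioi (0 : ℝ), G s))).neg.hasDerivWithinAt (s := Set.Ici 0)
    have h2 : ∀ τ ∈ Set.Ici (0 : ℝ), ∫ s in Set.Ioi τ, G s =
        (∫ s in Set.Ioi (0 : ℝ), G s) - ∫ s in (0 : ℝ)..τ, G s := by
      intro τ hτ
      rw [← intervalIntegral.integral_Ioi_sub_Ioi hGi hτ]
      abel
    have h3 : ∀ τ ∈ Set.Ici (0 : ℝ), y τ = -(NormedSpace.exp (τ • A)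
        ((∫ s in Set.Ioi (0 : ℝ), G s) - ∫ s in (0 : ℝ)..τ, G s)) := by
      intro τ hτ
      rw [hy, ← h2 τ hτ]
    refine (h1.congr_deriv ?_).congr h3 (h3 t ht)
    simp only [h3 t ht, mul_apply_eq_comp, map_neg, hG, exp_smul_exp_neg_smul]
    abel
  · rw [Metric.tendsto_atTop]
    intro ε hε
    obtain ⟨t₀, ht₀⟩ := Metric.tendsto_atTop.1 hu0 (ε * α / 2) (by positivity)
    refine ⟨max t₀ 0, fun t ht => ?_⟩
    have h1 := hbound t ((le_max_right _ _).trans ht) (ε * α / 2) (fun s hs => by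
      have := ht₀ s ((le_max_left _ _).trans (ht.trans hs))
      rw [dist_zero_right] at this
      exact this.le)
    have h4 : ε * α / 2 / α = ε / 2 := by field_simp
    rw [h4] at h1
    rw [dist_zero_right]
    linarith

theorem IsForwardSolution.eq_exp_smul {A : E →L[ℝ] E} {d : ℝ → E}
    (hd : IsForwardSolution (fun _ x => A x) d) {t : ℝ} (ht : 0 ≤ t) :
    NormedSpace.exp ((-t) • A) (d t) = d 0 := by
  have h : ∀ s, 0 ≤ s → HasDerivWithinAt (fun τ => NormedSpace.exp ((0 - τ) • A) (d τ)) 0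
      (Set.Ici 0) s := fun s hs => by
    have := HasDerivWithinAt.exp_smul_apply (u := 0) (by simpa using hd s hs) (A := A) 0
    simpa using this
  have := constant_of_has_deriv_right_zero (a := 0) (b := t)
    (f := fun τ => NormedSpace.exp ((0 - τ) • A) (d τ))
    (fun s hs => ((h s hs.1).mono Set.Icc_subset_Ici_self).continuousWithinAt)
    (fun s hs => (h s hs.1).mono (Set.Ici_subset_Ici.2 hs.1)) t (Set.right_mem_Icc.2 ht)
  simpa using this

theorem IsForwardSolution.eq_zero_of_initial {A : E →L[ℝ] E} {d : ℝ → E}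
    (hd : IsForwardSolution (fun _ x => A x) d) (h0 : d 0 = 0) {t : ℝ} (ht : 0 ≤ t) : d t = 0 := by
  rw [← exp_smul_exp_neg_smul A t (d t), hd.eq_exp_smul ht, h0, map_zero]

/-- Since `d 0 = exp (-t A) (d t)` and `exp (-t A)` contracts, `d 0` is the limit of vectors that
tend to `0`. -/
theorem IsForwardSolution.eq_zero_of_expanding {A : E →L[ℝ] E} {α : ℝ} (hα : 0 < α)
    (hA : ExpContracting (-A) α) {d : ℝ → E} (hd : IsForwardSolution (fun _ x => A x) d)
    (hlim : Tendsto d atTop (𝓝 0)) {t : ℝ} (ht : 0 ≤ t) : d t = 0 := by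
  refine hd.eq_zero_of_initial ?_ ht
  refine tendsto_nhds_unique (tendsto_const_nhds : Tendsto (fun _ : ℝ => d 0) atTop (𝓝 (d 0))) ?_
  refine squeeze_zero_norm' ((eventually_ge_atTop (0 : ℝ)).mono fun s hs => ?_)
    (tendsto_zero_iff_norm_tendsto_zero.1 hlim)
  rw [← hd.eq_exp_smul hs]
  have h1 := hA s hs
  rw [smul_neg, ← neg_smul] at h1
  refine (ContinuousLinearMap.le_opNorm _ _).trans (mul_le_of_le_one_left (norm_nonneg _) ?_)
  exact h1.trans (Real.exp_le_one_iff.2 (by simp; positivity))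

end LinearEquations

/-! ### Composition operators on functions vanishing at infinity -/

section Nemytskii

variable {X F : Type*} [TopologicalSpace X] [NormedAddCommGroup F]

theorem ZeroAtInftyContinuousMap.norm_le_iff {u : C₀(X, F)} {b : ℝ} (hb : 0 ≤ b) :
    ‖u‖ ≤ b ↔ ∀ x, ‖u x‖ ≤ b := by
  rw [← ZeroAtInftyContinuousMap.norm_toBCF_eq_norm, BoundedContinuousFunction.norm_le hb]
  rfl

theorem ZeroAtInftyContinuousMap.norm_apply_le (u : C₀(X, F)) (x : X) : ‖u x‖ ≤ ‖u‖ :=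
  (ZeroAtInftyContinuousMap.norm_le_iff (norm_nonneg u)).1 le_rfl x

variable [NormedSpace ℝ F]

/-- Evaluation at a point, as a continuous linear map on `C₀(X, F)`. -/
def evalZeroAtInfty (x : X) : C₀(X, F) →L[ℝ] F :=
  LinearMap.mkContinuous
    { toFun := fun u => u x
      map_add' := fun _ _ => rfl
      map_smul' := fun _ _ => rfl } 1
    fun u => by simpa using u.norm_apply_le x

/-- The composition (Nemytskii) operator `u ↦ f ∘ u` of a function with `f 0 = 0`. -/
def nemytskii (f : F → F) (hf : Continuous f) (h0 : f 0 = 0) (u : C₀(X, F)) : C₀(X, F) where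
  toFun := fun x => f (u x)
  continuous_toFun := hf.comp u.continuous
  zero_at_infty' := by
    have h := (hf.tendsto 0).comp u.zero_at_infty'
    rw [h0] at h
    exact h

/-- The operator `k ↦ (x ↦ L (u x) (k x))` of pointwise application of a bounded continuous
family of linear maps along `u`. -/
def pointwiseApply (L : F → F →L[ℝ] F) (hL : Continuous L) (b : ℝ) (hb : ∀ z, ‖L z‖ ≤ b)
    (u : C₀(X, F)) : C₀(X, F) →L[ℝ] C₀(X, F) :=
  LinearMap.mkContinuous
    { toFun := fun k =>
        { toFun := fun x => L (u x) (k x)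
          continuous_toFun := (hL.comp u.continuous).clm_apply k.continuous
          zero_at_infty' := by
            have h := (tendsto_zero_iff_norm_tendsto_zero.1 k.zero_at_infty').const_mul b
            rw [mul_zero] at h
            exact squeeze_zero_norm (fun x => (L (u x)).le_of_opNorm_le (hb _) _) h }
      map_add' := fun k l => by ext x; exact map_add (L (u x)) (k x) (l x)
      map_smul' := fun c k => by ext x; exact map_smul (L (u x)) c (k x) } b
    fun k => by
      have hb0 : 0 ≤ b := (norm_nonneg _).trans (hb 0)
      refine (ZeroAtInftyContinuousMap.norm_le_iff (by positivity)).2 fun x => ?_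
      exact ((L (u x)).le_of_opNorm_le (hb _) _).trans
        (mul_le_mul_of_nonneg_left (k.norm_apply_le x) hb0)

theorem pointwiseApply_apply (L : F → F →L[ℝ] F) (hL : Continuous L) (b : ℝ)
    (hb : ∀ z, ‖L z‖ ≤ b) (u k : C₀(X, F)) (x : X) :
    pointwiseApply L hL b hb u k x = L (u x) (k x) := rfl

theorem norm_pointwiseApply_zero_le [Nonempty X] (L : F → F →L[ℝ] F) (hL : Continuous L) (b : ℝ)
    (hb : ∀ z, ‖L z‖ ≤ b) : ‖pointwiseApply (X := X) L hL b hb 0‖ ≤ ‖L 0‖ := by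
  refine ContinuousLinearMap.opNorm_le_bound _ (norm_nonneg _) fun k => ?_
  refine (ZeroAtInftyContinuousMap.norm_le_iff (by positivity)).2 fun x => ?_
  rw [pointwiseApply_apply]
  exact ((L 0).le_opNorm _).trans (mul_le_mul_of_nonneg_left (k.norm_apply_le x) (norm_nonneg _))

/-- The composition operator of a `C¹` function is `C¹`, if the derivative is bounded and uniformly
continuous. -/
theorem hasFDerivAt_nemytskii {f : F → F} (hf : ContDiff ℝ 1 f) (h0 : f 0 = 0)
    (hu : UniformContinuous (fderiv ℝ f)) {b : ℝ} (hb : ∀ z, ‖fderiv ℝ f z‖ ≤ b) (u : C₀(X, F)) :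
    HasFDerivAt (nemytskii (X := X) f hf.continuous h0)
      (pointwiseApply (fderiv ℝ f) (hf.continuous_fderiv one_ne_zero) b hb u) u := by
  rw [hasFDerivAt_iff_isLittleO_nhds_zero, Asymptotics.isLittleO_iff]
  intro ε hε
  obtain ⟨δ, hδ, hδε⟩ := Metric.uniformContinuous_iff.1 hu ε hε
  filter_upwards [Metric.ball_mem_nhds (0 : C₀(X, F)) hδ] with k hk
  rw [mem_ball_zero_iff] at hk
  refine (ZeroAtInftyContinuousMap.norm_le_iff (by positivity)).2 fun x => ?_
  have hball : ∀ z ∈ Metric.ball (u x) δ, ‖fderiv ℝ f z - fderiv ℝ f (u x)‖ ≤ ε := fun z hz => by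
    rw [← dist_eq_norm]
    exact (hδε hz).le
  have key := Convex.norm_image_sub_le_of_norm_fderiv_le' (𝕜 := ℝ) (f := f)
    (fun z _ => (hf.differentiable one_ne_zero) z) hball
    (convex_ball _ _) (Metric.mem_ball_self hδ)
    (y := u x + k x) (by simpa using (k.norm_apply_le x).trans_lt hk)
  rw [add_sub_cancel_left] at key
  exact key.trans (mul_le_mul_of_nonneg_left (k.norm_apply_le x) hε.le)

theorem continuous_pointwiseApply {L : F → F →L[ℝ] F} (hL : UniformContinuous L) {b : ℝ}
    (hb : ∀ z, ‖L z‖ ≤ b) : Continuous (pointwiseApply (X := X) L hL.continuous b hb) := by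
  refine (Metric.continuous_iff (α := C₀(X, F)) (β := C₀(X, F) →L[ℝ] C₀(X, F))).2 fun u ε hε => ?_
  obtain ⟨δ, hδ, hδε⟩ := Metric.uniformContinuous_iff.1 hL (ε / 2) (half_pos hε)
  refine ⟨δ, hδ, fun v hv => ?_⟩
  refine lt_of_le_of_lt ?_ (half_lt_self hε)
  rw [dist_eq_norm] at hv
  refine (dist_eq_norm (E := C₀(X, F) →L[ℝ] C₀(X, F)) _ _).trans_le ?_
  refine ContinuousLinearMap.opNorm_le_bound _ (half_pos hε).le fun k => ?_
  refine (ZeroAtInftyContinuousMap.norm_le_iff (by positivity)).2 fun x => ?_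
  have h1 : ‖L (v x) - L (u x)‖ ≤ ε / 2 := by
    rw [← dist_eq_norm]
    refine (hδε ?_).le
    rw [dist_eq_norm]
    exact ((v - u).norm_apply_le x).trans_lt hv
  have h2 : (pointwiseApply L hL.continuous b hb v - pointwiseApply L hL.continuous b hb u) k x
      = (L (v x) - L (u x)) (k x) := rfl
  rw [h2]
  exact ((L (v x) - L (u x)).le_of_opNorm_le h1 _).trans
    (mul_le_mul_of_nonneg_left (k.norm_apply_le x) (half_pos hε).le)

theorem contDiff_nemytskii {f : F → F} (hf : ContDiff ℝ 1 f) (h0 : f 0 = 0)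
    (hu : UniformContinuous (fderiv ℝ f)) {b : ℝ} (hb : ∀ z, ‖fderiv ℝ f z‖ ≤ b) :
    ContDiff ℝ 1 (nemytskii (X := X) f hf.continuous h0) :=
  contDiff_one_iff_hasFDerivAt.2 ⟨_, continuous_pointwiseApply hu hb,
    hasFDerivAt_nemytskii hf h0 hu hb⟩

end Nemytskii

/-- A function that is `C¹` near `0` agrees near `0` with a `C¹` function of compact support. -/
theorem ContDiffAt.exists_hasCompactSupport {F G : Type*} [NormedAddCommGroup F] [NormedSpace ℝ F]
    [FiniteDimensional ℝ F] [NormedAddCommGroup G] [NormedSpace ℝ G] {f : F → G}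
    (hf : ContDiffAt ℝ 1 f 0) :
    ∃ g : F → G, ContDiff ℝ 1 g ∧ HasCompactSupport g ∧ g =ᶠ[𝓝 0] f := by
  obtain ⟨ε, hε, hball⟩ := Metric.eventually_nhds_iff_ball.1 (hf.eventually (by simp))
  let χ : ContDiffBump (0 : F) := ⟨ε / 4, ε / 2, by positivity, by linarith⟩
  refine ⟨fun z => χ z • f z, contDiff_iff_contDiffAt.2 fun z => ?_, χ.hasCompactSupport.smul_right,
    χ.eventuallyEq_one.mono fun z hz => by simp [hz]⟩
  by_cases hz : z ∈ Metric.ball (0 : F) ε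
  · exact χ.contDiffAt.smul (hball z hz)
  · have h1 : z ∉ tsupport χ := by
      rw [χ.tsupport_eq]
      intro h
      refine hz (Metric.closedBall_subset_ball ?_ h)
      change ε / 2 < ε
      linarith
    have h2 : (fun z => χ z • f z) =ᶠ[𝓝 z] fun _ => 0 := by
      filter_upwards [(isClosed_tsupport χ).isOpen_compl.mem_nhds h1] with y hy
      rw [image_eq_zero_of_notMem_tsupport hy, zero_smul]
    exact contDiffAt_const.congr_of_eventuallyEq h2

/-! ### The local stable manifold of a hyperbolic equilibrium -/

section HalfLine

variable {F : Type*} [NormedAddCommGroup F]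

/-- A function on `[0, ∞)` vanishing at infinity, extended to `ℝ` by its value at `0`. -/
def extendHalfLine (u : C₀(ℝ≥0, F)) (t : ℝ) : F := u t.toNNReal

theorem continuous_extendHalfLine (u : C₀(ℝ≥0, F)) : Continuous (extendHalfLine u) :=
  u.continuous.comp continuous_real_toNNReal

theorem tendsto_extendHalfLine (u : C₀(ℝ≥0, F)) : Tendsto (extendHalfLine u) atTop (𝓝 0) := by
  have h := u.zero_at_infty'
  rw [cocompact_eq_atTop] at h
  exact h.comp tendsto_real_toNNReal_atTop

theorem norm_extendHalfLine_le (u : C₀(ℝ≥0, F)) (t : ℝ) : ‖extendHalfLine u t‖ ≤ ‖u‖ :=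
  u.norm_apply_le _

/-- The restriction to `[0, ∞)` of a function that vanishes at `+∞`. -/
def restrictHalfLine (y : ℝ → F) (hy : ContinuousOn y (Set.Ici 0))
    (hlim : Tendsto y atTop (𝓝 0)) : C₀(ℝ≥0, F) where
  toFun := fun x => y x
  continuous_toFun := hy.comp_continuous NNReal.continuous_coe fun x => x.2
  zero_at_infty' := by
    rw [cocompact_eq_atTop]
    exact hlim.comp (NNReal.tendsto_coe_atTop.2 tendsto_id)

theorem extendHalfLine_restrictHalfLine {y : ℝ → F} (hy : ContinuousOn y (Set.Ici 0))
    (hlim : Tendsto y atTop (𝓝 0)) {t : ℝ} (ht : 0 ≤ t) :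
    extendHalfLine (restrictHalfLine y hy hlim) t = y t := by
  change y (t.toNNReal : ℝ) = y t
  rw [Real.coe_toNNReal t ht]

theorem ext_of_extendHalfLine {u v : C₀(ℝ≥0, F)}
    (h : ∀ t, 0 ≤ t → extendHalfLine u t = extendHalfLine v t) : u = v := by
  ext x
  have := h x x.2
  simpa [extendHalfLine] using this

variable [NormedSpace ℝ F]

theorem IsForwardSolution.continuousOn {Y : ℝ → F → F} {γ : ℝ → F} (h : IsForwardSolution Y γ) :
    ContinuousOn γ (Set.Ici 0) := fun t ht => (h t ht).continuousWithinAt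

theorem IsForwardSolution.congr {Y Y' : ℝ → F → F} {γ γ' : ℝ → F} (h : IsForwardSolution Y γ)
    (hγ : ∀ t, 0 ≤ t → γ' t = γ t) (hY : ∀ t, 0 ≤ t → Y' t (γ t) = Y t (γ t)) :
    IsForwardSolution Y' γ' := fun t ht => by
  rw [hγ t ht, hY t ht]
  exact (h t ht).congr (fun s hs => hγ s hs) (hγ t ht)

end HalfLine

section StableManifold

variable {Es Eu : Type*} [NormedAddCommGroup Es] [NormedSpace ℝ Es] [CompleteSpace Es]
  [NormedAddCommGroup Eu] [NormedSpace ℝ Eu] [CompleteSpace Eu]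
  {As : Es →L[ℝ] Es} {Au : Eu →L[ℝ] Eu} {α : ℝ}

/-- `y` is the solution of `y' = (As ⊕ Au) y + u` that vanishes at infinity and has the stable
component `ξ` at time `0`. Curves on `[0, ∞)` that vanish at infinity are elements of
`C₀(ℝ≥0, Es × Eu)`. -/
def IsGreenSolution (As : Es →L[ℝ] Es) (Au : Eu →L[ℝ] Eu) (ξ : Es) (u y : C₀(ℝ≥0, Es × Eu)) :
    Prop :=
  (extendHalfLine y 0).1 = ξ ∧
    IsForwardSolution (fun t x => As.prodMap Au x + extendHalfLine u t) (extendHalfLine y)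

theorem exists_isGreenSolution (hα : 0 < α) (hs : ExpContracting As α)
    (hu : ExpContracting (-Au) α) (ξ : Es) (u : C₀(ℝ≥0, Es × Eu)) :
    ∃ y, IsGreenSolution As Au ξ u y ∧ ‖y‖ ≤ ‖ξ‖ + ‖u‖ / α := by
  have hc := continuous_extendHalfLine u
  have hl := tendsto_extendHalfLine u
  have hn := norm_extendHalfLine_le u
  obtain ⟨y₁, h0, h1, hb1, hl1⟩ := exists_forced_solution_of_contracting hα hs
    (continuous_fst.comp hc) ((continuous_fst.tendsto _).comp hl)
    (fun t => (norm_fst_le _).trans (hn t)) ξ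
  obtain ⟨y₂, h2, hb2, hl2⟩ := exists_forced_solution_of_expanding hα hu
    (continuous_snd.comp hc) ((continuous_snd.tendsto _).comp hl)
    (fun t => (norm_snd_le _).trans (hn t))
  have hsol : IsForwardSolution (fun t x => As.prodMap Au x + extendHalfLine u t)
      (fun t => (y₁ t, y₂ t)) := fun t ht => (h1 t ht).prodMk (h2 t ht)
  have hlim : Tendsto (fun t => (y₁ t, y₂ t)) atTop (𝓝 (0 : Es × Eu)) := hl1.prodMk_nhds hl2
  have hext := fun (t : ℝ) (ht : 0 ≤ t) => extendHalfLine_restrictHalfLine hsol.continuousOn hlim ht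
  refine ⟨restrictHalfLine _ hsol.continuousOn hlim, ⟨?_, hsol.congr hext fun _ _ => rfl⟩,
    (ZeroAtInftyContinuousMap.norm_le_iff (by positivity)).2 fun x => ?_⟩
  · rw [hext 0 le_rfl, h0]
  · refine max_le (hb1 x x.2) ((hb2 x x.2).trans ?_)
    exact le_add_of_nonneg_left (norm_nonneg _)

theorem IsGreenSolution.unique (hα : 0 < α) (hu : ExpContracting (-Au) α) {ξ : Es}
    {u y z : C₀(ℝ≥0, Es × Eu)} (hy : IsGreenSolution As Au ξ u y)
    (hz : IsGreenSolution As Au ξ u z) : y = z := by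
  have hd : ∀ t : ℝ, 0 ≤ t → HasDerivWithinAt (fun t => extendHalfLine y t - extendHalfLine z t)
      (As.prodMap Au (extendHalfLine y t - extendHalfLine z t)) (Set.Ici 0) t := fun t ht => by
    refine ((hy.2 t ht).sub (hz.2 t ht)).congr_deriv ?_
    rw [map_sub]
    exact add_sub_add_right_eq_sub _ _ _
  have h1 : IsForwardSolution (fun _ x => As x)
      (fun t => (extendHalfLine y t - extendHalfLine z t).1) := fun t ht =>
    (ContinuousLinearMap.fst ℝ Es Eu).hasFDerivAt.comp_hasDerivWithinAt t (hd t ht)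
  have h2 : IsForwardSolution (fun _ x => Au x)
      (fun t => (extendHalfLine y t - extendHalfLine z t).2) := fun t ht =>
    (ContinuousLinearMap.snd ℝ Es Eu).hasFDerivAt.comp_hasDerivWithinAt t (hd t ht)
  have hlim : Tendsto (fun t => (extendHalfLine y t - extendHalfLine z t).2) atTop (𝓝 0) := by
    have := (continuous_snd.tendsto _).comp
      ((tendsto_extendHalfLine y).sub (tendsto_extendHalfLine z))
    rwa [sub_zero] at this
  refine ext_of_extendHalfLine fun t ht => sub_eq_zero.1 (Prod.ext ?_ ?_)
  · exact h1.eq_zero_of_initial (by simp [hy.1, hz.1]) ht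
  · exact h2.eq_zero_of_expanding hα hu hlim ht

/-- The solution operator `(ξ, u) ↦ S ξ + T u` of the inhomogeneous linear equation. -/
theorem exists_green_operator (hα : 0 < α) (hs : ExpContracting As α)
    (hu : ExpContracting (-Au) α) :
    ∃ (S : Es →L[ℝ] C₀(ℝ≥0, Es × Eu)) (T : C₀(ℝ≥0, Es × Eu) →L[ℝ] C₀(ℝ≥0, Es × Eu)),
      ‖T‖ ≤ 1 / α ∧ ∀ ξ u y, IsGreenSolution As Au ξ u y ↔ y = S ξ + T u := by
  choose y hy hyn using exists_isGreenSolution hα hs hu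
  have hadd : ∀ ξ ξ' u u', y (ξ + ξ') (u + u') = y ξ u + y ξ' u' := fun ξ ξ' u u' => by
    refine (hy _ _).unique hα hu ⟨?_, fun t ht => ?_⟩
    · exact congrArg₂ (· + ·) (hy ξ u).1 (hy ξ' u').1
    · refine (((hy ξ u).2 t ht).add ((hy ξ' u').2 t ht)).congr_deriv ?_
      change _ = As.prodMap Au (extendHalfLine (y ξ u) t + extendHalfLine (y ξ' u') t)
        + (extendHalfLine u t + extendHalfLine u' t)
      rw [map_add]
      exact add_add_add_comm _ _ _ _
  have hsmul : ∀ (a : ℝ) ξ u, y (a • ξ) (a • u) = a • y ξ u := fun a ξ u => by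
    refine (hy _ _).unique hα hu ⟨?_, fun t ht => ?_⟩
    · exact congrArg (a • ·) (hy ξ u).1
    · refine (((hy ξ u).2 t ht).const_smul a).congr_deriv ?_
      change _ = As.prodMap Au (a • extendHalfLine (y ξ u) t) + a • extendHalfLine u t
      rw [map_smul, smul_add]
  let S : Es →L[ℝ] C₀(ℝ≥0, Es × Eu) := LinearMap.mkContinuous
    { toFun := fun ξ => y ξ 0
      map_add' := fun ξ ξ' => by simpa using hadd ξ ξ' 0 0
      map_smul' := fun a ξ => by simpa using hsmul a ξ 0 } 1
    fun ξ => by simpa using hyn ξ 0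
  let T : C₀(ℝ≥0, Es × Eu) →L[ℝ] C₀(ℝ≥0, Es × Eu) := LinearMap.mkContinuous
    { toFun := fun u => y 0 u
      map_add' := fun u u' => by simpa using hadd 0 0 u u'
      map_smul' := fun a u => by simpa using hsmul a 0 u } (1 / α)
    fun u => by simpa [div_eq_inv_mul] using hyn 0 u
  have hST : ∀ ξ u, y ξ u = S ξ + T u := fun ξ u => by simpa [S, T] using hadd ξ 0 0 u
  refine ⟨S, T, LinearMap.mkContinuous_norm_le _ (by positivity) _, fun ξ u z => ⟨fun h => ?_, ?_⟩⟩
  · rw [← hST]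
    exact h.unique hα hu (hy ξ u)
  · rintro rfl
    rw [← hST]
    exact hy ξ u

end StableManifold

section StableManifold

variable {Es Eu : Type*} [NormedAddCommGroup Es] [NormedSpace ℝ Es] [FiniteDimensional ℝ Es]
  [NormedAddCommGroup Eu] [NormedSpace ℝ Eu] [FiniteDimensional ℝ Eu]
  {As : Es →L[ℝ] Es} {Au : Eu →L[ℝ] Eu} {α : ℝ}

/-- The local stable manifold theorem. The vector field `Y` need only be close to the split
linear field `As ⊕ Au` to first order at `0`. The stable manifold is the graph of `g`: every
point of the graph near `0` has a forward orbit that stays small and converges to `0`, and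
every such orbit starts on the graph.

After a cutoff, the orbits that converge to `0` are the solutions `x` in `C₀([0, ∞))` of the
Lyapunov-Perron equation `x = S ξ + T (f ∘ x)`, where `f` is the difference of the two fields. The
operator `x ↦ x - T (f ∘ x)` is `C¹` with invertible derivative at `0`, so that the inverse
function theorem gives existence, uniqueness and smoothness at once. -/
theorem exists_localStableManifold (hα : 0 < α) (hs : ExpContracting As α)
    (hu : ExpContracting (-Au) α) {Y : Es × Eu → Es × Eu} (hY : ContDiffAt ℝ 1 Y 0)
    (hY0 : Y 0 = 0) (hlin : ‖fderiv ℝ Y 0 - As.prodMap Au‖ < α) :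
    ∃ (ρ δ : ℝ) (g : Es → Eu), 0 < ρ ∧ 0 < δ ∧ g 0 = 0 ∧ ContDiffOn ℝ 1 g (Metric.ball 0 ρ) ∧
      (∀ ε > 0, ∃ ρ' > 0, ∀ ξ : Es, ‖ξ‖ < ρ' → ∃ γ : ℝ → Es × Eu, γ 0 = (ξ, g ξ) ∧
        IsForwardSolution (fun _ => Y) γ ∧ (∀ t, 0 ≤ t → ‖γ t‖ < ε) ∧
        Tendsto γ atTop (𝓝 0)) ∧
      (∀ γ : ℝ → Es × Eu, IsForwardSolution (fun _ => Y) γ → (∀ t, 0 ≤ t → ‖γ t‖ < δ) →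
        Tendsto γ atTop (𝓝 0) → (γ 0).2 = g (γ 0).1) := by
  have := FiniteDimensional.complete ℝ Es
  have := FiniteDimensional.complete ℝ Eu
  set A : Es × Eu →L[ℝ] Es × Eu := As.prodMap Au with hA
  obtain ⟨f, hf, hfc, hfY⟩ := (hY.sub A.contDiff.contDiffAt).exists_hasCompactSupport
  have hf0 : f 0 = 0 := by rw [hfY.self_of_nhds]; simp [hY0]
  have hf' : ‖fderiv ℝ f 0‖ < α := by
    rw [hfY.fderiv_eq]
    have h1 : fderiv ℝ (fun z => Y z - A z) 0 = fderiv ℝ Y 0 - A := by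
      rw [fderiv_fun_sub (hY.differentiableAt one_ne_zero) A.differentiableAt, A.fderiv]
    rwa [h1]
  have hfu : UniformContinuous (fderiv ℝ f) :=
    (hfc.fderiv ℝ).uniformContinuous_of_continuous (hf.continuous_fderiv one_ne_zero)
  obtain ⟨b, hb⟩ := (hf.continuous_fderiv one_ne_zero).bounded_above_of_compact_support
    (hfc.fderiv ℝ)
  obtain ⟨S, T, hT, hST⟩ := exists_green_operator hα hs hu
  set N : C₀(ℝ≥0, Es × Eu) → C₀(ℝ≥0, Es × Eu) := nemytskii f hf.continuous hf0 with hN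
  have hNd : ContDiff ℝ 1 N := contDiff_nemytskii hf hf0 hfu hb
  set D := pointwiseApply (X := ℝ≥0) (fderiv ℝ f) (hf.continuous_fderiv one_ne_zero) b hb 0
  have hND : HasFDerivAt N D 0 := hasFDerivAt_nemytskii hf hf0 hfu hb 0
  have hTD : ‖T ∘L D‖ < 1 := by
    refine (ContinuousLinearMap.opNorm_comp_le T D).trans_lt ?_
    calc ‖T‖ * ‖D‖ ≤ 1 / α * ‖fderiv ℝ f 0‖ :=
          mul_le_mul hT (norm_pointwiseApply_zero_le _ _ _ _) D.opNorm_nonneg (by positivity)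
      _ < 1 / α * α := by gcongr
      _ = 1 := by field_simp
  -- the fixed point equation `x = S ξ + T (f ∘ x)` is inverted near `x = 0`
  set Ψ : C₀(ℝ≥0, Es × Eu) → C₀(ℝ≥0, Es × Eu) := fun x => x - T (N x) with hΨ
  have hΨd : ContDiff ℝ 1 Ψ := contDiff_id.sub (T.contDiff.comp hNd)
  let e : C₀(ℝ≥0, Es × Eu) ≃L[ℝ] C₀(ℝ≥0, Es × Eu) :=
    ContinuousLinearEquiv.unitsEquiv _ _ (Units.oneSub (T ∘L D) hTD)
  have hΨe : HasFDerivAt Ψ (e : C₀(ℝ≥0, Es × Eu) →L[ℝ] C₀(ℝ≥0, Es × Eu)) 0 :=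
    (hasFDerivAt_id _).sub (T.hasFDerivAt.comp _ hND)
  have hN0 : N 0 = 0 := by ext1 x; exact hf0
  have hΨ0 : Ψ 0 = 0 := by simp [hΨ, hN0]
  set H := hΨd.contDiffAt.toOpenPartialHomeomorph Ψ hΨe one_ne_zero with hH
  have hHc : ∀ x, H x = Ψ x := fun x => rfl
  have hsrc : H.source ∈ 𝓝 0 := H.open_source.mem_nhds
    (hΨd.contDiffAt.mem_toOpenPartialHomeomorph_source hΨe one_ne_zero)
  have htgt : H.target ∈ 𝓝 0 := by
    have := hΨd.contDiffAt.image_mem_toOpenPartialHomeomorph_target hΨe one_ne_zero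
    rw [hΨ0] at this
    exact H.open_target.mem_nhds this
  have hsymm0 : H.symm 0 = 0 := by
    have := H.left_inv (mem_of_mem_nhds hsrc)
    rwa [hHc, hΨ0] at this
  have hsymm : ContDiffAt ℝ 1 H.symm 0 := by
    have := hΨd.contDiffAt.to_localInverse hΨe one_ne_zero
    rw [hΨ0] at this
    exact this
  have hS0 : Tendsto S (𝓝 0) (𝓝 0) := by simpa using S.continuous.tendsto 0
  have hcont : Tendsto (fun ξ => H.symm (S ξ)) (𝓝 0) (𝓝 0) := by
    have h1 := hsymm.continuousAt.tendsto.comp hS0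
    rwa [hsymm0] at h1
  obtain ⟨η, hη, hηf⟩ := Metric.eventually_nhds_iff_ball.1 hfY
  simp only [mem_ball_zero_iff] at hηf
  obtain ⟨ρ, hρ, hρd⟩ := Metric.eventually_nhds_iff_ball.1
    (hS0.eventually (hsymm.eventually (by simp)))
  obtain ⟨δ, hδ, hδsrc⟩ := Metric.mem_nhds_iff.1 hsrc
  set g : Es → Eu := fun ξ => (evalZeroAtInfty (0 : ℝ≥0) (H.symm (S ξ))).2 with hg
  refine ⟨ρ, min (δ / 2) η, g, hρ, by positivity, by simp [hg, hsymm0], fun ξ hξ => ?_, ?_, ?_⟩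
  · exact (contDiff_snd.contDiffAt.comp ξ ((evalZeroAtInfty (0 : ℝ≥0)).contDiff.contDiffAt.comp ξ
      ((hρd ξ hξ).comp ξ S.contDiff.contDiffAt))).contDiffWithinAt
  · intro ε hε
    obtain ⟨ρ', hρ', hball⟩ := Metric.eventually_nhds_iff_ball.1
      ((hcont.eventually (Metric.ball_mem_nhds 0 (lt_min hε hη))).and (hS0.eventually htgt))
    refine ⟨ρ', hρ', fun ξ hξ => ?_⟩
    obtain ⟨h1, h2⟩ := hball ξ (mem_ball_zero_iff.2 hξ)
    rw [dist_zero_right] at h1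
    set x := H.symm (S ξ) with hx
    have hxeq : x = S ξ + T (N x) := by
      have h3 : Ψ x = S ξ := H.right_inv h2
      rw [← h3]
      exact (sub_add_cancel _ _).symm
    obtain ⟨hx0, hxs⟩ := (hST ξ (N x) x).2 hxeq
    have hsmall := fun t => (norm_extendHalfLine_le x t).trans_lt h1
    refine ⟨extendHalfLine x, Prod.ext hx0 ?_, hxs.congr (fun _ _ => rfl) fun t _ => ?_,
      fun t _ => (hsmall t).trans_le (min_le_left _ _), tendsto_extendHalfLine x⟩
    · change (x (Real.toNNReal 0)).2 = (x 0).2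
      rw [Real.toNNReal_zero]
    · change _ = A (extendHalfLine x t) + f (extendHalfLine x t)
      rw [hηf _ ((hsmall t).trans_le (min_le_right _ _))]
      simp
  · intro γ hγ hsmall hlim
    -- the cutoff does not affect an orbit that stays small, so it solves the fixed point equation
    set x := restrictHalfLine γ hγ.continuousOn hlim with hx
    have hext := fun (t : ℝ) (ht : 0 ≤ t) =>
      extendHalfLine_restrictHalfLine hγ.continuousOn hlim ht
    have hG : IsGreenSolution As Au (γ 0).1 (N x) x := by
      refine ⟨by rw [hx, hext 0 le_rfl], hγ.congr hext fun t ht => ?_⟩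
      change A (γ t) + f (extendHalfLine x t) = Y (γ t)
      rw [hx, hext t ht, hηf _ ((hsmall t ht).trans_le (min_le_right _ _))]
      simp
    have hxeq := (hST _ _ _).1 hG
    have hΨx : Ψ x = S (γ 0).1 := by
      rw [hΨ]
      exact sub_eq_of_eq_add hxeq
    have hxsrc : x ∈ H.source := by
      refine hδsrc (mem_ball_zero_iff.2 (lt_of_le_of_lt ?_ (half_lt_self hδ)))
      exact (ZeroAtInftyContinuousMap.norm_le_iff (by positivity)).2 fun s =>
        ((hsmall s s.2).le.trans (min_le_left _ _))
    have hxx : H.symm (S (γ 0).1) = x := by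
      rw [← hΨx, ← hHc]
      exact H.left_inv hxsrc
    change (γ 0).2 = (H.symm (S (γ 0).1) 0).2
    rw [hxx]
    rfl

end StableManifold

/-! ### Dissipative operators -/

section Dissipative

variable {E : Type*} [NormedAddCommGroup E] [InnerProductSpace ℝ E] [CompleteSpace E]

/-- Along a solution of `y' = A y` the function `‖y‖² exp (2 α t)` does not increase. -/
theorem ExpContracting.of_inner_le {A : E →L[ℝ] E} {α : ℝ}
    (hA : ∀ x, inner ℝ (A x) x ≤ -(α * ‖x‖ ^ 2)) : ExpContracting A α := by
  intro t ht
  refine ContinuousLinearMap.opNorm_le_bound _ (Real.exp_pos _).le fun x => ?_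
  set y : ℝ → E := fun s => NormedSpace.exp (s • A) x with hy
  have hyd : ∀ s, HasDerivAt y (A (y s)) s := fun s => by
    simpa using (hasDerivAt_exp_smul_const' A s).clm_apply (hasDerivAt_const s x)
  have hd : ∀ s, HasDerivAt (fun s => ‖y s‖ ^ 2 * Real.exp (2 * α * s))
      (2 * inner ℝ (y s) (A (y s)) * Real.exp (2 * α * s)
        + ‖y s‖ ^ 2 * (Real.exp (2 * α * s) * (2 * α))) s := fun s => by
    have h2 := ((hasDerivAt_id s).const_mul (2 * α)).exp
    simp only [id, mul_one] at h2
    exact (hyd s).norm_sq.mul h2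
  have hanti : Antitone fun s => ‖y s‖ ^ 2 * Real.exp (2 * α * s) := by
    refine antitone_of_deriv_nonpos (fun s => (hd s).differentiableAt) fun s => ?_
    rw [(hd s).deriv, real_inner_comm]
    have h1 := mul_le_mul_of_nonneg_right (hA (y s)) (Real.exp_pos (2 * α * s)).le
    linarith
  have h0 := hanti ht
  simp only [hy, zero_smul, NormedSpace.exp_zero, one_apply_eq_self, mul_zero, Real.exp_zero,
    mul_one] at h0
  refine (sq_le_sq₀ (norm_nonneg _) (by positivity)).1 ?_
  rw [mul_pow, ← Real.exp_nat_mul]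
  have h3 : Real.exp (((2 : ℕ) : ℝ) * -(α * t)) * Real.exp (2 * α * t) = 1 := by
    rw [← Real.exp_add, Real.exp_eq_one_iff]
    push_cast
    ring
  have h4 := mul_le_mul_of_nonneg_left h0 (Real.exp_pos (((2 : ℕ) : ℝ) * -(α * t))).le
  refine le_of_eq_of_le ?_ h4
  linear_combination (-‖NormedSpace.exp (t • A) x‖ ^ 2) * h3

end Dissipative

/-! ### Stable manifolds in a chart -/

section Chart

variable {E : Type*} [NormedAddCommGroup E] [NormedSpace ℝ E] {k : ℕ}
  {Eu : Type*} [NormedAddCommGroup Eu] [NormedSpace ℝ Eu] [FiniteDimensional ℝ Eu]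

/-- Near `P` let the phase space `S` be the part `0 ≤ r` of a hypersurface, parametrized by `Φ`,
with an affine inverse `p ↦ L (p - P)`, and invariant under `X`. If the vector field in the chart is
hyperbolic with stable dimension `k`, and if the sign of `r` along an orbit converging to `P` is
decided by the linear form `ℓ` of the stable coordinates at time `0`, then the stable manifold of
`P` in `S` has dimension `k`. -/
theorem StableManifoldHasDim.of_chart {X : E → E} {S : Set E} {P : E}
    {Φ : EuclideanSpace ℝ (Fin k) × Eu → E} {L : E →L[ℝ] EuclideanSpace ℝ (Fin k) × Eu}
    {r : E → ℝ} (ℓ : EuclideanSpace ℝ (Fin k) →ₗ[ℝ] ℝ)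
    {As : EuclideanSpace ℝ (Fin k) →L[ℝ] EuclideanSpace ℝ (Fin k)} {Au : Eu →L[ℝ] Eu} {α : ℝ}
    (hα : 0 < α) (hs : ExpContracting As α) (hu : ExpContracting (-Au) α)
    (hX : ContDiffAt ℝ 1 X P) (hX0 : X P = 0)
    (hΦ : ContDiffAt ℝ 1 Φ 0) (hΦ0 : Φ 0 = P) (hL : ∀ z, L (Φ z - P) = z)
    (hlin : ‖fderiv ℝ (fun z => L (X (Φ z))) 0 - As.prodMap Au‖ < α)
    (hS : ∀ᶠ p in 𝓝 P, p ∈ S ↔ p = Φ (L (p - P)) ∧ 0 ≤ r p)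
    (htan : ∀ᶠ z in 𝓝 0, fderiv ℝ Φ z (L (X (Φ z))) = X (Φ z))
    (hr : ∃ O ∈ 𝓝 (0 : EuclideanSpace ℝ (Fin k) × Eu), ∀ z,
      IsForwardSolution (fun _ z => L (X (Φ z))) z → (∀ t, 0 ≤ t → z t ∈ O) →
      Tendsto z atTop (𝓝 0) →
      (0 ≤ ℓ (z 0).1 → ∀ t, 0 ≤ t → 0 ≤ r (Φ (z t))) ∧ (0 ≤ r (Φ (z 0)) → 0 ≤ ℓ (z 0).1)) :
    StableManifoldHasDim X S P k := by
  subst hΦ0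
  have hY : ContDiffAt ℝ 1 (fun z => L (X (Φ z))) 0 :=
    L.contDiff.contDiffAt.comp 0 (hX.comp 0 hΦ)
  obtain ⟨ρ, δ, g, hρ, hδ, hg0, hg, hexist, huniq⟩ :=
    exists_localStableManifold hα hs hu hY (by simp [hX0]) hlin
  obtain ⟨Or, hOr, hr⟩ := hr
  have hgc : ContinuousAt (fun ξ => (ξ, g ξ)) 0 :=
    continuousAt_id.prodMk (hg.continuousOn.continuousAt (Metric.ball_mem_nhds _ hρ))
  have hgt : Tendsto (fun ξ => (ξ, g ξ)) (𝓝 0) (𝓝 0) := by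
    have := hgc.tendsto
    rwa [hg0] at this
  obtain ⟨ρ₀, hρ₀, hΦg⟩ := Metric.eventually_nhds_iff_ball.1
    (hgt.eventually (hΦ.eventually (by simp)))
  set ρ₁ := min ρ ρ₀ with hρ₁
  have hρ₁p : 0 < ρ₁ := lt_min hρ hρ₀
  set φ : EuclideanSpace ℝ (Fin k) → E := fun x => Φ (ρ₁ • x, g (ρ₁ • x)) with hφ
  have hscale : ∀ x ∈ Metric.ball (0 : EuclideanSpace ℝ (Fin k)) 1,
      ρ₁ • x ∈ Metric.ball (0 : EuclideanSpace ℝ (Fin k)) ρ₁ := by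
    intro x hx
    rw [mem_ball_zero_iff] at hx ⊢
    rw [norm_smul, Real.norm_of_nonneg hρ₁p.le]
    exact mul_lt_of_lt_one_right hρ₁p hx
  have hφc : ∀ x ∈ Metric.ball (0 : EuclideanSpace ℝ (Fin k)) 1, ContDiffAt ℝ 1 φ x := by
    intro x hx
    have h1 : ContDiffAt ℝ 1 (fun x : EuclideanSpace ℝ (Fin k) => ρ₁ • x) x :=
      contDiffAt_id.const_smul ρ₁
    have h2 : ContDiffAt ℝ 1 g (ρ₁ • x) := hg.contDiffAt
      (Metric.isOpen_ball.mem_nhds (Metric.ball_subset_ball (min_le_left _ _) (hscale x hx)))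
    have h3 := hΦg (ρ₁ • x) (Metric.ball_subset_ball (min_le_right _ _) (hscale x hx))
    exact ContDiffAt.comp x (g := Φ) (f := fun x => (ρ₁ • x, g (ρ₁ • x))) h3
      (h1.prodMk (h2.comp x h1))
  have hφL : ∀ x, (L (φ x - Φ 0)).1 = ρ₁ • x := fun x => by rw [hφ, hL]
  have hLc : Continuous fun p => L (p - Φ 0) :=
    L.continuous.comp (continuous_id.sub continuous_const)
  -- the stable part of `L` inverts `φ` up to scaling, so `φ` is an immersion and an embedding
  refine ⟨φ, ℓ, ⟨by simp only [hφ, smul_zero, hg0]; rfl,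
    fun x hx => (hφc x hx).contDiffWithinAt, fun x hx => ?_, ?_⟩, ?_⟩
  · have h1 : HasFDerivAt (fun x => (L (φ x - Φ 0)).1)
        ((ContinuousLinearMap.fst ℝ _ _).comp (L.comp (fderiv ℝ φ x))) x :=
      (ContinuousLinearMap.fst ℝ (EuclideanSpace ℝ (Fin k)) Eu).hasFDerivAt.comp x
        (L.hasFDerivAt.comp x
          (((hφc x hx).differentiableAt one_ne_zero).hasFDerivAt.sub_const (Φ 0)))
    have h2 : HasFDerivAt (fun x => (L (φ x - Φ 0)).1)
        (ρ₁ • ContinuousLinearMap.id ℝ (EuclideanSpace ℝ (Fin k))) x := by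
      simp only [hφL]
      exact (hasFDerivAt_id x).const_smul ρ₁
    have h3 := h1.unique h2
    intro a b hab
    have h4 := congrArg (fun T => T a) h3
    have h5 := congrArg (fun T => T b) h3
    simp only [ContinuousLinearMap.comp_apply, hab] at h4 h5
    rw [h4] at h5
    simpa [hρ₁p.ne'] using h5
  · refine Topology.IsEmbedding.of_comp
      (g := fun p => ρ₁⁻¹ • (L (p - Φ 0)).1) ?_ ?_ ?_
    · exact continuousOn_iff_continuous_domRestrict.1
        fun x hx => (hφc x hx).continuousAt.continuousWithinAt
    · exact (continuous_fst.comp hLc).const_smul ρ₁⁻¹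
    · have : (fun p => ρ₁⁻¹ • (L (p - Φ 0)).1) ∘
          (Metric.ball (0 : EuclideanSpace ℝ (Fin k)) 1).domRestrict φ = Subtype.val := by
        funext x
        simp only [Function.comp, Set.domRestrict_apply, hφL]
        rw [smul_smul, inv_mul_cancel₀ hρ₁p.ne', one_smul]
      rw [this]
      exact Topology.IsEmbedding.subtypeVal
  have hLt : Tendsto (fun p => L (p - Φ 0)) (𝓝 (Φ 0)) (𝓝 0) := by
    have := hLc.tendsto (Φ 0)
    rwa [sub_self, map_zero] at this
  refine ⟨{p | (p ∈ S ↔ p = Φ (L (p - Φ 0)) ∧ 0 ≤ r p) ∧ L (p - Φ 0) ∈ Metric.ball 0 δ ∩ Or},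
    hS.and (hLt.eventually (inter_mem (Metric.ball_mem_nhds _ hδ) hOr)), fun N hN hNO => ?_⟩
  have hgood : ∀ᶠ z in 𝓝 (0 : EuclideanSpace ℝ (Fin k) × Eu), Φ z ∈ N ∧ z ∈ Or ∧
      fderiv ℝ Φ z (L (X (Φ z))) = X (Φ z) ∧ ContDiffAt ℝ 1 Φ z :=
    (hΦ.continuousAt.eventually hN).and (Filter.Eventually.and hOr
      (htan.and (hΦ.eventually (by simp))))
  obtain ⟨ε, hε, hgood⟩ := Metric.eventually_nhds_iff_ball.1 hgood
  simp only [mem_ball_zero_iff] at hgood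
  obtain ⟨ρ', hρ', hex⟩ := hexist ε hε
  have hnear : ∀ᶠ p in 𝓝 (Φ 0), (L (p - Φ 0)).1 ∈ Metric.ball 0 (min ρ' ρ₁) :=
    ((continuous_fst.tendsto _).comp hLt).eventually (Metric.ball_mem_nhds _ (lt_min hρ' hρ₁p))
  filter_upwards [hnear] with p hp
  rw [mem_ball_zero_iff] at hp
  constructor
  · -- an orbit in `S` that converges to `P` is read in the chart, where it starts on the graph
    rintro ⟨γ, hγ0, hγ, hγl⟩
    have hγO := fun t ht => hNO (hγ t ht).1.2
    have hγΦ : ∀ t, 0 ≤ t → γ t = Φ (L (γ t - Φ 0)) := fun t ht =>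
      ((hγO t ht).1.1 (hγ t ht).1.1).1
    have hz : IsForwardSolution (fun _ z => L (X (Φ z))) (fun t => L (γ t - Φ 0)) := fun t ht => by
      have := L.hasFDerivAt.comp_hasDerivWithinAt t ((hγ t ht).2.sub_const (Φ 0))
      simp only
      rw [← hγΦ t ht]
      exact this
    have hzl : Tendsto (fun t => L (γ t - Φ 0)) atTop (𝓝 0) := hLt.comp hγl
    have h1 := huniq _ hz (fun t ht => mem_ball_zero_iff.1 (hγO t ht).2.1) hzl
    have h2 := (hr _ hz (fun t ht => (hγO t ht).2.2) hzl).2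
    have hrp := ((hγO 0 le_rfl).1.1 (hγ 0 le_rfl).1.1).2
    rw [hγΦ 0 le_rfl] at hrp
    have h3 := h2 hrp
    simp only [hγ0] at h1 h3
    refine ⟨ρ₁⁻¹ • (L (p - Φ 0)).1, ⟨?_, ?_⟩, ?_⟩
    · rw [mem_ball_zero_iff, norm_smul, norm_inv, Real.norm_of_nonneg hρ₁p.le,
        inv_mul_lt_one₀ hρ₁p]
      exact hp.trans_le (min_le_right _ _)
    · change 0 ≤ ℓ (ρ₁⁻¹ • (L (p - Φ 0)).1)
      rw [map_smul]
      exact mul_nonneg (inv_nonneg.2 hρ₁p.le) h3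
    · have h4 := hγΦ 0 le_rfl
      rw [hγ0] at h4
      rw [h4, hφ]
      simp only [smul_smul, mul_inv_cancel₀ hρ₁p.ne', one_smul, ← h1, Prod.mk.eta, hL]
  · -- an orbit on the graph is mapped back to `S`; it keeps `0 ≤ r` because `0 ≤ ℓ x`
    rintro ⟨x, ⟨hx, hxℓ⟩, rfl⟩
    rw [hφL] at hp
    obtain ⟨z, hz0, hz, hzε, hzl⟩ := hex (ρ₁ • x) (hp.trans_le (min_le_left _ _))
    have hzg := fun t ht => hgood (z t) (hzε t ht)
    have h2 := (hr z hz (fun t ht => (hzg t ht).2.1) hzl).1 (by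
      rw [hz0]
      change 0 ≤ ℓ (ρ₁ • x)
      rw [map_smul]
      exact mul_nonneg hρ₁p.le hxℓ)
    refine ⟨fun t => Φ (z t), by simp only [hz0, hφ], fun t ht => ⟨⟨?_, (hzg t ht).1⟩, ?_⟩, ?_⟩
    · refine (hNO (hzg t ht).1).1.2 ⟨by rw [hL], h2 t ht⟩
    · have h3 := ((hzg t ht).2.2.2.differentiableAt one_ne_zero).hasFDerivAt.comp_hasDerivWithinAt
        t (hz t ht)
      rwa [(hzg t ht).2.2.1] at h3
    · exact hΦ.continuousAt.tendsto.comp hzl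

end Chart

section Reversor

variable {E : Type*} [NormedAddCommGroup E] [NormedSpace ℝ E]

/-- A reversing symmetry `R` of the vector field exchanges stable and unstable manifolds. -/
theorem StableManifoldHasDim.unstable_of_reversor {X : E → E} {S : Set E} {P : E} {k : ℕ}
    (R : E ≃L[ℝ] E) (hRR : ∀ p, R (R p) = p) (hX : ∀ p, X (R p) = -R (X p))
    (hS : ∀ p, R p ∈ S ↔ p ∈ S) (h : StableManifoldHasDim X S P k) :
    UnstableManifoldHasDim X S (R P) k := by
  have hlss : ∀ N p, p ∈ localStableSet (fun p => -X p) S N (R P) ↔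
      R p ∈ localStableSet X S (R ⁻¹' N) P := by
    intro N p
    constructor
    · rintro ⟨γ, h0, hγ, hl⟩
      refine ⟨fun t => R (γ t), congrArg R h0, fun t ht => ⟨⟨(hS _).2 (hγ t ht).1.1, ?_⟩, ?_⟩, ?_⟩
      · rw [Set.mem_preimage, hRR]
        exact (hγ t ht).1.2
      · have := R.hasFDerivAt.comp_hasDerivWithinAt t (hγ t ht).2
        simpa [hX, Function.comp_def] using this
      · have := (R.continuous.tendsto _).comp hl
        rwa [hRR] at this
    · rintro ⟨γ, h0, hγ, hl⟩
      refine ⟨fun t => R (γ t), by simp only [h0, hRR],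
        fun t ht => ⟨⟨(hS _).2 (hγ t ht).1.1, (hγ t ht).1.2⟩, ?_⟩,
        (R.continuous.tendsto _).comp hl⟩
      have := R.hasFDerivAt.comp_hasDerivWithinAt t (hγ t ht).2
      simpa [hX, Function.comp_def] using this
  obtain ⟨φ, ℓ, ⟨h0, hc, hi, he⟩, O, hO, hN⟩ := h
  have hpre : ∀ N ∈ 𝓝 (R P), R ⁻¹' N ∈ 𝓝 P := fun N hN => R.continuous.continuousAt hN
  refine ⟨fun x => R (φ x), ℓ, ⟨congrArg R h0, R.contDiff.comp_contDiffOn hc, fun x hx => ?_, ?_⟩,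
    R ⁻¹' O, ?_, fun N hN' hNO => ?_⟩
  · have h1 : DifferentiableAt ℝ φ x :=
      (hc.differentiableOn one_ne_zero x hx).differentiableAt (Metric.isOpen_ball.mem_nhds hx)
    have h2 : fderiv ℝ (fun x => R (φ x)) x = (R : E →L[ℝ] E).comp (fderiv ℝ φ x) :=
      (R.hasFDerivAt.comp x h1.hasFDerivAt).fderiv
    rw [h2]
    exact R.injective.comp (hi x hx)
  · exact R.toHomeomorph.isEmbedding.comp he
  · refine R.continuous.continuousAt ?_
    rwa [hRR]
  · have h1 := hN (R ⁻¹' N) (hpre N hN') fun p hp => by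
      have := hNO hp
      rwa [Set.mem_preimage, hRR] at this
    have h2 : Tendsto R (𝓝 (R P)) (𝓝 P) := by
      have := R.continuous.tendsto (R P)
      rwa [hRR] at this
    filter_upwards [h2.eventually h1] with p hp
    rw [hlss, hp]
    constructor
    · rintro ⟨x, hx, hxp⟩
      exact ⟨x, hx, by simp only [hxp, hRR]⟩
    · rintro ⟨x, hx, rfl⟩
      exact ⟨x, hx, by simp only [hRR]⟩

end Reversor

namespace IsoscelesParams

variable (c : IsoscelesParams)

/-! ### The potentials and their critical points -/

/-- The scale factor `(M/2)^{3/2}` of the potential `W`. -/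
def scale : ℝ := (c.M / 2) ^ (3 / 2 : ℝ)

/-- The quadratic form `cos² θ + μ sin² θ`. -/
def quad (θ : ℝ) : ℝ := Real.cos θ ^ 2 + c.μ * Real.sin θ ^ 2

theorem scale_pos : 0 < c.scale := Real.rpow_pos_of_pos (by linarith [c.M_pos]) _

theorem one_lt_μ : 1 < c.μ := by
  have := c.M_pos
  have := c.m_pos
  rw [μ, one_lt_div c.m_pos]
  linarith

theorem quad_eq (θ : ℝ) : c.quad θ = 1 + (c.μ - 1) * Real.sin θ ^ 2 := by
  rw [quad]
  linear_combination Real.sin_sq_add_cos_sq θ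

theorem quad_eq' (θ : ℝ) : c.quad θ = c.μ - (c.μ - 1) * Real.cos θ ^ 2 := by
  rw [quad]
  linear_combination c.μ * Real.sin_sq_add_cos_sq θ

theorem quad_pos (θ : ℝ) : 0 < c.quad θ := by
  have := c.one_lt_μ
  rw [quad_eq]
  have := mul_nonneg (sub_pos.2 this).le (sq_nonneg (Real.sin θ))
  linarith

theorem U_pos (θ : ℝ) (hθ : 0 ≤ Real.cos θ) : 0 < c.U θ := by
  have := c.B_pos
  have := c.B₁_pos
  refine mul_pos c.scale_pos ?_
  have : 0 ≤ 16 * c.B₁ * Real.cos θ ^ 3 / (c.quad θ) ^ (3 / 2 : ℝ) :=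
    div_nonneg (by positivity) (Real.rpow_nonneg (c.quad_pos θ).le _)
  change 0 < c.B + 16 * c.B₁ * Real.cos θ ^ 3 / (c.quad θ) ^ (3 / 2 : ℝ)
  linarith

theorem hasDerivAt_quad (θ : ℝ) :
    HasDerivAt c.quad (2 * (c.μ - 1) * Real.sin θ * Real.cos θ) θ := by
  have := ((Real.hasDerivAt_cos θ).pow 2).add (((Real.hasDerivAt_sin θ).pow 2).const_mul c.μ)
  refine this.congr_deriv ?_
  norm_num
  ring

theorem contDiff_quad : ContDiff ℝ ⊤ c.quad := by
  unfold quad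
  fun_prop

theorem contDiff_U : ContDiff ℝ ⊤ c.U := by
  have h : ContDiff ℝ ⊤ fun θ => (c.quad θ) ^ (3 / 2 : ℝ) :=
    c.contDiff_quad.rpow_const_of_ne fun θ => (c.quad_pos θ).ne'
  have h2 : ContDiff ℝ ⊤ fun θ => 16 * c.B₁ * Real.cos θ ^ 3 / (c.quad θ) ^ (3 / 2 : ℝ) :=
    (by fun_prop : ContDiff ℝ ⊤ fun θ => 16 * c.B₁ * Real.cos θ ^ 3).div h
      fun θ => (Real.rpow_pos_of_pos (c.quad_pos θ) _).ne'
  exact contDiff_const.mul (contDiff_const.add h2)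

theorem contDiffAt_V {θ : ℝ} (hθ : Real.cos θ ≠ 0) : ContDiffAt ℝ ⊤ c.V θ := by
  have h : ContDiff ℝ ⊤ fun θ => (c.quad θ) ^ (1 / 2 : ℝ) :=
    c.contDiff_quad.rpow_const_of_ne fun θ => (c.quad_pos θ).ne'
  have h2 : ContDiff ℝ ⊤ fun θ => 4 * c.A₁ / (c.quad θ) ^ (1 / 2 : ℝ) :=
    contDiff_const.div h fun θ => (Real.rpow_pos_of_pos (c.quad_pos θ) _).ne'
  exact contDiffAt_const.mul ((contDiffAt_const.div Real.contDiff_cos.contDiffAt hθ).add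
    h2.contDiffAt)

theorem rpow_three_halves (θ : ℝ) :
    (c.quad θ) ^ (3 / 2 : ℝ) = (c.quad θ) ^ (5 / 2 : ℝ) / c.quad θ := by
  rw [← Real.rpow_sub_one (c.quad_pos θ).ne']
  norm_num

theorem hasDerivAt_U (θ : ℝ) :
    HasDerivAt c.U (-(48 * c.scale * c.B₁ * c.μ * Real.sin θ * Real.cos θ ^ 2
      / (c.quad θ) ^ (5 / 2 : ℝ))) θ := by
  have hq := c.quad_pos θ
  have h1 : HasDerivAt (fun θ => (c.quad θ) ^ (-(3 / 2) : ℝ))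
      (2 * (c.μ - 1) * Real.sin θ * Real.cos θ * (-(3 / 2)) * (c.quad θ) ^ (-(3 / 2) - 1 : ℝ)) θ :=
    (c.hasDerivAt_quad θ).rpow_const (Or.inl hq.ne')
  have h2 := ((((((Real.hasDerivAt_cos θ).pow 3).const_mul (16 * c.B₁)).mul h1).const_add
    c.B).const_mul c.scale)
  have h3 : c.U = fun θ => c.scale * (c.B + 16 * c.B₁ * Real.cos θ ^ 3
      * (c.quad θ) ^ (-(3 / 2) : ℝ)) := by
    funext θ
    rw [Real.rpow_neg (c.quad_pos θ).le, ← div_eq_mul_inv]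
    rfl
  rw [h3]
  refine h2.congr_deriv ?_
  have h4 : (c.quad θ) ^ (-(3 / 2) - 1 : ℝ) = ((c.quad θ) ^ (5 / 2 : ℝ))⁻¹ := by
    rw [← Real.rpow_neg hq.le]
    norm_num
  have h5 : (c.quad θ) ^ (-(3 / 2) : ℝ) = c.quad θ * ((c.quad θ) ^ (5 / 2 : ℝ))⁻¹ := by
    rw [Real.rpow_neg hq.le, rpow_three_halves, inv_div, div_eq_mul_inv]
  rw [h4, h5, quad_eq']
  norm_num
  ring

/-- The factor `B - 16 B₁ (μ - 1) (cos² θ / (cos² θ + μ sin² θ))^{5/2}` of `W'`. -/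
def critFactor (θ : ℝ) : ℝ :=
  c.B - 16 * c.B₁ * (c.μ - 1) * (Real.cos θ ^ 2 / c.quad θ) ^ (5 / 2 : ℝ)

/-- The left-hand side is `cos⁴ θ · W'(θ)`; it has the same meaning at `θ = ± π/2`, where `W` has a
pole. -/
theorem deriv_U_mul_cos_add {θ : ℝ} (hθ : 0 ≤ Real.cos θ) :
    deriv c.U θ * Real.cos θ + 3 * c.U θ * Real.sin θ
      = 3 * c.scale * Real.sin θ * c.critFactor θ := by
  have hq := c.quad_pos θ
  have h5 : (Real.cos θ ^ 2 / c.quad θ) ^ (5 / 2 : ℝ)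
      = Real.cos θ ^ 5 / (c.quad θ) ^ (5 / 2 : ℝ) := by
    rw [Real.div_rpow (sq_nonneg _) hq.le, ← Real.rpow_natCast (Real.cos θ) 2,
      ← Real.rpow_mul hθ, ← Real.rpow_natCast (Real.cos θ) 5]
    norm_num
  have hU : c.U θ = c.scale * (c.B + 16 * c.B₁ * Real.cos θ ^ 3 / (c.quad θ) ^ (3 / 2 : ℝ)) := rfl
  rw [(c.hasDerivAt_U θ).deriv, hU, critFactor, h5, rpow_three_halves]
  have h6 := Real.rpow_pos_of_pos hq (5 / 2)
  field_simp
  rw [quad_eq']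
  ring

/-- `(μ - 1)^{2/5} (16 B₁ / B)^{2/5}`, the value of `1 + μ tan² θ_w`. -/
def critRatio : ℝ := (c.μ - 1) ^ (2 / 5 : ℝ) * (16 * c.B₁ / c.B) ^ (2 / 5 : ℝ)

theorem one_lt_critRatio (hB : 1 + c.B / (16 * c.B₁) < c.μ) : 1 < c.critRatio := by
  have h0 := c.B_pos
  have h1 := c.B₁_pos
  have h2 := c.one_lt_μ
  rw [critRatio, ← Real.mul_rpow (by linarith) (by positivity)]
  refine Real.one_lt_rpow ?_ (by norm_num)
  have h3 : c.B / (16 * c.B₁) < c.μ - 1 := by linarith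
  rw [div_lt_iff₀ (by positivity)] at h3
  rw [← mul_div_assoc, one_lt_div h0]
  exact h3

theorem critFactor_zero : c.critFactor 0 = c.B - 16 * c.B₁ * (c.μ - 1) := by
  simp [critFactor, quad]

theorem critFactor_zero_neg (hB : 1 + c.B / (16 * c.B₁) < c.μ) : c.critFactor 0 < 0 := by
  have h1 := c.B₁_pos
  have h3 : c.B / (16 * c.B₁) < c.μ - 1 := by linarith
  rw [div_lt_iff₀ (by positivity)] at h3
  rw [critFactor_zero]
  linarith

theorem critFactor_eq_zero_iff (θ : ℝ) :
    c.critFactor θ = 0 ↔ Real.cos θ ^ 2 / c.quad θ = c.critRatio⁻¹ := by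
  have h0 := c.B_pos
  have h1 := c.B₁_pos
  have h2 := c.one_lt_μ
  have h3 : 0 < c.μ - 1 := by linarith
  have hx : 0 ≤ Real.cos θ ^ 2 / c.quad θ := div_nonneg (sq_nonneg _) (c.quad_pos θ).le
  have hr : c.critRatio⁻¹ = (c.B / (16 * c.B₁ * (c.μ - 1))) ^ (2 / 5 : ℝ) := by
    rw [critRatio, ← Real.mul_rpow h3.le (by positivity), ← Real.inv_rpow (by positivity)]
    congr 1
    field_simp
  have hy : 0 ≤ c.B / (16 * c.B₁ * (c.μ - 1)) := by positivity
  rw [hr, critFactor, sub_eq_zero]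
  constructor
  · intro h
    have h4 : (Real.cos θ ^ 2 / c.quad θ) ^ (5 / 2 : ℝ) = c.B / (16 * c.B₁ * (c.μ - 1)) := by
      rw [eq_div_iff (by positivity)]
      linarith
    rw [← h4, ← Real.rpow_mul hx]
    norm_num
  · intro h
    rw [h, ← Real.rpow_mul hy]
    norm_num
    field_simp

theorem cos_sq_div_quad_eq_iff (hB : 1 + c.B / (16 * c.B₁) < c.μ) (θ : ℝ) :
    Real.cos θ ^ 2 / c.quad θ = c.critRatio⁻¹ ↔
      Real.cos θ ^ 2 = c.μ / ((c.μ - 1) + c.critRatio) := by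
  have h2 := c.one_lt_μ
  have h3 := c.one_lt_critRatio hB
  rw [div_eq_iff (c.quad_pos θ).ne', eq_div_iff (by linarith), eq_comm,
    inv_mul_eq_iff_eq_mul₀ (by linarith), quad_eq']
  constructor <;> intro h <;> linarith

theorem cos_sq_θw_bounds (hB : 1 + c.B / (16 * c.B₁) < c.μ) :
    0 < c.μ / ((c.μ - 1) + c.critRatio) ∧ c.μ / ((c.μ - 1) + c.critRatio) < 1 := by
  have h2 := c.one_lt_μ
  have h3 := c.one_lt_critRatio hB
  refine ⟨div_pos (by linarith) (by linarith), ?_⟩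
  rw [div_lt_one (by linarith)]
  linarith

theorem cos_θw (hB : 1 + c.B / (16 * c.B₁) < c.μ) :
    Real.cos c.θw = √(c.μ / ((c.μ - 1) + c.critRatio)) := by
  have h := c.cos_sq_θw_bounds hB
  refine Real.cos_arccos ((by norm_num : (-1 : ℝ) ≤ 0).trans (Real.sqrt_nonneg _)) ?_
  exact Real.sqrt_le_one.2 h.2.le

theorem θw_mem (hB : 1 + c.B / (16 * c.B₁) < c.μ) : 0 < c.θw ∧ c.θw < Real.pi / 2 := by
  have h := c.cos_sq_θw_bounds hB
  refine ⟨Real.arccos_pos.2 ?_, Real.arccos_lt_pi_div_two.2 (Real.sqrt_pos.2 h.1)⟩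
  change √(c.μ / ((c.μ - 1) + c.critRatio)) < 1
  rw [Real.sqrt_lt' one_pos, one_pow]
  exact h.2

theorem critFactor_eq_zero_iff_eq_θw (hB : 1 + c.B / (16 * c.B₁) < c.μ) {θ : ℝ}
    (hθ : θ ∈ Set.Icc (-(Real.pi / 2)) (Real.pi / 2)) :
    c.critFactor θ = 0 ↔ θ = c.θw ∨ θ = -c.θw := by
  have hw := c.θw_mem hB
  have hπ := Real.pi_pos
  have hcw : 0 ≤ Real.cos c.θw := by rw [c.cos_θw hB]; positivity
  have h1 : Real.cos c.θw ^ 2 = c.μ / ((c.μ - 1) + c.critRatio) := by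
    rw [c.cos_θw hB, Real.sq_sqrt (c.cos_sq_θw_bounds hB).1.le]
  rw [critFactor_eq_zero_iff, c.cos_sq_div_quad_eq_iff hB, ← h1,
    sq_eq_sq₀ (Real.cos_nonneg_of_mem_Icc hθ) hcw, ← Real.cos_abs θ]
  constructor
  · intro h
    have h2 := Real.injOn_cos ⟨abs_nonneg θ, (abs_le.2 ⟨hθ.1, hθ.2⟩).trans (by linarith)⟩
      ⟨hw.1.le, by linarith⟩ h
    exact eq_or_eq_neg_of_abs_eq h2
  · rintro (rfl | rfl)
    · rw [abs_of_pos hw.1]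
    · rw [abs_neg, abs_of_pos hw.1]

/-- `θ` is a critical point of `W` in the open interval `(-π/2, π/2)`; the equation is
`cos⁴ θ · W'(θ) = 0`, written in terms of `U`. -/
def IsCrit (θ : ℝ) : Prop :=
  θ ∈ Set.Ioo (-(Real.pi / 2)) (Real.pi / 2) ∧
    deriv c.U θ * Real.cos θ + 3 * c.U θ * Real.sin θ = 0

variable {c} in
theorem IsCrit.cos_pos {θ : ℝ} (h : c.IsCrit θ) : 0 < Real.cos θ := Real.cos_pos_of_mem_Ioo h.1

theorem isCrit_zero : c.IsCrit 0 := by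
  have hπ := Real.pi_pos
  refine ⟨⟨by linarith, by linarith⟩, ?_⟩
  rw [c.deriv_U_mul_cos_add (by simp)]
  simp

theorem isCrit_θw (hB : 1 + c.B / (16 * c.B₁) < c.μ) : c.IsCrit c.θw ∧ c.IsCrit (-c.θw) := by
  have hw := c.θw_mem hB
  have h1 : c.θw ∈ Set.Ioo (-(Real.pi / 2)) (Real.pi / 2) := ⟨by linarith, hw.2⟩
  have h2 : -c.θw ∈ Set.Ioo (-(Real.pi / 2)) (Real.pi / 2) := ⟨by linarith, by linarith⟩
  refine ⟨⟨h1, ?_⟩, h2, ?_⟩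
  · rw [c.deriv_U_mul_cos_add (Real.cos_pos_of_mem_Ioo h1).le,
      (c.critFactor_eq_zero_iff_eq_θw hB (Set.Ioo_subset_Icc_self h1)).2 (Or.inl rfl), mul_zero]
  · rw [c.deriv_U_mul_cos_add (Real.cos_pos_of_mem_Ioo h2).le,
      (c.critFactor_eq_zero_iff_eq_θw hB (Set.Ioo_subset_Icc_self h2)).2 (Or.inr rfl), mul_zero]

theorem isCrit_iff (hB : 1 + c.B / (16 * c.B₁) < c.μ) (θ : ℝ) :
    c.IsCrit θ ↔ θ = 0 ∨ θ = c.θw ∨ θ = -c.θw := by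
  constructor
  · rintro ⟨h1, h2⟩
    rw [c.deriv_U_mul_cos_add (Real.cos_pos_of_mem_Ioo h1).le] at h2
    have h3 := c.scale_pos
    rcases mul_eq_zero.1 h2 with h | h
    · left
      refine (Real.sin_eq_zero_iff_of_lt_of_lt ?_ ?_).1 (by simpa [h3.ne'] using h)
      · linarith [h1.1, Real.pi_pos]
      · linarith [h1.2, Real.pi_pos]
    · exact Or.inr ((c.critFactor_eq_zero_iff_eq_θw hB (Set.Ioo_subset_Icc_self h1)).1 h)
  · rintro (rfl | rfl | rfl)
    · exact c.isCrit_zero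
    · exact (c.isCrit_θw hB).1
    · exact (c.isCrit_θw hB).2

/-! ### Equilibria on the collision manifold -/

/-- The point `(0, s √(2 W(θ)), θ, 0)`, where `s = ± 1`; it lies on the collision manifold. -/
def critPoint (s θ : ℝ) : State := (0, s * √(2 * c.W θ), θ, 0)

theorem W_eq {θ : ℝ} (hθ : Real.cos θ ≠ 0) : c.W θ = c.U θ / Real.cos θ ^ 3 := by
  rw [c.U_eq θ hθ]
  field_simp

theorem W_pos {θ : ℝ} (hθ : 0 < Real.cos θ) : 0 < c.W θ := by
  rw [c.W_eq hθ.ne']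
  exact div_pos (c.U_pos θ hθ.le) (pow_pos hθ 3)

theorem sq_mul_cos_pow {s θ : ℝ} (hs : s ^ 2 = 1) (hθ : 0 < Real.cos θ) :
    (s * √(2 * c.W θ)) ^ 2 * Real.cos θ ^ 3 = 2 * c.U θ := by
  rw [mul_pow, hs, Real.sq_sqrt (by linarith [c.W_pos hθ]), c.W_eq hθ.ne']
  field_simp

theorem critPoint_mem_collisionManifold {s θ : ℝ} (hs : s ^ 2 = 1) (h : c.IsCrit θ) :
    c.critPoint s θ ∈ c.collisionManifold := by
  have h2 := c.sq_mul_cos_pow hs h.cos_pos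
  have hU := c.U_pos θ h.cos_pos.le
  refine ⟨rfl, Set.Ioo_subset_Icc_self h.1, ?_⟩
  simp only [critPoint]
  field_simp
  linear_combination (Real.cos θ ^ 3) * h2

theorem field_critPoint (C h : ℝ) {s θ : ℝ} (hs : s ^ 2 = 1) (hθ : c.IsCrit θ) :
    c.field C h (c.critPoint s θ) = 0 := by
  have h2 := c.sq_mul_cos_pow hs hθ.cos_pos
  have hU := c.U_pos θ hθ.cos_pos.le
  have hq : √(c.U θ) ^ 2 = c.U θ := Real.sq_sqrt hU.le
  have hq0 := Real.sqrt_pos.2 hU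
  simp only [field, critPoint, wSqDivCos, Prod.mk_eq_zero]
  refine ⟨by ring, ?_, trivial, ?_⟩
  · field_simp
    linear_combination h2 - 2 * hq
  · field_simp
    linear_combination 2 * √(c.U θ) * (Real.cos θ ^ 2 * hθ.2
      + 3 * Real.sin θ * Real.cos θ ^ 2 * h2)

/-- The equation `v' = 0` determines `v²` and excludes `cos θ = 0`; then `w' = 0` says that `θ` is a
critical point of `W`. -/
theorem eq_critPoint_of_equilibrium (C h : ℝ) {P : State} (hP : P ∈ c.collisionManifold)
    (h0 : c.field C h P = 0) :
    c.IsCrit P.2.2.1 ∧ (P = c.critPoint 1 P.2.2.1 ∨ P = c.critPoint (-1) P.2.2.1) := by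
  obtain ⟨r, v, θ, w⟩ := P
  obtain ⟨hr, hθ, -⟩ := hP
  simp only at hr hθ
  subst hr
  simp only [field, wSqDivCos, Prod.mk_eq_zero] at h0
  obtain ⟨-, h2, rfl, h4⟩ := h0
  have hc0 := Real.cos_nonneg_of_mem_Icc hθ
  have hU := c.U_pos θ hc0
  have hq : √(c.U θ) ^ 2 = c.U θ := Real.sq_sqrt hU.le
  have hq0 := Real.sqrt_pos.2 hU
  have hv : v ^ 2 * Real.cos θ ^ 3 = 2 * c.U θ := by
    field_simp at h2
    linear_combination h2 + 2 * hq
  have hc : 0 < Real.cos θ := by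
    refine lt_of_le_of_ne hc0 fun h => ?_
    rw [← h] at hv
    norm_num at hv
    exact hU.ne' hv
  have hθ' : θ ∈ Set.Ioo (-(Real.pi / 2)) (Real.pi / 2) := by
    refine ⟨lt_of_le_of_ne hθ.1 ?_, lt_of_le_of_ne hθ.2 ?_⟩ <;> rintro rfl <;> simp at hc
  refine ⟨⟨hθ', ?_⟩, ?_⟩
  · field_simp at h4
    have h5 : 2 * √(c.U θ) * Real.cos θ ^ 2
        * (deriv c.U θ * Real.cos θ + 3 * c.U θ * Real.sin θ) = 0 := by
      linear_combination h4 - 6 * √(c.U θ) * Real.sin θ * Real.cos θ ^ 2 * hv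
    exact (mul_eq_zero.1 h5).resolve_left (by positivity)
  · have h6 : v ^ 2 = √(2 * c.W θ) ^ 2 := by
      rw [Real.sq_sqrt (by linarith [c.W_pos hc]), c.W_eq hc.ne']
      field_simp
      exact hv
    rcases sq_eq_sq_iff_eq_or_eq_neg.1 h6 with h7 | h7
    · left; simp [critPoint, h7]
    · right; simp [critPoint, h7]

/-! ### Derivatives of the energy function and of the vector field -/

theorem contDiff_deriv_U : ContDiff ℝ 1 (deriv c.U) := by
  have h : ContDiff ℝ (1 + 1) c.U := c.contDiff_U.of_le le_top
  exact (contDiff_succ_iff_deriv.1 h).2.2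

theorem contDiffAt_deriv_V {θ : ℝ} (hθ : Real.cos θ ≠ 0) : ContDiffAt ℝ 1 (deriv c.V) θ := by
  have h := ((c.contDiffAt_V hθ).of_le le_top).fderiv_right (m := 1) (n := 2) (by norm_num)
  have h2 := h.clm_apply (contDiffAt_const (c := (1 : ℝ)))
  refine h2.congr_of_eventuallyEq (Eventually.of_forall fun x => ?_)
  simp

theorem contDiffAt_energyFn (C h : ℝ) {p : State} (hp : 0 < Real.cos p.2.2.1) :
    ContDiffAt ℝ 1 (c.energyFn C h) p := by
  have hθ : ContDiffAt ℝ 1 (fun p : State => p.2.2.1) p := by fun_prop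
  have hU : ContDiffAt ℝ 1 (fun p : State => c.U p.2.2.1) p :=
    (c.contDiff_U.of_le le_top).contDiffAt.comp p hθ
  have hV : ContDiffAt ℝ 1 (fun p : State => c.V p.2.2.1) p :=
    ContDiffAt.comp p (g := c.V) (f := fun p : State => p.2.2.1)
      ((c.contDiffAt_V hp.ne').of_le le_top) hθ
  have hc : ContDiffAt ℝ 1 (fun p : State => Real.cos p.2.2.1) p := by fun_prop
  change ContDiffAt ℝ 1 (fun p : State => c.U p.2.2.1 * p.2.2.2 ^ 2
    + (p.2.1 ^ 2 * Real.cos p.2.2.1 ^ 3 - 2 * c.U p.2.2.1) * Real.cos p.2.2.1 ^ 3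
    + (C ^ 2 - 2 * p.1 * c.V p.2.2.1 * Real.cos p.2.2.1 ^ 2) * p.1 * Real.cos p.2.2.1 ^ 4
    - 2 * h * p.1 ^ 3 * Real.cos p.2.2.1 ^ 6) p
  fun_prop

theorem contDiffAt_field (C h : ℝ) {p : State} (hp : 0 < Real.cos p.2.2.1) :
    ContDiffAt ℝ 1 (c.field C h) p := by
  have hU0 := c.U_pos p.2.2.1 hp.le
  have hθ : ContDiffAt ℝ 1 (fun p : State => p.2.2.1) p := by fun_prop
  have hU : ContDiffAt ℝ 1 (fun p : State => c.U p.2.2.1) p :=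
    (c.contDiff_U.of_le le_top).contDiffAt.comp p hθ
  have hq : ContDiffAt ℝ 1 (fun p : State => √(c.U p.2.2.1)) p := hU.sqrt hU0.ne'
  have hU' : ContDiffAt ℝ 1 (fun p : State => deriv c.U p.2.2.1) p :=
    c.contDiff_deriv_U.contDiffAt.comp p hθ
  have hV : ContDiffAt ℝ 1 (fun p : State => c.V p.2.2.1) p :=
    ContDiffAt.comp p (g := c.V) (f := fun p : State => p.2.2.1)
      ((c.contDiffAt_V hp.ne').of_le le_top) hθ
  have hV' : ContDiffAt ℝ 1 (fun p : State => deriv c.V p.2.2.1) p :=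
    ContDiffAt.comp p (g := deriv c.V) (f := fun p : State => p.2.2.1)
      (c.contDiffAt_deriv_V hp.ne') hθ
  have hc : ContDiffAt ℝ 1 (fun p : State => Real.cos p.2.2.1) p := by fun_prop
  have hs : ContDiffAt ℝ 1 (fun p : State => Real.sin p.2.2.1) p := by fun_prop
  have hq0 : √(c.U p.2.2.1) ≠ 0 := (Real.sqrt_pos.2 hU0).ne'
  have hUi : ContDiffAt ℝ 1 (fun p : State => (c.U p.2.2.1)⁻¹) p := hU.inv hU0.ne'
  have hqi : ContDiffAt ℝ 1 (fun p : State => (√(c.U p.2.2.1))⁻¹) p := hq.inv hq0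
  refine ContDiffAt.prodMk ?_ (ContDiffAt.prodMk ?_ (ContDiffAt.prodMk ?_ ?_))
  · simp only [div_eq_mul_inv]
    fun_prop
  · simp only [div_eq_mul_inv, mul_inv]
    fun_prop
  · fun_prop
  · simp only [wSqDivCos, div_eq_mul_inv]
    fun_prop

-- The derivatives of the energy and of the field are computed along the lines `t ↦ p + t u`.

theorem hasDerivAt_line (x a : ℝ) : HasDerivAt (fun t : ℝ => x + t * a) a 0 := by
  simpa using ((hasDerivAt_id (0 : ℝ)).mul_const a).const_add x

theorem hasDerivAt_comp_line {f : ℝ → ℝ} {f' x : ℝ} (hf : HasDerivAt f f' x) (a : ℝ) :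
    HasDerivAt (fun t : ℝ => f (x + t * a)) (f' * a) 0 := by
  have h : HasDerivAt f f' (x + 0 * a) := by simpa using hf
  exact h.comp (0 : ℝ) (hasDerivAt_line x a)

theorem fderiv_energyFn (C h : ℝ) {r v θ w : ℝ} (hθ : 0 < Real.cos θ) (a b d e : ℝ) :
    fderiv ℝ (c.energyFn C h) (r, v, θ, w) (a, b, d, e) =
      (C ^ 2 * Real.cos θ ^ 4 - 4 * r * c.V θ * Real.cos θ ^ 6 - 6 * h * r ^ 2 * Real.cos θ ^ 6) * a
      + 2 * v * Real.cos θ ^ 6 * b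
      + (deriv c.U θ * w ^ 2 - 6 * v ^ 2 * Real.cos θ ^ 5 * Real.sin θ
        - 2 * deriv c.U θ * Real.cos θ ^ 3 + 6 * c.U θ * Real.cos θ ^ 2 * Real.sin θ
        - 4 * C ^ 2 * r * Real.cos θ ^ 3 * Real.sin θ
        - 2 * r ^ 2 * (deriv c.V θ * Real.cos θ ^ 6 - 6 * c.V θ * Real.cos θ ^ 5 * Real.sin θ)
        + 12 * h * r ^ 3 * Real.cos θ ^ 5 * Real.sin θ) * d
      + 2 * c.U θ * w * e := by
  have hd : DifferentiableAt ℝ (c.energyFn C h) (r, v, θ, w) :=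
    (c.contDiffAt_energyFn C h hθ).differentiableAt one_ne_zero
  have h1 : HasLineDerivAt ℝ (c.energyFn C h) _ (r, v, θ, w) (a, b, d, e) :=
    hd.hasFDerivAt.hasLineDerivAt (a, b, d, e)
  have hU := hasDerivAt_comp_line (c.contDiff_U.differentiable (by simp) θ).hasDerivAt d
  have hV := hasDerivAt_comp_line
    ((c.contDiffAt_V hθ.ne').differentiableAt (by simp)).hasDerivAt d
  have hc := hasDerivAt_comp_line (Real.hasDerivAt_cos θ) d
  have hr := hasDerivAt_line r a
  have hv := hasDerivAt_line v b
  have hw := hasDerivAt_line w e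
  have h2 := (((hU.mul (hw.pow 2)).add ((((hv.pow 2).mul (hc.pow 3)).sub (hU.const_mul 2)).mul
    (hc.pow 3))).add (((((hr.const_mul 2).mul hV).mul (hc.pow 2)).const_sub (C ^ 2)).mul hr
      |>.mul (hc.pow 4))).sub (((hr.pow 3).const_mul (2 * h)).mul (hc.pow 6))
  refine h1.unique (h2.congr_deriv ?_ |>.congr_of_eventuallyEq (Eventually.of_forall fun t => ?_))
  · simp only [Pi.pow_apply, Pi.mul_apply, zero_mul, add_zero]
    norm_num
    ring
  · simp only [energyFn, Pi.add_apply, Pi.sub_apply, Pi.mul_apply, Pi.pow_apply,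
      Prod.smul_fst, Prod.smul_snd, smul_eq_mul]

/-- The energy is preserved on its zero level; off that level its derivative along the field is
`v cos³ θ / √U` times the energy. -/
theorem fderiv_energyFn_field (C h : ℝ) {p : State} (hθ : 0 < Real.cos p.2.2.1)
    (hp : c.energyFn C h p = 0) :
    fderiv ℝ (c.energyFn C h) p (c.field C h p) = 0 := by
  obtain ⟨r, v, θ, w⟩ := p
  simp only at hθ
  have hU := c.U_pos θ hθ.le
  have hq : √(c.U θ) ^ 2 = c.U θ := Real.sq_sqrt hU.le
  have hq0 := Real.sqrt_pos.2 hU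
  have key : fderiv ℝ (c.energyFn C h) (r, v, θ, w) (c.field C h (r, v, θ, w))
      = v * Real.cos θ ^ 3 / √(c.U θ) * c.energyFn C h (r, v, θ, w) := by
    simp only [field]
    rw [c.fderiv_energyFn C h hθ]
    simp only [energyFn, wSqDivCos]
    rw [← hq, Real.sqrt_sq hq0.le]
    field_simp
    ring
  rw [key, hp, mul_zero]

/-- The coefficient of `δθ` in the linearization of `w'` at a critical point, `cos³ θ W'' / W`. -/
def kappa (θ : ℝ) : ℝ :=
  Real.cos θ ^ 2 * (deriv (deriv c.U) θ * Real.cos θ + 2 * deriv c.U θ * Real.sin θ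
    + 3 * c.U θ * Real.cos θ) / c.U θ

/-- The eigenvalue `v cos³ θ / √U` transverse to the collision manifold. -/
def radialRate (s θ : ℝ) : ℝ := s * √(2 * c.W θ) * Real.cos θ ^ 3 / √(c.U θ)

/-- The entries `∂v'/∂θ` and `∂w'/∂θ` simplify by the value of `v²` and by the equation for critical
points of `W`. -/
theorem fderiv_field_critPoint (C h : ℝ) {s θ : ℝ} (hs : s ^ 2 = 1) (hθ : c.IsCrit θ)
    (a b d e : ℝ) :
    fderiv ℝ (c.field C h) (c.critPoint s θ) (a, b, d, e) =
      (c.radialRate s θ * a, c.radialRate s θ * b, e,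
        2 * C ^ 2 * Real.sin θ * Real.cos θ ^ 3 / c.U θ * a
        + 6 * Real.sin θ * (s * √(2 * c.W θ)) * Real.cos θ ^ 5 / c.U θ * b
        + c.kappa θ * d + c.radialRate s θ / 2 * e) := by
  have hc0 := hθ.cos_pos
  have hU0 := c.U_pos θ hc0.le
  have hq2 : √(c.U θ) ^ 2 = c.U θ := Real.sq_sqrt hU0.le
  have hq0 := Real.sqrt_pos.2 hU0
  have hv2 := c.sq_mul_cos_pow hs hc0
  have hcrit := hθ.2
  set v := s * √(2 * c.W θ) with hv_def
  have hd : DifferentiableAt ℝ (c.field C h) (c.critPoint s θ) :=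
    (c.contDiffAt_field C h hc0).differentiableAt one_ne_zero
  have h1 : HasLineDerivAt ℝ (c.field C h) _ (c.critPoint s θ) (a, b, d, e) :=
    hd.hasFDerivAt.hasLineDerivAt (a, b, d, e)
  have hU := hasDerivAt_comp_line (c.contDiff_U.differentiable (by simp) θ).hasDerivAt d
  have hU' := hasDerivAt_comp_line (c.contDiff_deriv_U.differentiable (by simp) θ).hasDerivAt d
  have hV := hasDerivAt_comp_line
    ((c.contDiffAt_V hc0.ne').differentiableAt (by simp)).hasDerivAt d
  have hV' := hasDerivAt_comp_line
    ((c.contDiffAt_deriv_V hc0.ne').differentiableAt (by simp)).hasDerivAt d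
  have hc := hasDerivAt_comp_line (Real.hasDerivAt_cos θ) d
  have hsn := hasDerivAt_comp_line (Real.hasDerivAt_sin θ) d
  have hr : HasDerivAt (fun t : ℝ => t * a) a 0 := by simpa using hasDerivAt_line 0 a
  have hv := hasDerivAt_line v b
  have hw : HasDerivAt (fun t : ℝ => t * e) e 0 := by simpa using hasDerivAt_line 0 e
  have hU0' : c.U (θ + 0 * d) ≠ 0 := by simpa using hU0.ne'
  have hq := hU.sqrt hU0'
  have hq0' : √(c.U (θ + 0 * d)) ≠ 0 := by simpa using hq0.ne'
  have hcq := (hc.pow 3).div hq hq0'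
  have g1 := (hr.mul hv).mul hcq
  have g2 := ((((hc.pow 3).div (hq.const_mul 2) (mul_ne_zero two_ne_zero hq0')).mul
    (hv.pow 2)).sub hq).add (((hr.pow 2).mul ((hr.const_mul (2 * h)).add hV)).mul hcq)
  have g4Ω := ((hc.pow 2).const_mul 2).add ((((((hr.pow 3).const_mul (2 * h)).mul
    (hc.pow 5)).sub ((hv.pow 2).mul (hc.pow 5))).sub ((hr.const_mul (C ^ 2)).mul (hc.pow 3)) |>.add
      ((((hr.pow 2).const_mul 2).mul hV).mul (hc.pow 5))).div hU hU0')
  have g4 := ((((((hv.const_mul (1 / 2)).mul hw).mul hcq).add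
    (((hr.pow 2).mul hV').mul ((hc.pow 6).div hU hU0'))).add
    ((hU'.div hU hU0').mul ((hc.pow 3).sub ((hw.pow 2).div_const 2)))).add
    ((hsn.const_mul 3).mul (hc.pow 2))).sub
    ((((hr.const_mul (C ^ 2)).mul hsn).mul (hc.pow 3)).div hU hU0') |>.sub
    ((hsn.const_mul 3).mul g4Ω)
  have g := g1.prodMk (g2.prodMk (hw.prodMk g4))
  refine h1.unique (g.congr_deriv ?_ |>.congr_of_eventuallyEq (Eventually.of_forall fun t => ?_))
  · simp only [Pi.pow_apply, Pi.mul_apply, Pi.add_apply, Pi.sub_apply, Pi.div_apply, zero_mul,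
      add_zero, mul_zero, radialRate, kappa, ← hv_def]
    norm_num
    refine ⟨?_, ?_, ?_⟩
    · field_simp
    · field_simp
      rw [hq2]
      refine mul_left_cancel₀ hc0.ne' ?_
      linear_combination d * (-6 * Real.sin θ * c.U θ - Real.cos θ * deriv c.U θ) * hv2
        - 4 * d * c.U θ * hcrit
    · field_simp
      linear_combination 2 * √(c.U θ) * d * ((3 * Real.cos θ ^ 2 * c.U θ
          - 15 * Real.sin θ ^ 2 * c.U θ - 3 * Real.sin θ * Real.cos θ * deriv c.U θ) * hv2
        - (Real.cos θ * deriv c.U θ + 8 * Real.sin θ * c.U θ) * hcrit)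
  · simp only [field, wSqDivCos, critPoint, Pi.add_apply, Pi.sub_apply, Pi.mul_apply, Pi.pow_apply,
      Pi.div_apply, Prod.smul_fst, Prod.smul_snd, smul_eq_mul, zero_add,
      ← hv_def]

/-! ### Eigenvalues -/

/-- The roots `l/4 ± p`, `p² = l²/16 + κ`, of `λ² - (l/2) λ - κ` have opposite signs if `κ > 0`. -/
theorem exists_saddle_roots (l : ℝ) {κ : ℝ} (hκ : 0 < κ) :
    ∃ a b : ℝ, a < 0 ∧ 0 < b ∧ a ^ 2 = κ + l / 2 * a ∧ b ^ 2 = κ + l / 2 * b := by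
  set p := √(l ^ 2 / 16 + κ) with hp
  have hp2 : p ^ 2 = l ^ 2 / 16 + κ := Real.sq_sqrt (by positivity)
  have hp0 : |l / 4| < p :=
    abs_lt_of_sq_lt_sq (by linarith [hp2, div_pow l 4 2]) (Real.sqrt_nonneg _)
  obtain ⟨hp1, hp3⟩ := abs_lt.1 hp0
  exact ⟨l / 4 - p, l / 4 + p, by linarith, by linarith, by linear_combination hp2,
    by linear_combination hp2⟩

/-- `κ` is the derivative of the factorized form of `cos⁴ θ · W'(θ)`, up to a positive factor. At a
critical point one of its two terms vanishes, and the sign of the other one is visible. -/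
theorem kappa_eq {θ : ℝ} (hθ : 0 < Real.cos θ) {f' : ℝ} (hf : HasDerivAt c.critFactor f' θ) :
    c.kappa θ = Real.cos θ ^ 2 * (3 * c.scale * (Real.cos θ * c.critFactor θ + Real.sin θ * f'))
      / c.U θ := by
  have h1 := ((((c.contDiff_deriv_U.differentiable (by simp) θ).hasDerivAt.mul
    (Real.hasDerivAt_cos θ)).add (((c.contDiff_U.differentiable (by simp) θ).hasDerivAt.const_mul
      3).mul (Real.hasDerivAt_sin θ))))
  have h2 := ((Real.hasDerivAt_sin θ).const_mul (3 * c.scale)).mul hf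
  have h3 : (fun θ => 3 * c.scale * Real.sin θ) * c.critFactor =ᶠ[𝓝 θ]
      deriv c.U * Real.cos + (fun y => 3 * c.U y) * Real.sin := by
    filter_upwards [Real.continuous_cos.continuousAt.eventually (lt_mem_nhds hθ)] with x hx
    exact (c.deriv_U_mul_cos_add hx.le).symm
  have h4 := (h2.congr_of_eventuallyEq h3.symm).unique h1
  rw [kappa]
  congr 2
  linear_combination -h4

theorem hasDerivAt_critFactor {θ : ℝ} (hθ : 0 < Real.cos θ) :
    HasDerivAt c.critFactor (80 * c.B₁ * (c.μ - 1) * c.μ * Real.sin θ * Real.cos θ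
      / c.quad θ ^ 2 * (Real.cos θ ^ 2 / c.quad θ) ^ (3 / 2 : ℝ)) θ := by
  have hq := c.quad_pos θ
  have h1 := (((Real.hasDerivAt_cos θ).pow 2).div (c.hasDerivAt_quad θ) hq.ne').rpow_const
    (p := 5 / 2) (Or.inl (by simp only [Pi.div_apply, Pi.pow_apply]; positivity))
  have h2 := (h1.const_mul (16 * c.B₁ * (c.μ - 1))).const_sub c.B
  refine h2.congr_deriv ?_
  norm_num
  field_simp
  rw [quad_eq']
  ring

theorem kappa_zero : c.kappa 0 = 3 * (c.B - 16 * c.B₁ * (c.μ - 1)) / (c.B + 16 * c.B₁) := by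
  have hk := c.scale_pos
  have h0 := c.B_pos
  have h1 := c.B₁_pos
  rw [c.kappa_eq (by simp) (c.hasDerivAt_critFactor (by simp)), critFactor_zero]
  have hU : c.U 0 = c.scale * (c.B + 16 * c.B₁) := by simp [U, scale]
  rw [hU]
  simp
  field_simp

theorem kappa_zero_neg (hB : 1 + c.B / (16 * c.B₁) < c.μ) : c.kappa 0 < 0 := by
  have h0 := c.B_pos
  have h1 := c.B₁_pos
  have h2 := c.critFactor_zero_neg hB
  rw [critFactor_zero] at h2
  rw [kappa_zero]
  exact div_neg_of_neg_of_pos (by linarith) (by linarith)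

theorem kappa_pos {θ : ℝ} (hθ : 0 < Real.cos θ) (hs : Real.sin θ ≠ 0) (h0 : c.critFactor θ = 0) :
    0 < c.kappa θ := by
  have hq := c.quad_pos θ
  have hU := c.U_pos θ hθ.le
  have hk := c.scale_pos
  have hB := c.B₁_pos
  have hμ := c.one_lt_μ
  have hμ1 : 0 < c.μ - 1 := by linarith
  have hs2 : 0 < Real.sin θ ^ 2 := by positivity
  have h3 : 0 < (Real.cos θ ^ 2 / c.quad θ) ^ (3 / 2 : ℝ) := Real.rpow_pos_of_pos (by positivity) _
  rw [c.kappa_eq hθ (c.hasDerivAt_critFactor hθ), h0]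
  have h4 : Real.cos θ * 0 + Real.sin θ * (80 * c.B₁ * (c.μ - 1) * c.μ * Real.sin θ * Real.cos θ
      / c.quad θ ^ 2 * (Real.cos θ ^ 2 / c.quad θ) ^ (3 / 2 : ℝ))
      = 80 * c.B₁ * (c.μ - 1) * c.μ * Real.sin θ ^ 2 * Real.cos θ
      / c.quad θ ^ 2 * (Real.cos θ ^ 2 / c.quad θ) ^ (3 / 2 : ℝ) := by ring
  rw [h4]
  positivity

theorem kappa_θw_pos (hB : 1 + c.B / (16 * c.B₁) < c.μ) :
    0 < c.kappa c.θw ∧ 0 < c.kappa (-c.θw) := by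
  have hw := c.θw_mem hB
  have hπ := Real.pi_pos
  obtain ⟨h1, h2⟩ := c.isCrit_θw hB
  have h3 : 0 < Real.sin c.θw := Real.sin_pos_of_pos_of_lt_pi hw.1 (by linarith)
  refine ⟨c.kappa_pos h1.cos_pos h3.ne' ?_, c.kappa_pos h2.cos_pos ?_ ?_⟩
  · exact (c.critFactor_eq_zero_iff_eq_θw hB (Set.Ioo_subset_Icc_self h1.1)).2 (Or.inl rfl)
  · rw [Real.sin_neg]
    exact (neg_lt_zero.2 h3).ne
  · exact (c.critFactor_eq_zero_iff_eq_θw hB (Set.Ioo_subset_Icc_self h2.1)).2 (Or.inr rfl)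

theorem radialRate_sq {s θ : ℝ} (hs : s ^ 2 = 1) (hθ : 0 < Real.cos θ) :
    c.radialRate s θ ^ 2 = 2 * Real.cos θ ^ 3 := by
  have hU := c.U_pos θ hθ.le
  have h1 := c.sq_mul_cos_pow hs hθ
  rw [radialRate, div_pow, Real.sq_sqrt hU.le, div_eq_iff hU.ne']
  linear_combination (Real.cos θ ^ 3) * h1

theorem radialRate_eq (s θ : ℝ) : c.radialRate s θ = s * c.radialRate 1 θ := by
  rw [radialRate, radialRate]
  ring

theorem radialRate_one_pos {θ : ℝ} (hθ : 0 < Real.cos θ) : 0 < c.radialRate 1 θ := by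
  have hU := c.U_pos θ hθ.le
  have hW := c.W_pos hθ
  rw [radialRate, one_mul]
  positivity

theorem fderiv_energyFn_critPoint (C h : ℝ) {s θ : ℝ} (hs : s ^ 2 = 1) (hθ : c.IsCrit θ)
    (a b d e : ℝ) :
    fderiv ℝ (c.energyFn C h) (c.critPoint s θ) (a, b, d, e) =
      C ^ 2 * Real.cos θ ^ 4 * a + 2 * (s * √(2 * c.W θ)) * Real.cos θ ^ 6 * b := by
  have h1 := c.sq_mul_cos_pow hs hθ.cos_pos
  rw [critPoint, c.fderiv_energyFn C h hθ.cos_pos]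
  linear_combination (-2 * Real.cos θ ^ 2 * d) * hθ.2
    - (6 * Real.cos θ ^ 2 * Real.sin θ * d) * h1

theorem velocity_ne_zero {s θ : ℝ} (hs : s ^ 2 = 1) (hθ : 0 < Real.cos θ) :
    s * √(2 * c.W θ) ≠ 0 := by
  have hW := c.W_pos hθ
  refine mul_ne_zero ?_ (by positivity)
  rintro rfl
  norm_num at hs

theorem fderiv_energyFn_critPoint_ne_zero (C h : ℝ) {s θ : ℝ} (hs : s ^ 2 = 1) (hθ : c.IsCrit θ) :
    fderiv ℝ (c.energyFn C h) (c.critPoint s θ) ≠ 0 := by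
  intro h0
  have h1 := c.fderiv_energyFn_critPoint C h hs hθ 0 1 0 0
  rw [h0] at h1
  have h2 := c.velocity_ne_zero hs hθ.cos_pos
  have h3 := hθ.cos_pos
  simp at h1
  rcases h1 with (h1 | h1) | h1
  · exact h2 (by simp [h1])
  · exact h2 (by simp [h1])
  · exact h3.ne' h1

theorem critPoint_mem_energySurface (C h : ℝ) {s θ : ℝ} (hs : s ^ 2 = 1) (hθ : c.IsCrit θ) :
    c.critPoint s θ ∈ c.energySurface C h := by
  refine ⟨le_rfl, Set.Ioo_subset_Icc_self hθ.1, ?_⟩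
  have h1 := c.sq_mul_cos_pow hs hθ.cos_pos
  simp only [critPoint, energyFn]
  linear_combination (Real.cos θ ^ 3) * h1

theorem eq_zero_of_sq_add_sq {x y : ℝ} (h : x ^ 2 + y ^ 2 = 0) : x = 0 ∧ y = 0 := by
  have := (add_eq_zero_iff_of_nonneg (sq_nonneg x) (sq_nonneg y)).1 h
  simpa using this

/-- The linearization along the energy surface is block triangular: its eigenvalues are the radial
rate `l` and the roots of `λ² - (l/2) λ - κ`, written here in real and imaginary parts. -/
theorem eigenvalue_cases (C h : ℝ) {s θ : ℝ} (hs : s ^ 2 = 1) (hθ : c.IsCrit θ) {lam : ℂ}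
    (hlam : IsTangentEigenvalue (c.field C h) (c.energyFn C h) (c.critPoint s θ) lam) :
    lam.re = c.radialRate s θ ∨
      (lam.re ^ 2 - lam.im ^ 2 - c.radialRate s θ / 2 * lam.re - c.kappa θ = 0 ∧
        2 * lam.re * lam.im - c.radialRate s θ / 2 * lam.im = 0) := by
  obtain ⟨⟨a₁, a₂, a₃, a₄⟩, ⟨b₁, b₂, b₃, b₄⟩, hne, ha, hb, hXa, hXb⟩ := hlam
  rw [c.fderiv_energyFn_critPoint C h hs hθ] at ha hb
  rw [c.fderiv_field_critPoint C h hs hθ] at hXa hXb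
  simp only [Prod.smul_mk, Prod.mk_sub_mk, Prod.mk_add_mk, Prod.mk.injEq, smul_eq_mul] at hXa hXb
  obtain ⟨ha1, ha2, ha3, ha4⟩ := hXa
  obtain ⟨hb1, hb2, hb3, hb4⟩ := hXb
  set l := c.radialRate s θ
  by_cases h1 : a₁ = 0 ∧ b₁ = 0
  · obtain ⟨rfl, rfl⟩ := h1
    have hv := c.velocity_ne_zero hs hθ.cos_pos
    have hc6 : Real.cos θ ^ 6 ≠ 0 := pow_ne_zero 6 hθ.cos_pos.ne'
    have h2 : ∀ b : ℝ, C ^ 2 * Real.cos θ ^ 4 * 0 + 2 * (s * √(2 * c.W θ)) * Real.cos θ ^ 6 * b = 0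
        → b = 0 := fun b hb => by
      rw [mul_zero, zero_add] at hb
      exact (mul_eq_zero.1 hb).resolve_left (mul_ne_zero (mul_ne_zero two_ne_zero hv) hc6)
    obtain rfl := h2 _ ha
    obtain rfl := h2 _ hb
    subst ha3 hb3
    right
    set p := lam.re ^ 2 - lam.im ^ 2 - l / 2 * lam.re - c.kappa θ with hp
    set q := 2 * lam.re * lam.im - l / 2 * lam.im with hq
    -- the complex equation `(p + i q) (a₃ + i b₃) = 0`
    have e1 : p * a₃ - q * b₃ = 0 := by rw [hp, hq]; linear_combination -ha4
    have e2 : q * a₃ + p * b₃ = 0 := by rw [hp, hq]; linear_combination -hb4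
    have e3 : (p ^ 2 + q ^ 2) * (a₃ ^ 2 + b₃ ^ 2) = 0 := by
      linear_combination (p * a₃ - q * b₃) * e1 + (q * a₃ + p * b₃) * e2
    rcases mul_eq_zero.1 e3 with e4 | e4
    · exact eq_zero_of_sq_add_sq e4
    · obtain ⟨rfl, rfl⟩ := eq_zero_of_sq_add_sq e4
      simp at hne
  · left
    have e3 : ((lam.re - l) ^ 2 + lam.im ^ 2) * (a₁ ^ 2 + b₁ ^ 2) = 0 := by
      linear_combination (-(lam.re - l) * a₁ + lam.im * b₁) * ha1
        + (-(lam.re - l) * b₁ - lam.im * a₁) * hb1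
    rcases mul_eq_zero.1 e3 with e4 | e4
    · exact sub_eq_zero.1 (eq_zero_of_sq_add_sq e4).1
    · exact absurd (eq_zero_of_sq_add_sq e4) h1

theorem isTangentEigenvalue_of_root (C h : ℝ) {s θ : ℝ} (hs : s ^ 2 = 1) (hθ : c.IsCrit θ)
    {x y : ℝ}
    (h1 : x ^ 2 - y ^ 2 - c.radialRate s θ / 2 * x - c.kappa θ = 0)
    (h2 : 2 * x * y - c.radialRate s θ / 2 * y = 0) :
    IsTangentEigenvalue (c.field C h) (c.energyFn C h) (c.critPoint s θ) ⟨x, y⟩ := by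
  refine ⟨(0, 0, 1, x), (0, 0, 0, y), Or.inl (by simp), ?_, ?_, ?_, ?_⟩
  · rw [c.fderiv_energyFn_critPoint C h hs hθ]; ring
  · rw [c.fderiv_energyFn_critPoint C h hs hθ]; ring
  · rw [c.fderiv_field_critPoint C h hs hθ]
    simp only [Prod.smul_mk, Prod.mk_sub_mk, Prod.mk.injEq, smul_eq_mul]
    refine ⟨by ring, by ring, by ring, by linear_combination -h1⟩
  · rw [c.fderiv_field_critPoint C h hs hθ]
    simp only [Prod.smul_mk, Prod.mk_add_mk, Prod.mk.injEq, smul_eq_mul]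
    refine ⟨by ring, by ring, by ring, by linear_combination -h2⟩

/-- If `κ < 0`, both roots of `λ² - (l/2) λ - κ` have a real part of the sign of `l`: their sum is
`l/2` and their product `-κ` is positive. -/
theorem re_mul_pos_of_kappa_neg (C h : ℝ) {s θ : ℝ} (hs : s ^ 2 = 1) (hθ : c.IsCrit θ)
    (hκ : c.kappa θ < 0) {lam : ℂ}
    (hlam : IsTangentEigenvalue (c.field C h) (c.energyFn C h) (c.critPoint s θ) lam) :
    0 < lam.re * c.radialRate s θ := by
  have hl := c.radialRate_sq hs hθ.cos_pos
  have hl2 : 0 < c.radialRate s θ ^ 2 := by rw [hl]; have := hθ.cos_pos; positivity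
  rcases c.eigenvalue_cases C h hs hθ hlam with h1 | ⟨h1, h2⟩
  · rw [h1]
    nlinarith
  · have h3 : lam.im * (2 * lam.re - c.radialRate s θ / 2) = 0 := by linear_combination h2
    rcases mul_eq_zero.1 h3 with h4 | h4
    · rw [h4] at h1
      nlinarith [sq_nonneg lam.re]
    · nlinarith

theorem isSource_critPoint (C h : ℝ) {θ : ℝ} (hθ : c.IsCrit θ) (hκ : c.kappa θ < 0) :
    IsSource (c.field C h) (c.energyFn C h) (c.critPoint 1 θ) := by
  refine ⟨c.field_critPoint C h (by norm_num) hθ, fun lam hlam => ?_⟩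
  exact pos_of_mul_pos_left (c.re_mul_pos_of_kappa_neg C h (by norm_num) hθ hκ hlam)
    (c.radialRate_one_pos hθ.cos_pos).le

theorem isSink_critPoint (C h : ℝ) {θ : ℝ} (hθ : c.IsCrit θ) (hκ : c.kappa θ < 0) :
    IsSink (c.field C h) (c.energyFn C h) (c.critPoint (-1) θ) := by
  refine ⟨c.field_critPoint C h (by norm_num) hθ, fun lam hlam => ?_⟩
  have h1 := c.re_mul_pos_of_kappa_neg C h (by norm_num) hθ hκ hlam
  rw [radialRate_eq] at h1
  nlinarith [c.radialRate_one_pos hθ.cos_pos]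

theorem isSaddle_critPoint (C h : ℝ) {s θ : ℝ} (hs : s ^ 2 = 1) (hθ : c.IsCrit θ)
    (hκ : 0 < c.kappa θ) : IsSaddle (c.field C h) (c.energyFn C h) (c.critPoint s θ) := by
  have hl : 0 < c.radialRate s θ ^ 2 := by
    rw [c.radialRate_sq hs hθ.cos_pos]; have := hθ.cos_pos; positivity
  set l := c.radialRate s θ with hl_def
  obtain ⟨x, y, hx, hy, hx2, hy2⟩ := exists_saddle_roots l hκ
  refine ⟨c.field_critPoint C h hs hθ, fun lam hlam h0 => ?_, ⟨⟨y, 0⟩, ?_, hy⟩,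
    ⟨⟨x, 0⟩, ?_, hx⟩⟩
  · rcases c.eigenvalue_cases C h hs hθ hlam with h1 | ⟨h1, h2⟩
    · rw [h0, ← hl_def] at h1
      rw [← h1] at hl
      norm_num at hl
    · rw [h0] at h1
      nlinarith [sq_nonneg lam.im]
  · exact c.isTangentEigenvalue_of_root C h hs hθ (by linear_combination hy2) (by ring)
  · exact c.isTangentEigenvalue_of_root C h hs hθ (by linear_combination hx2) (by ring)

theorem isSpiral_critPoint_zero (C h : ℝ) {s : ℝ} (hs : s ^ 2 = 1)
    (hμ : 1 + (25 * c.B + 16 * c.B₁) / (24 * (16 * c.B₁)) < c.μ) :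
    IsSpiral (c.field C h) (c.energyFn C h) (c.critPoint s 0) := by
  have h0 := c.B_pos
  have h1 := c.B₁_pos
  have hl := c.radialRate_sq hs (θ := 0) (by simp)
  rw [Real.cos_zero] at hl
  -- `l² = 2` at `θ = 0`, so `λ² - (l/2) λ - κ` has the discriminant `1/2 + 4 κ`
  have hκ : c.kappa 0 < -(1 / 8) := by
    have h2 : (25 * c.B + 16 * c.B₁) / (24 * (16 * c.B₁)) < c.μ - 1 := by linarith
    rw [div_lt_iff₀ (by positivity)] at h2
    rw [kappa_zero, div_lt_iff₀ (by positivity)]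
    linarith
  set y := √(-c.kappa 0 - 1 / 8) with hy
  have hy2 : y ^ 2 = -c.kappa 0 - 1 / 8 := Real.sq_sqrt (by linarith)
  refine ⟨⟨c.radialRate s 0 / 4, y⟩,
    c.isTangentEigenvalue_of_root C h hs c.isCrit_zero ?_ (by ring), ?_⟩
  · linear_combination -hy2 - hl / 16
  · exact (Real.sqrt_pos.2 (by linarith)).ne'

end IsoscelesParams

/-! ### The radial coordinate along converging orbits -/

/-- A solution of `r' = a r` with `a ≤ 0` stays nonnegative. The coefficient need not be continuous;
`-r` is compared with `ε (1 + t)`, because it cannot grow while it is positive. -/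
theorem nonneg_of_deriv_eq_mul {r a : ℝ → ℝ}
    (hr : ∀ t, 0 ≤ t → HasDerivWithinAt r (r t * a t) (Set.Ici 0) t) (ha : ∀ t, 0 ≤ t → a t ≤ 0)
    (h0 : 0 ≤ r 0) {t : ℝ} (ht : 0 ≤ t) : 0 ≤ r t := by
  have key : ∀ ε > 0, -r t ≤ ε * (1 + t) := by
    intro ε hε
    refine image_le_of_deriv_right_lt_deriv_boundary' (a := 0) (b := t) (f := fun s => -r s)
      (f' := fun s => -(r s * a s)) (B := fun s => ε * (1 + s)) (B' := fun _ => ε)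
      ?_ ?_ ?_ ?_ ?_ ?_ (Set.right_mem_Icc.2 ht)
    · exact fun s hs => ((hr s hs.1).mono Set.Icc_subset_Ici_self).continuousWithinAt.neg
    · exact fun s hs => ((hr s hs.1).mono (Set.Ici_subset_Ici.2 hs.1)).neg
    · simp only [add_zero, mul_one]
      linarith
    · fun_prop
    · intro s _
      simpa using (((hasDerivAt_id s).const_add 1).const_mul ε).hasDerivWithinAt
    · intro s hs h
      have h1 : r s ≤ 0 := by
        have := mul_pos hε (by linarith [hs.1] : 0 < 1 + s)
        linarith
      have h2 := mul_nonneg_of_nonpos_of_nonpos h1 (ha s hs.1)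
      linarith
  by_contra hneg
  push Not at hneg
  have h1 := key (-r t / (2 * (1 + t))) (div_pos (by linarith) (by linarith))
  have h2 : -r t / (2 * (1 + t)) * (1 + t) = -r t / 2 := by
    have : 1 + t ≠ 0 := by linarith
    field_simp
  rw [h2] at h1
  linarith

/-- If `a ≥ 0` then `r²` does not decrease along `r' = a r`, so it vanishes if its limit does. -/
theorem eq_zero_of_deriv_eq_mul {r a : ℝ → ℝ}
    (hr : ∀ t, 0 ≤ t → HasDerivWithinAt r (r t * a t) (Set.Ici 0) t) (ha : ∀ t, 0 ≤ t → 0 ≤ a t)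
    (hlim : Tendsto r atTop (𝓝 0)) {t : ℝ} (ht : 0 ≤ t) : r t = 0 := by
  have hd : ∀ s, 0 < s → HasDerivAt (fun s => r s ^ 2) (2 * r s * (r s * a s)) s := fun s hs => by
    refine (((hr s hs.le).hasDerivAt (Ici_mem_nhds hs)).pow 2).congr_deriv ?_
    norm_num
  have hmono : MonotoneOn (fun s => r s ^ 2) (Set.Ici 0) := by
    refine monotoneOn_of_deriv_nonneg (convex_Ici 0)
      (fun s hs => (hr s hs).continuousWithinAt.pow 2) (fun s hs => ?_) fun s hs => ?_
    · rw [interior_Ici] at hs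
      exact (hd s hs).differentiableAt.differentiableWithinAt
    · rw [interior_Ici] at hs
      rw [(hd s hs).deriv]
      have := mul_nonneg (sq_nonneg (r s)) (ha s (le_of_lt hs))
      linarith
  have h1 : r t ^ 2 ≤ 0 := by
    have h2 := hlim.pow 2
    rw [zero_pow two_ne_zero] at h2
    refine ge_of_tendsto h2 ((eventually_ge_atTop t).mono fun s hs => ?_)
    exact hmono ht (ht.trans hs) hs
  exact pow_eq_zero_iff two_ne_zero |>.1 (le_antisymm h1 (sq_nonneg _))

namespace IsoscelesParams

variable (c : IsoscelesParams)

/-! ### The energy surface as a graph -/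

/-- The value of `v²` on the energy surface, as a function of `(r, θ, w)`. -/
def velocitySq (C h : ℝ) (y : ℝ × ℝ × ℝ) : ℝ :=
  (2 * c.U y.2.1 * Real.cos y.2.1 ^ 3 - c.U y.2.1 * y.2.2 ^ 2
    - (C ^ 2 - 2 * y.1 * c.V y.2.1 * Real.cos y.2.1 ^ 2) * y.1 * Real.cos y.2.1 ^ 4
    + 2 * h * y.1 ^ 3 * Real.cos y.2.1 ^ 6) / Real.cos y.2.1 ^ 6

theorem energyFn_eq_zero_iff (C h : ℝ) {r v θ w : ℝ} (hθ : Real.cos θ ≠ 0) :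
    c.energyFn C h (r, v, θ, w) = 0 ↔ v ^ 2 = c.velocitySq C h (r, θ, w) := by
  rw [velocitySq, eq_div_iff (pow_ne_zero 6 hθ)]
  simp only [energyFn]
  constructor <;> intro h <;> linear_combination h

/-- The projection `(r, v, θ, w) ↦ (r, θ, w)`. -/
def dropVelocity : State →L[ℝ] ℝ × ℝ × ℝ :=
  (ContinuousLinearMap.fst ℝ ℝ (ℝ × ℝ × ℝ)).prod
    ((ContinuousLinearMap.snd ℝ ℝ (ℝ × ℝ)).comp (ContinuousLinearMap.snd ℝ ℝ (ℝ × ℝ × ℝ)))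

theorem dropVelocity_apply (p : State) : dropVelocity p = (p.1, p.2.2) := rfl

/-- The energy surface near the critical point `(0, s √(2 W(θ)), θ, 0)`, as a graph over
`(r, δθ, w)`. -/
def graphChart (C h s θ : ℝ) (y : ℝ × ℝ × ℝ) : State :=
  (y.1, s * √(c.velocitySq C h (y.1, θ + y.2.1, y.2.2)), θ + y.2.1, y.2.2)

theorem velocitySq_base (C h : ℝ) {θ : ℝ} (hθ : Real.cos θ ≠ 0) :
    c.velocitySq C h (0, θ, 0) = 2 * c.W θ := by
  rw [velocitySq, c.W_eq hθ]
  field_simp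
  ring

theorem graphChart_zero (C h s : ℝ) {θ : ℝ} (hθ : Real.cos θ ≠ 0) :
    c.graphChart C h s θ 0 = c.critPoint s θ := by
  have h1 := c.velocitySq_base C h hθ
  simp only [graphChart, critPoint, Prod.fst_zero, Prod.snd_zero, add_zero, h1]

theorem contDiffAt_velocitySq (C h : ℝ) {θ : ℝ} (hθ : 0 < Real.cos θ) :
    ContDiffAt ℝ 1 (fun y : ℝ × ℝ × ℝ => c.velocitySq C h (y.1, θ + y.2.1, y.2.2)) 0 := by
  have hp : 0 < Real.cos (θ + (0 : ℝ × ℝ × ℝ).2.1) := by simpa using hθ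
  have hθ' : ContDiffAt ℝ 1 (fun y : ℝ × ℝ × ℝ => θ + y.2.1) 0 := by fun_prop
  have hU : ContDiffAt ℝ 1 (fun y : ℝ × ℝ × ℝ => c.U (θ + y.2.1)) 0 :=
    (c.contDiff_U.of_le le_top).contDiffAt.comp 0 hθ'
  have hV : ContDiffAt ℝ 1 (fun y : ℝ × ℝ × ℝ => c.V (θ + y.2.1)) 0 :=
    ContDiffAt.comp 0 (g := c.V) (f := fun y : ℝ × ℝ × ℝ => θ + y.2.1)
      ((c.contDiffAt_V hp.ne').of_le le_top) hθ'
  have hc : ContDiffAt ℝ 1 (fun y : ℝ × ℝ × ℝ => Real.cos (θ + y.2.1)) 0 := by fun_prop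
  have hci : ContDiffAt ℝ 1 (fun y : ℝ × ℝ × ℝ => (Real.cos (θ + y.2.1) ^ 6)⁻¹) 0 :=
    (hc.pow 6).inv (pow_pos hp 6).ne'
  simp only [velocitySq, div_eq_mul_inv]
  fun_prop

theorem contDiffAt_graphChart (C h s : ℝ) {θ : ℝ} (hθ : 0 < Real.cos θ) :
    ContDiffAt ℝ 1 (c.graphChart C h s θ) 0 := by
  have h1 : c.velocitySq C h ((0 : ℝ × ℝ × ℝ).1, θ + (0 : ℝ × ℝ × ℝ).2.1, (0 : ℝ × ℝ × ℝ).2.2)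
      ≠ 0 := by
    simp only [Prod.fst_zero, Prod.snd_zero, add_zero, c.velocitySq_base C h hθ.ne']
    linarith [c.W_pos hθ]
  have h2 := (c.contDiffAt_velocitySq C h hθ).sqrt h1
  refine ContDiffAt.prodMk ?_ (ContDiffAt.prodMk ?_ (ContDiffAt.prodMk ?_ ?_)) <;> fun_prop

theorem dropVelocity_graphChart (C h s θ : ℝ) (y : ℝ × ℝ × ℝ) :
    dropVelocity (c.graphChart C h s θ y) = (0, θ, 0) + y := by
  simp [dropVelocity_apply, graphChart, Prod.ext_iff]

/-- Near `y = 0` the chart takes values in the part `cos θ > 0`, `s v > 0` of the energy surface. -/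
theorem eventually_graphChart (C h : ℝ) {s θ : ℝ} (hs : s ^ 2 = 1) (hθ : 0 < Real.cos θ) :
    ∀ᶠ y in 𝓝 (0 : ℝ × ℝ × ℝ), 0 < Real.cos (θ + y.2.1) ∧
      0 < c.velocitySq C h (y.1, θ + y.2.1, y.2.2) ∧
      c.energyFn C h (c.graphChart C h s θ y) = 0 := by
  have h1 : ∀ᶠ y in 𝓝 (0 : ℝ × ℝ × ℝ), 0 < Real.cos (θ + y.2.1) := by
    have : ContinuousAt (fun y : ℝ × ℝ × ℝ => Real.cos (θ + y.2.1)) 0 := by fun_prop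
    exact this.eventually (lt_mem_nhds (by simpa using hθ))
  have h2 : ∀ᶠ y in 𝓝 (0 : ℝ × ℝ × ℝ), 0 < c.velocitySq C h (y.1, θ + y.2.1, y.2.2) := by
    refine (c.contDiffAt_velocitySq C h hθ).continuousAt.eventually (lt_mem_nhds ?_)
    simp only [Prod.fst_zero, Prod.snd_zero, add_zero, c.velocitySq_base C h hθ.ne']
    linarith [c.W_pos hθ]
  filter_upwards [h1, h2] with y hy1 hy2
  refine ⟨hy1, hy2, ?_⟩
  rw [graphChart, c.energyFn_eq_zero_iff C h hy1.ne', mul_pow, hs, one_mul, Real.sq_sqrt hy2.le]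

/-- The graph is the whole energy surface near the equilibrium: `v` keeps the sign `s` there, and
`θ` stays away from `± π/2`. -/
theorem eventually_mem_energySurface_iff (C h : ℝ) {s θ : ℝ} (hs : s ^ 2 = 1) (hθ : c.IsCrit θ) :
    ∀ᶠ p in 𝓝 (c.critPoint s θ), p ∈ c.energySurface C h ↔
      p = c.graphChart C h s θ (dropVelocity (p - c.critPoint s θ)) ∧ 0 ≤ p.1 := by
  have hW := c.W_pos hθ.cos_pos
  have h0 : dropVelocity (c.critPoint s θ - c.critPoint s θ) = 0 := by rw [sub_self, map_zero]
  have h1 : Tendsto (fun p => dropVelocity (p - c.critPoint s θ)) (𝓝 (c.critPoint s θ)) (𝓝 0) := by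
    have : Continuous fun p => dropVelocity (p - c.critPoint s θ) := by fun_prop
    have := this.tendsto (c.critPoint s θ)
    rwa [h0] at this
  have h2 : ∀ᶠ p : State in 𝓝 (c.critPoint s θ), 0 < s * p.2.1 := by
    have : ContinuousAt (fun p : State => s * p.2.1) (c.critPoint s θ) := by fun_prop
    refine this.eventually (lt_mem_nhds ?_)
    simp only [critPoint]
    rw [← mul_assoc, ← sq, hs, one_mul]
    positivity
  have h3 : ∀ᶠ p : State in 𝓝 (c.critPoint s θ),
      p.2.2.1 ∈ Set.Ioo (-(Real.pi / 2)) (Real.pi / 2) := by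
    have : ContinuousAt (fun p : State => p.2.2.1) (c.critPoint s θ) := by fun_prop
    exact this.eventually (Ioo_mem_nhds hθ.1.1 hθ.1.2)
  filter_upwards [h1.eventually (c.eventually_graphChart C h hs hθ.cos_pos), h2, h3]
    with p hp hv hI
  obtain ⟨r, v, θ', w⟩ := p
  have hd : dropVelocity ((r, v, θ', w) - c.critPoint s θ) = (r, θ' - θ, w) := by
    simp [dropVelocity_apply, critPoint]
  rw [hd] at hp ⊢
  obtain ⟨hc, hq, hE⟩ := hp
  simp only [add_sub_cancel] at hc hq
  simp only at hv hI
  constructor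
  · rintro ⟨hr, -, hF⟩
    refine ⟨?_, hr⟩
    have h4 := (c.energyFn_eq_zero_iff C h hc.ne').1 hF
    have h5 : s * v = √(c.velocitySq C h (r, θ', w)) := by
      rw [← h4, ← one_mul (v ^ 2), ← hs, ← mul_pow, Real.sqrt_sq hv.le]
    simp only [graphChart, add_sub_cancel, ← h5]
    rw [← mul_assoc, ← sq, hs, one_mul]
  · rintro ⟨h4, hr⟩
    refine ⟨hr, Set.Ioo_subset_Icc_self hI, ?_⟩
    rw [h4]
    exact hE

/-- The vector field is tangent to the graph. -/
theorem eventually_fderiv_graphChart (C h : ℝ) {s θ : ℝ} (hs : s ^ 2 = 1) (hθ : 0 < Real.cos θ) :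
    ∀ᶠ y in 𝓝 (0 : ℝ × ℝ × ℝ), fderiv ℝ (c.graphChart C h s θ) y
      (dropVelocity (c.field C h (c.graphChart C h s θ y))) =
        c.field C h (c.graphChart C h s θ y) := by
  have hev := c.eventually_graphChart C h hs hθ
  filter_upwards [hev, hev.eventually_nhds,
    (c.contDiffAt_graphChart C h s hθ).eventually (by simp)] with y hy hy' hd
  obtain ⟨hc, hq, hE⟩ := hy
  have hΦ := (hd.differentiableAt one_ne_zero).hasFDerivAt
  set u := dropVelocity (c.field C h (c.graphChart C h s θ y)) with hu
  have h1 : dropVelocity (fderiv ℝ (c.graphChart C h s θ) y u) = u := by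
    have h2 := dropVelocity.hasFDerivAt.comp y hΦ
    have h3 : dropVelocity ∘ c.graphChart C h s θ = fun y => (0, θ, 0) + y :=
      funext (c.dropVelocity_graphChart C h s θ)
    rw [h3] at h2
    have h4 := h2.unique ((hasFDerivAt_id y).const_add _)
    exact congrArg (fun T => T u) h4
  have hF := ((c.contDiffAt_energyFn C h (p := c.graphChart C h s θ y) hc).differentiableAt
    one_ne_zero).hasFDerivAt
  have h5 : fderiv ℝ (c.energyFn C h) (c.graphChart C h s θ y)
      (fderiv ℝ (c.graphChart C h s θ) y u) = 0 := by
    have h6 := hF.comp y hΦ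
    have h7 : HasFDerivAt (c.energyFn C h ∘ c.graphChart C h s θ)
        (0 : ℝ × ℝ × ℝ →L[ℝ] ℝ) y :=
      (hasFDerivAt_const (0 : ℝ) y).congr_of_eventuallyEq (hy'.mono fun z hz => hz.2.2)
    exact congrArg (fun T => T u) (h6.unique h7)
  have h6 := c.fderiv_energyFn_field C h (p := c.graphChart C h s θ y) hc hE
  -- both vectors project to `u` and are tangent to the level set, which is transverse to `∂/∂v`
  set a := fderiv ℝ (c.graphChart C h s θ) y u
  set b := c.field C h (c.graphChart C h s θ y)
  obtain ⟨a₁, a₂, a₃, a₄⟩ := a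
  obtain ⟨b₁, b₂, b₃, b₄⟩ := b
  rw [hu, dropVelocity_apply, dropVelocity_apply] at h1
  simp only [Prod.mk.injEq] at h1
  obtain ⟨rfl, rfl, rfl⟩ := h1
  rw [graphChart, c.fderiv_energyFn C h hc] at h5 h6
  have hs0 : s ≠ 0 := by rintro rfl; norm_num at hs
  have h7 : 2 * (s * √(c.velocitySq C h (y.1, θ + y.2.1, y.2.2))) * Real.cos (θ + y.2.1) ^ 6
      * (a₂ - b₂) = 0 := by linear_combination h5 - h6
  have h8 := (mul_eq_zero.1 h7).resolve_left
    (mul_ne_zero (mul_ne_zero two_ne_zero (mul_ne_zero hs0 (Real.sqrt_pos.2 hq).ne'))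
      (pow_pos hc 6).ne')
  rw [sub_eq_zero.1 h8]

/-- The linearization in the graph chart. -/
theorem exists_fderiv_field_graphChart (C h : ℝ) {s θ : ℝ} (hs : s ^ 2 = 1) (hθ : c.IsCrit θ) :
    ∃ (β : ℝ) (J : ℝ × ℝ × ℝ →L[ℝ] ℝ × ℝ × ℝ),
      HasFDerivAt (fun y => dropVelocity (c.field C h (c.graphChart C h s θ y))) J 0 ∧
      ∀ a d e, J (a, d, e) = (c.radialRate s θ * a, e,
        β * a + c.kappa θ * d + c.radialRate s θ / 2 * e) := by
  have hc := hθ.cos_pos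
  have hΦ := ((c.contDiffAt_graphChart C h s hc).differentiableAt one_ne_zero).hasFDerivAt
  have hX : HasFDerivAt (c.field C h) (fderiv ℝ (c.field C h) (c.critPoint s θ))
      (c.graphChart C h s θ 0) := by
    rw [c.graphChart_zero C h s hc.ne']
    exact ((c.contDiffAt_field C h (p := c.critPoint s θ) hc).differentiableAt
      one_ne_zero).hasFDerivAt
  have hF : HasFDerivAt (c.energyFn C h) (fderiv ℝ (c.energyFn C h) (c.critPoint s θ))
      (c.graphChart C h s θ 0) := by
    rw [c.graphChart_zero C h s hc.ne']
    exact ((c.contDiffAt_energyFn C h (p := c.critPoint s θ) hc).differentiableAt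
      one_ne_zero).hasFDerivAt
  have hv := c.velocity_ne_zero hs hc
  set v := s * √(2 * c.W θ) with hv_def
  -- the derivative of the chart is found from `dF = 0` along the graph
  have hD : ∀ a d e, fderiv ℝ (c.graphChart C h s θ) 0 (a, d, e)
      = (a, -(C ^ 2 / (2 * v * Real.cos θ ^ 2)) * a, d, e) := by
    intro a d e
    have h1 : dropVelocity (fderiv ℝ (c.graphChart C h s θ) 0 (a, d, e)) = (a, d, e) := by
      have h2 := dropVelocity.hasFDerivAt.comp 0 hΦ
      have h3 : dropVelocity ∘ c.graphChart C h s θ = fun y => (0, θ, 0) + y :=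
        funext (c.dropVelocity_graphChart C h s θ)
      rw [h3] at h2
      have h4 := h2.unique ((hasFDerivAt_id 0).const_add _)
      exact congrArg (fun T => T (a, d, e)) h4
    have h5 : fderiv ℝ (c.energyFn C h) (c.critPoint s θ)
        (fderiv ℝ (c.graphChart C h s θ) 0 (a, d, e)) = 0 := by
      have h6 := hF.comp 0 hΦ
      have h7 : HasFDerivAt (c.energyFn C h ∘ c.graphChart C h s θ)
          (0 : ℝ × ℝ × ℝ →L[ℝ] ℝ) 0 :=
        (hasFDerivAt_const (0 : ℝ) 0).congr_of_eventuallyEq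
          ((c.eventually_graphChart C h hs hc).mono fun z hz => hz.2.2)
      exact congrArg (fun T => T (a, d, e)) (h6.unique h7)
    generalize fderiv ℝ (c.graphChart C h s θ) 0 (a, d, e) = b at h1 h5 ⊢
    obtain ⟨b₁, b₂, b₃, b₄⟩ := b
    rw [dropVelocity_apply] at h1
    simp only [Prod.mk.injEq] at h1
    obtain ⟨rfl, rfl, rfl⟩ := h1
    rw [c.fderiv_energyFn_critPoint C h hs hθ, ← hv_def] at h5
    have h8 : b₂ = -(C ^ 2 / (2 * v * Real.cos θ ^ 2)) * b₁ := by
      have h9 : Real.cos θ ^ 4 * (C ^ 2 * b₁ + 2 * v * Real.cos θ ^ 2 * b₂) = 0 := by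
        linear_combination h5
      have h10 := (mul_eq_zero.1 h9).resolve_left (pow_pos hc 4).ne'
      field_simp
      linear_combination h10
    rw [h8]
  refine ⟨2 * C ^ 2 * Real.sin θ * Real.cos θ ^ 3 / c.U θ
    + 6 * Real.sin θ * v * Real.cos θ ^ 5 / c.U θ * (-(C ^ 2 / (2 * v * Real.cos θ ^ 2))),
    _, dropVelocity.hasFDerivAt.comp 0 (hX.comp 0 hΦ), fun a d e => ?_⟩
  simp only [ContinuousLinearMap.comp_apply, hD, c.fderiv_field_critPoint C h hs hθ,
    dropVelocity_apply, ← hv_def]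
  ring_nf

/-! ### Stable manifolds of the equilibria -/

/-- Rescaling of the radial coordinate. -/
def scaleFst (δ : ℝ) : ℝ × ℝ × ℝ →L[ℝ] ℝ × ℝ × ℝ :=
  (δ • ContinuousLinearMap.fst ℝ ℝ (ℝ × ℝ)).prod (ContinuousLinearMap.snd ℝ ℝ (ℝ × ℝ))

/-- The nilpotent map `(a, d, e) ↦ (0, 0, a)`, which couples the radial direction to `w'`. -/
def radialCoupling : ℝ × ℝ × ℝ →L[ℝ] ℝ × ℝ × ℝ :=
  (0 : ℝ × ℝ × ℝ →L[ℝ] ℝ).prod ((0 : ℝ × ℝ × ℝ →L[ℝ] ℝ).prod (ContinuousLinearMap.fst ℝ ℝ (ℝ × ℝ)))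

theorem radialCoupling_apply (y : ℝ × ℝ × ℝ) : radialCoupling y = (0, 0, y.1) := rfl

/-- Let `T` split the uncoupled linearization `(a, d, e) ↦ (l a, e, κ d + (l/2) e)` into a
contracting part `As` of dimension `k` and an expanding part `Au`. If the radial direction is stable
and given by the form `ℓ`, the stable manifold is a `k`-dimensional half-disk; if the radial
direction is unstable, it is a `k`-dimensional disk in the collision manifold. The coupling of the
radial direction to `w'` is made small by a rescaling of `r`. -/
theorem stableManifoldHasDim_critPoint (C h : ℝ) {s θ : ℝ} (hs : s ^ 2 = 1) (hθ : c.IsCrit θ)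
    {k m : ℕ} (T : (EuclideanSpace ℝ (Fin k) × EuclideanSpace ℝ (Fin m)) ≃L[ℝ] ℝ × ℝ × ℝ)
    {As : EuclideanSpace ℝ (Fin k) →L[ℝ] EuclideanSpace ℝ (Fin k)}
    {Au : EuclideanSpace ℝ (Fin m) →L[ℝ] EuclideanSpace ℝ (Fin m)} {α : ℝ}
    (hα : 0 < α) (hAs : ExpContracting As α) (hAu : ExpContracting (-Au) α)
    (hT : ∀ z, T (As z.1, Au z.2) = (c.radialRate s θ * (T z).1, (T z).2.2,
      c.kappa θ * (T z).2.1 + c.radialRate s θ / 2 * (T z).2.2))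
    (ℓ : EuclideanSpace ℝ (Fin k) →ₗ[ℝ] ℝ)
    (hℓ : (s = -1 ∧ ∀ z, (T z).1 = ℓ z.1) ∨ (s = 1 ∧ ℓ = 0)) :
    StableManifoldHasDim (c.field C h) (c.energySurface C h) (c.critPoint s θ) k := by
  have hc := hθ.cos_pos
  obtain ⟨β, J, hJ, hJe⟩ := c.exists_fderiv_field_graphChart C h hs hθ
  set N := β • T.symm.toContinuousLinearMap.comp (radialCoupling.comp
    T.toContinuousLinearMap) with hN
  set δ := α / (‖N‖ + 1) with hδ
  have hδ0 : 0 < δ := by positivity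
  have hδN : δ * ‖N‖ < α := by
    rw [hδ, div_mul_eq_mul_div, div_lt_iff₀ (by positivity)]
    linarith
  set M : (EuclideanSpace ℝ (Fin k) × EuclideanSpace ℝ (Fin m)) →L[ℝ] ℝ × ℝ × ℝ :=
    (scaleFst δ).comp T.toContinuousLinearMap with hM
  set M' : ℝ × ℝ × ℝ →L[ℝ] (EuclideanSpace ℝ (Fin k) × EuclideanSpace ℝ (Fin m)) :=
    T.symm.toContinuousLinearMap.comp (scaleFst δ⁻¹) with hM'
  have hMap : ∀ z, M z = (δ * (T z).1, (T z).2) := fun z => rfl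
  have hM'ap : ∀ y, M' y = T.symm (δ⁻¹ * y.1, y.2) := fun y => rfl
  have hM'M : ∀ z, M' (M z) = z := fun z => by
    rw [hM'ap, hMap, inv_mul_cancel_left₀ hδ0.ne', Prod.mk.eta, T.symm_apply_apply]
  have hMM' : ∀ y, M (M' y) = y := fun y => by
    rw [hMap, hM'ap, T.apply_symm_apply, mul_inv_cancel_left₀ hδ0.ne']
  set Φ : EuclideanSpace ℝ (Fin k) × EuclideanSpace ℝ (Fin m) → State :=
    fun z => c.graphChart C h s θ (M z) with hΦ
  have hM0 : Tendsto M (𝓝 0) (𝓝 0) := by simpa using M.continuous.tendsto 0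
  have hgc : ContDiffAt ℝ 1 (c.graphChart C h s θ) (M 0) := by
    rw [map_zero]
    exact c.contDiffAt_graphChart C h s hc
  have hΦ0 : Φ 0 = c.critPoint s θ := by
    simp only [hΦ, map_zero, c.graphChart_zero C h s hc.ne']
  have hdrop : ∀ y, dropVelocity (c.graphChart C h s θ y - c.critPoint s θ) = y := fun y => by
    rw [map_sub, c.dropVelocity_graphChart, dropVelocity_apply, critPoint]
    simp
  have hYd : HasFDerivAt (fun z => (M'.comp dropVelocity) (c.field C h (Φ z)))
      (M'.comp (J.comp M)) 0 := by
    have h1 : HasFDerivAt (fun y => dropVelocity (c.field C h (c.graphChart C h s θ y))) J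
        (M 0) := by
      rw [map_zero]
      exact hJ
    exact M'.hasFDerivAt.comp 0 (h1.comp 0 M.hasFDerivAt)
  have hJM : M'.comp (J.comp M) = As.prodMap Au + δ • N := by
    refine ContinuousLinearMap.ext fun z => T.injective ?_
    have h1 : T ((As.prodMap Au + δ • N) z) = T (As z.1, Au z.2) + (δ * β) • (0, 0, (T z).1) := by
      simp only [hN, add_apply, smul_apply, map_add,
        map_smul, ContinuousLinearMap.comp_apply, ContinuousLinearEquiv.coe_coe,
        T.apply_symm_apply, radialCoupling_apply, smul_smul]
      rfl
    rw [h1, hT]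
    simp only [ContinuousLinearMap.comp_apply]
    rw [hM'ap, T.apply_symm_apply, hMap]
    rw [show (δ * (T z).1, (T z).2) = (δ * (T z).1, (T z).2.1, (T z).2.2) from rfl, hJe]
    simp only [Prod.smul_mk, Prod.mk_add_mk, smul_eq_mul, Prod.mk.injEq]
    refine ⟨?_, by ring, by ring⟩
    field_simp
    ring
  have hlin : ‖fderiv ℝ (fun z => (M'.comp dropVelocity) (c.field C h (Φ z))) 0
      - As.prodMap Au‖ < α := by
    rw [hYd.fderiv, hJM, add_sub_cancel_left, norm_smul, Real.norm_of_nonneg hδ0.le]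
    exact hδN
  -- the growth rate of `r` along the flow in the chart
  set rate : EuclideanSpace ℝ (Fin k) × EuclideanSpace ℝ (Fin m) → ℝ := fun z =>
    (Φ z).2.1 * (Real.cos (Φ z).2.2.1 ^ 3 / √(c.U (Φ z).2.2.1)) with hrate
  have hΦc : ContinuousAt Φ 0 := hgc.continuousAt.comp M.continuous.continuousAt
  have hratec : ∀ᶠ z in 𝓝 0, 0 < s * rate z := by
    have hU0 := c.U_pos θ hc.le
    have h1 : ContinuousAt (fun p : State =>
        s * (p.2.1 * (Real.cos p.2.2.1 ^ 3 / √(c.U p.2.2.1)))) (Φ 0) := by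
      have h2 : ContinuousAt (fun p : State => √(c.U p.2.2.1)) (Φ 0) :=
        (Real.continuous_sqrt.comp (c.contDiff_U.continuous.comp (by fun_prop))).continuousAt
      refine continuousAt_const.mul (ContinuousAt.mul (by fun_prop) (ContinuousAt.div (by fun_prop)
        h2 ?_))
      rw [hΦ0]
      exact (Real.sqrt_pos.2 hU0).ne'
    refine (h1.comp hΦc).eventually (lt_mem_nhds ?_)
    have h3 : s * ((Φ 0).2.1 * (Real.cos (Φ 0).2.2.1 ^ 3 / √(c.U (Φ 0).2.2.1)))
        = c.radialRate 1 θ := by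
      rw [hΦ0, radialRate]
      simp only [critPoint]
      rw [one_mul]
      linear_combination (√(2 * c.W θ) * (Real.cos θ ^ 3 / √(c.U θ))) * hs
    simp only [Function.comp, h3]
    exact c.radialRate_one_pos hc
  refine StableManifoldHasDim.of_chart (Φ := Φ) (L := M'.comp dropVelocity)
    (r := fun p => p.1) ℓ hα hAs hAu (c.contDiffAt_field C h (p := c.critPoint s θ) hc)
    (c.field_critPoint C h hs hθ) (hgc.comp 0 M.contDiff.contDiffAt) hΦ0 (fun z => ?_) hlin ?_ ?_ ?_
  · rw [ContinuousLinearMap.comp_apply, hΦ]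
    simp only [hdrop, hM'M]
  · refine (c.eventually_mem_energySurface_iff C h hs hθ).mono fun p hp => ?_
    rw [hp]
    simp only [hΦ, ContinuousLinearMap.comp_apply, hMM']
  · filter_upwards [hM0.eventually (c.eventually_fderiv_graphChart C h hs hc),
      hM0.eventually ((c.contDiffAt_graphChart C h s hc).eventually (by simp))] with z hz hd
    have h1 : HasFDerivAt Φ ((fderiv ℝ (c.graphChart C h s θ) (M z)).comp M) z :=
      (hd.differentiableAt one_ne_zero).hasFDerivAt.comp z M.hasFDerivAt
    rw [h1.fderiv]
    simp only [ContinuousLinearMap.comp_apply, hMM']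
    exact hz
  · refine ⟨{z | 0 < s * rate z}, hratec, fun z hz hzO hzl => ?_⟩
    have hr : ∀ t, 0 ≤ t → HasDerivWithinAt (fun t => (M (z t)).1)
        ((M (z t)).1 * rate (z t)) (Set.Ici 0) t := fun t ht => by
      have h1 := (ContinuousLinearMap.fst ℝ ℝ (ℝ × ℝ)).hasFDerivAt.comp_hasDerivWithinAt t
        (M.hasFDerivAt.comp_hasDerivWithinAt t (hz t ht))
      refine h1.congr_deriv ?_
      simp only [ContinuousLinearMap.comp_apply, hMM']
      change (M (z t)).1 * (Φ (z t)).2.1 * _ = (M (z t)).1 * ((Φ (z t)).2.1 * _)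
      rw [mul_assoc]
      rfl
    have hMfst : ∀ t, (M (z t)).1 = δ * (T (z t)).1 := fun t => rfl
    have hΦr : ∀ t, (Φ (z t)).1 = (M (z t)).1 := fun t => rfl
    simp only [hΦr]
    rcases hℓ with ⟨rfl, hTℓ⟩ | ⟨rfl, rfl⟩
    · -- `r` decays without changing sign
      have h0 : (M (z 0)).1 = δ * ℓ (z 0).1 := by rw [hMfst, hTℓ]
      rw [h0]
      refine ⟨fun h1 t ht => ?_, fun h1 => nonneg_of_mul_nonneg_right h1 hδ0⟩
      refine nonneg_of_deriv_eq_mul hr (fun t ht => ?_) (by rw [h0]; positivity) ht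
      have := hzO t ht
      simp only [Set.mem_ofPred_eq] at this
      linarith
    · -- `r` cannot decay where it grows, so it vanishes along converging orbits
      refine ⟨fun _ t ht => ?_, fun _ => le_rfl⟩
      refine (eq_zero_of_deriv_eq_mul hr (fun t ht => ?_) ?_ ht).ge
      · have := hzO t ht
        simp only [Set.mem_ofPred_eq] at this
        linarith
      · exact (continuous_fst.tendsto _).comp (hM0.comp hzl)

theorem inner_euclidean_one (x y : EuclideanSpace ℝ (Fin 1)) : inner ℝ x y = x 0 * y 0 := by
  simp [PiLp.inner_apply, mul_comm]

theorem inner_euclidean_two (x y : EuclideanSpace ℝ (Fin 2)) :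
    inner ℝ x y = x 0 * y 0 + x 1 * y 1 := by
  simp [PiLp.inner_apply, Fin.sum_univ_two, mul_comm]

theorem inner_euclidean_three (x y : EuclideanSpace ℝ (Fin 3)) :
    inner ℝ x y = x 0 * y 0 + x 1 * y 1 + x 2 * y 2 := by
  simp [PiLp.inner_apply, Fin.sum_univ_three, mul_comm]

theorem radialRate_neg_one_neg {θ : ℝ} (hθ : 0 < Real.cos θ) : c.radialRate (-1) θ < 0 := by
  rw [radialRate_eq]
  linarith [c.radialRate_one_pos hθ]

/-- A sink. With `q = -l/4` and `p² = q² - κ`, the linearization is strictly dissipative in the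
coordinates `(r, p δθ, w + q δθ)`. -/
theorem stableManifoldHasDim_three (C h : ℝ) {θ : ℝ} (hθ : c.IsCrit θ) (hκ : c.kappa θ < 0) :
    StableManifoldHasDim (c.field C h) (c.energySurface C h) (c.critPoint (-1) θ) 3 := by
  have hl := c.radialRate_neg_one_neg hθ.cos_pos
  set l := c.radialRate (-1) θ with hl_def
  set κ := c.kappa θ with hκ_def
  set q := -l / 4 with hq
  have hq0 : 0 < q := by rw [hq]; linarith
  have hlq : l = -4 * q := by rw [hq]; ring
  set p := √(q ^ 2 - κ) with hp
  have hp2 : p ^ 2 = q ^ 2 - κ := Real.sq_sqrt (by nlinarith)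
  have hqp : q < p := lt_of_pow_lt_pow_left₀ 2 (Real.sqrt_nonneg _) (by linarith)
  have hp0 : 0 < p := hq0.trans hqp
  let T : (EuclideanSpace ℝ (Fin 3) × EuclideanSpace ℝ (Fin 0)) ≃ₗ[ℝ] ℝ × ℝ × ℝ :=
    { toFun := fun z => (z.1 0, z.1 1 / p, z.1 2 - q * (z.1 1 / p))
      invFun := fun y => (!₂[y.1, p * y.2.1, y.2.2 + q * y.2.1], 0)
      map_add' := fun x y => by
        simp only [Prod.fst_add, PiLp.add_apply, Prod.mk_add_mk, Prod.mk.injEq]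
        exact ⟨trivial, by ring, by ring⟩
      map_smul' := fun a x => by
        simp only [Prod.smul_fst, PiLp.smul_apply, smul_eq_mul, Prod.smul_mk, Prod.mk.injEq,
          RingHom.id_apply]
        exact ⟨trivial, by ring, by ring⟩
      left_inv := fun z => by
        refine Prod.ext ?_ (Subsingleton.elim _ _)
        ext i
        fin_cases i <;> simp
        field_simp
      right_inv := fun y => by
        refine Prod.ext ?_ (Prod.ext ?_ ?_) <;> simp <;> field_simp
        ring }
  let A : EuclideanSpace ℝ (Fin 3) →ₗ[ℝ] EuclideanSpace ℝ (Fin 3) :=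
    { toFun := fun x => !₂[l * x 0, p * x 2 - q * x 1, (κ + q ^ 2) / p * x 1 - q * x 2]
      map_add' := fun x y => by ext i; fin_cases i <;> simp <;> ring
      map_smul' := fun a x => by ext i; fin_cases i <;> simp <;> ring }
  -- the symmetric part of the lower block has the eigenvalues `-q ± q² / p`, and `l = -4 q` lies
  -- below them
  have hAs : ExpContracting (LinearMap.toContinuousLinearMap A) (q - q ^ 2 / p) := by
    refine ExpContracting.of_inner_le fun x => ?_
    rw [← real_inner_self_eq_norm_sq, inner_euclidean_three, inner_euclidean_three]
    have hκq : (κ + q ^ 2) / p = 2 * q ^ 2 / p - p := by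
      field_simp
      linarith
    change l * x 0 * x 0 + (p * x 2 - q * x 1) * x 1 + ((κ + q ^ 2) / p * x 1 - q * x 2) * x 2 ≤ _
    rw [hκq, hlq]
    have h1 : 0 ≤ q ^ 2 / p * (x 1 - x 2) ^ 2 := by positivity
    have h2 : 0 ≤ (3 * q + q ^ 2 / p) * (x 0) ^ 2 := by positivity
    have h3 : 2 * q ^ 2 / p = 2 * (q ^ 2 / p) := by ring
    rw [h3]
    linarith
  have hAu : ExpContracting (-(0 : EuclideanSpace ℝ (Fin 0) →L[ℝ] EuclideanSpace ℝ (Fin 0)))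
      (q - q ^ 2 / p) := by
    refine ExpContracting.of_inner_le fun x => ?_
    rw [Subsingleton.elim x 0]
    simp
  have hα : 0 < q - q ^ 2 / p := by
    rw [sub_pos, div_lt_iff₀ hp0]
    nlinarith
  let ℓ : EuclideanSpace ℝ (Fin 3) →ₗ[ℝ] ℝ :=
    { toFun := fun x => x 0
      map_add' := fun _ _ => rfl
      map_smul' := fun _ _ => rfl }
  refine c.stableManifoldHasDim_critPoint C h (by norm_num) hθ T.toContinuousLinearEquiv hα hAs hAu
    (fun z => ?_) ℓ (Or.inl ⟨rfl, fun z => rfl⟩)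
  rw [← hl_def, ← hκ_def]
  change (l * z.1 0, (p * z.1 2 - q * z.1 1) / p, (κ + q ^ 2) / p * z.1 1 - q * z.1 2
    - q * ((p * z.1 2 - q * z.1 1) / p)) = (l * z.1 0, z.1 2 - q * (z.1 1 / p),
      κ * (z.1 1 / p) + l / 2 * (z.1 2 - q * (z.1 1 / p)))
  rw [hlq]
  refine Prod.ext rfl (Prod.ext ?_ ?_) <;> simp only <;> field_simp
  ring

/-- The linear map with matrix `diag (a, b)`. -/
def diagTwo (a b : ℝ) : EuclideanSpace ℝ (Fin 2) →L[ℝ] EuclideanSpace ℝ (Fin 2) :=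
  LinearMap.toContinuousLinearMap
    { toFun := fun x => !₂[a * x 0, b * x 1]
      map_add' := fun x y => by ext i; fin_cases i <;> simp <;> ring
      map_smul' := fun t x => by ext i; fin_cases i <;> simp <;> ring }

theorem expContracting_diagTwo {a b α : ℝ} (ha : a ≤ -α) (hb : b ≤ -α) :
    ExpContracting (diagTwo a b) α := by
  refine ExpContracting.of_inner_le fun x => ?_
  rw [← real_inner_self_eq_norm_sq, inner_euclidean_two, inner_euclidean_two]
  change a * x 0 * x 0 + b * x 1 * x 1 ≤ _
  nlinarith [sq_nonneg (x 0), sq_nonneg (x 1)]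

theorem neg_diagTwo (a b : ℝ) : -diagTwo a b = diagTwo (-a) (-b) := by
  refine ContinuousLinearMap.ext fun x => ?_
  ext i
  fin_cases i
  · exact (neg_mul a (x 0)).symm
  · exact (neg_mul b (x 1)).symm

theorem neg_smul_id (a : ℝ) : -(a • ContinuousLinearMap.id ℝ (EuclideanSpace ℝ (Fin 1))) =
    (-a) • ContinuousLinearMap.id ℝ (EuclideanSpace ℝ (Fin 1)) :=
  ContinuousLinearMap.ext fun x => (neg_smul a x).symm

theorem expContracting_smul_id {a α : ℝ} (ha : a ≤ -α) :
    ExpContracting (a • ContinuousLinearMap.id ℝ (EuclideanSpace ℝ (Fin 1))) α := by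
  refine ExpContracting.of_inner_le fun x => ?_
  rw [← real_inner_self_eq_norm_sq, inner_euclidean_one, inner_euclidean_one]
  change a * x 0 * x 0 ≤ _
  nlinarith [sq_nonneg (x 0)]

/-- The eigenvector coordinates `δθ = u₋ + u₊`, `w = a u₋ + b u₊` for the eigenvalues `a ≠ b`; here
the radial coordinate is grouped with `u₋`. -/
def splitTwoOne (a b : ℝ) (hab : a ≠ b) :
    (EuclideanSpace ℝ (Fin 2) × EuclideanSpace ℝ (Fin 1)) ≃ₗ[ℝ] ℝ × ℝ × ℝ where
  toFun z := (z.1 0, z.1 1 + z.2 0, a * z.1 1 + b * z.2 0)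
  invFun y := (!₂[y.1, (b * y.2.1 - y.2.2) / (b - a)], !₂[(y.2.2 - a * y.2.1) / (b - a)])
  map_add' x y := by
    simp only [Prod.fst_add, Prod.snd_add, PiLp.add_apply, Prod.mk_add_mk, Prod.mk.injEq]
    exact ⟨trivial, by ring, by ring⟩
  map_smul' t x := by
    simp only [Prod.smul_fst, Prod.smul_snd, PiLp.smul_apply, smul_eq_mul, Prod.smul_mk,
      Prod.mk.injEq, RingHom.id_apply]
    exact ⟨trivial, by ring, by ring⟩
  left_inv z := by
    have h : b - a ≠ 0 := sub_ne_zero.2 hab.symm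
    refine Prod.ext ?_ ?_ <;> ext i <;> fin_cases i <;> simp <;> field_simp <;> ring
  right_inv y := by
    have h : b - a ≠ 0 := sub_ne_zero.2 hab.symm
    refine Prod.ext ?_ (Prod.ext ?_ ?_) <;> simp <;> field_simp <;> ring

/-- A saddle with `v < 0`: the radial direction is stable, and the stable manifold is a half-disk
spanned by it and the stable eigenvector in the `(θ, w)`-plane. -/
theorem stableManifoldHasDim_two (C h : ℝ) {θ : ℝ} (hθ : c.IsCrit θ) (hκ : 0 < c.kappa θ) :
    StableManifoldHasDim (c.field C h) (c.energySurface C h) (c.critPoint (-1) θ) 2 := by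
  have hl := c.radialRate_neg_one_neg hθ.cos_pos
  obtain ⟨a, b, ha, hb, ha2, hb2⟩ := exists_saddle_roots (c.radialRate (-1) θ) hκ
  set l := c.radialRate (-1) θ with hl_def
  set κ := c.kappa θ with hκ_def
  have hα : 0 < min (-l) (min (-a) b) := by
    simp only [lt_min_iff]
    exact ⟨by linarith, by linarith, hb⟩
  have h1 : min (-l) (min (-a) b) ≤ -l := min_le_left _ _
  have h2 : min (-l) (min (-a) b) ≤ -a := (min_le_right _ _).trans (min_le_left _ _)
  have h3 : min (-l) (min (-a) b) ≤ b := (min_le_right _ _).trans (min_le_right _ _)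
  let ℓ : EuclideanSpace ℝ (Fin 2) →ₗ[ℝ] ℝ :=
    { toFun := fun x => x 0
      map_add' := fun _ _ => rfl
      map_smul' := fun _ _ => rfl }
  refine c.stableManifoldHasDim_critPoint C h (by norm_num) hθ
    (splitTwoOne a b (by linarith)).toContinuousLinearEquiv hα
    (As := diagTwo l a) (Au := b • ContinuousLinearMap.id ℝ _)
    (expContracting_diagTwo (by linarith) (by linarith))
    (by rw [neg_smul_id]; exact expContracting_smul_id (by linarith))
    (fun z => ?_) ℓ (Or.inl ⟨rfl, fun z => rfl⟩)
  rw [← hl_def, ← hκ_def]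
  change (l * z.1 0, a * z.1 1 + b * z.2 0, a * (a * z.1 1) + b * (b * z.2 0)) =
    (l * z.1 0, a * z.1 1 + b * z.2 0, κ * (z.1 1 + z.2 0) + l / 2 * (a * z.1 1 + b * z.2 0))
  refine Prod.ext rfl (Prod.ext rfl ?_)
  simp only
  linear_combination (z.1 1) * ha2 + (z.2 0) * hb2

/-- A saddle with `v > 0`: the radial direction is unstable, and the stable manifold is a curve in
the collision manifold. -/
theorem stableManifoldHasDim_one (C h : ℝ) {θ : ℝ} (hθ : c.IsCrit θ) (hκ : 0 < c.kappa θ) :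
    StableManifoldHasDim (c.field C h) (c.energySurface C h) (c.critPoint 1 θ) 1 := by
  have hl := c.radialRate_one_pos hθ.cos_pos
  obtain ⟨a, b, ha, hb, ha2, hb2⟩ := exists_saddle_roots (c.radialRate 1 θ) hκ
  set l := c.radialRate 1 θ with hl_def
  set κ := c.kappa θ with hκ_def
  have hα : 0 < min l (min (-a) b) := by
    simp only [lt_min_iff]
    exact ⟨by linarith, by linarith, hb⟩
  have h1 : min l (min (-a) b) ≤ l := min_le_left _ _
  have h2 : min l (min (-a) b) ≤ -a := (min_le_right _ _).trans (min_le_left _ _)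
  have h3 : min l (min (-a) b) ≤ b := (min_le_right _ _).trans (min_le_right _ _)
  refine c.stableManifoldHasDim_critPoint C h (by norm_num) hθ
    ((LinearEquiv.prodComm ℝ _ _).trans
      (splitTwoOne b a (by linarith))).toContinuousLinearEquiv hα
    (As := a • ContinuousLinearMap.id ℝ _) (Au := diagTwo l b)
    (expContracting_smul_id (by linarith))
    (by rw [neg_diagTwo]; exact expContracting_diagTwo (by linarith) (by linarith))
    (fun z => ?_) 0 (Or.inr ⟨rfl, rfl⟩)
  rw [← hl_def, ← hκ_def]
  change (l * z.2 0, b * z.2 1 + a * z.1 0, b * (b * z.2 1) + a * (a * z.1 0)) =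
    (l * z.2 0, b * z.2 1 + a * z.1 0, κ * (z.2 1 + z.1 0) + l / 2 * (b * z.2 1 + a * z.1 0))
  refine Prod.ext rfl (Prod.ext rfl ?_)
  simp only
  linear_combination (z.1 0) * ha2 + (z.2 1) * hb2

/-! ### Reversibility -/

/-- The reversing symmetry `(r, v, θ, w) ↦ (r, -v, θ, -w)`. -/
def reversor : State ≃L[ℝ] State :=
  (ContinuousLinearEquiv.refl ℝ ℝ).prodCongr ((ContinuousLinearEquiv.neg ℝ).prodCongr
    ((ContinuousLinearEquiv.refl ℝ ℝ).prodCongr (ContinuousLinearEquiv.neg ℝ)))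

theorem reversor_apply (r v θ w : ℝ) : reversor (r, v, θ, w) = (r, -v, θ, -w) := rfl

/-- The reversor exchanges the equilibria with `v > 0` and `v < 0`. -/
theorem unstableManifoldHasDim_critPoint (C h s θ : ℝ) {k : ℕ}
    (hk : StableManifoldHasDim (c.field C h) (c.energySurface C h) (c.critPoint s θ) k) :
    UnstableManifoldHasDim (c.field C h) (c.energySurface C h) (c.critPoint (-s) θ) k := by
  have h1 : c.critPoint (-s) θ = reversor (c.critPoint s θ) := by
    rw [critPoint, critPoint, reversor_apply]
    simp
  rw [h1]
  refine hk.unstable_of_reversor reversor ?_ ?_ ?_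
  · rintro ⟨r, v, θ, w⟩
    simp only [reversor_apply, neg_neg]
  · rintro ⟨r, v, θ, w⟩
    rw [reversor_apply]
    simp only [field, wSqDivCos, reversor_apply, Prod.neg_mk, Prod.mk.injEq]
    refine ⟨by ring, by ring, trivial, by ring⟩
  · rintro ⟨r, v, θ, w⟩
    rw [reversor_apply]
    simp only [energySurface, energyFn, Set.mem_ofPred_eq, neg_sq]

theorem W_neg (θ : ℝ) : c.W (-θ) = c.W θ := by
  simp [W]

theorem Q_eq : c.Q = c.critPoint 1 0 := by simp [Q, critPoint]

theorem Qstar_eq : c.Qstar = c.critPoint (-1) 0 := by simp [Qstar, critPoint]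

theorem Eplus_eq : c.Eplus = c.critPoint 1 c.θw := by simp [Eplus, critPoint]

theorem Eminus_eq : c.Eminus = c.critPoint 1 (-c.θw) := by simp [Eminus, critPoint, W_neg]

theorem EplusStar_eq : c.EplusStar = c.critPoint (-1) c.θw := by simp [EplusStar, critPoint]

theorem EminusStar_eq : c.EminusStar = c.critPoint (-1) (-c.θw) := by
  simp [EminusStar, critPoint, W_neg]

end IsoscelesParams

end

/-! ### The equilibria and their invariant manifolds -/

theorem mainTheorem2 (c : IsoscelesParams) (C h : ℝ)
    (hA : 1 + c.A / (4 * c.A₁) < c.μ)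
    (hB : 1 + c.B / (16 * c.B₁) < c.μ)
    (hgen : (c.μ - 1) ^ (4 / 15 : ℝ) * (4 * c.A₁ / c.A) ^ (2 / 3 : ℝ) ≠
      (16 * c.B₁ / c.B) ^ (2 / 5 : ℝ)) :
    -- the equilibria on the triple collision manifold
    (0 < c.θw ∧ c.θw < Real.pi / 2) ∧
    {P | P ∈ c.collisionManifold ∧ c.field C h P = 0} =
      {c.Q, c.Qstar, c.Eplus, c.Eminus, c.EplusStar, c.EminusStar} ∧
    -- they are regular points of the energy hypersurface
    (∀ P ∈ c.collisionManifold, c.field C h P = 0 →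
      P ∈ c.energySurface C h ∧ fderiv ℝ (c.energyFn C h) P ≠ 0) ∧
    -- source and sink
    (IsSource (c.field C h) (c.energyFn C h) c.Q ∧
      UnstableManifoldHasDim (c.field C h) (c.energySurface C h) c.Q 3) ∧
    (IsSink (c.field C h) (c.energyFn C h) c.Qstar ∧
      StableManifoldHasDim (c.field C h) (c.energySurface C h) c.Qstar 3) ∧
    -- they are spirals, `μ ≫ 1` being used in the form of an explicit lower bound
    (1 + (25 * c.B + 16 * c.B₁) / (24 * (16 * c.B₁)) < c.μ →
      IsSpiral (c.field C h) (c.energyFn C h) c.Q ∧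
      IsSpiral (c.field C h) (c.energyFn C h) c.Qstar) ∧
    -- saddles
    (∀ P ∈ ({c.Eplus, c.Eminus} : Set IsoscelesParams.State),
      IsSaddle (c.field C h) (c.energyFn C h) P ∧
      UnstableManifoldHasDim (c.field C h) (c.energySurface C h) P 2 ∧
      StableManifoldHasDim (c.field C h) (c.energySurface C h) P 1) ∧
    (∀ P ∈ ({c.EplusStar, c.EminusStar} : Set IsoscelesParams.State),
      IsSaddle (c.field C h) (c.energyFn C h) P ∧
      StableManifoldHasDim (c.field C h) (c.energySurface C h) P 2 ∧
      UnstableManifoldHasDim (c.field C h) (c.energySurface C h) P 1) := by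
  have hone : (1 : ℝ) ^ 2 = 1 := by norm_num
  have hneg : (-1 : ℝ) ^ 2 = 1 := by norm_num
  have h0 := c.isCrit_zero
  obtain ⟨hp, hm⟩ := c.isCrit_θw hB
  have hκ0 := c.kappa_zero_neg hB
  obtain ⟨hκp, hκm⟩ := c.kappa_θw_pos hB
  have heq : ∀ P ∈ c.collisionManifold, c.field C h P = 0 →
      ∃ s θ : ℝ, s ^ 2 = 1 ∧ c.IsCrit θ ∧ P = c.critPoint s θ := by
    intro P hP hX
    obtain ⟨h1, h2 | h2⟩ := c.eq_critPoint_of_equilibrium C h hP hX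
    · exact ⟨1, _, hone, h1, h2⟩
    · exact ⟨-1, _, hneg, h1, h2⟩
  have hsource : ∀ θ, c.IsCrit θ → 0 < c.kappa θ →
      IsSaddle (c.field C h) (c.energyFn C h) (c.critPoint 1 θ) ∧
      UnstableManifoldHasDim (c.field C h) (c.energySurface C h) (c.critPoint 1 θ) 2 ∧
      StableManifoldHasDim (c.field C h) (c.energySurface C h) (c.critPoint 1 θ) 1 := by
    intro θ hθ hκ
    refine ⟨c.isSaddle_critPoint C h hone hθ hκ, ?_, c.stableManifoldHasDim_one C h hθ hκ⟩
    simpa using c.unstableManifoldHasDim_critPoint C h (-1) θ (c.stableManifoldHasDim_two C h hθ hκ)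
  have hsink : ∀ θ, c.IsCrit θ → 0 < c.kappa θ →
      IsSaddle (c.field C h) (c.energyFn C h) (c.critPoint (-1) θ) ∧
      StableManifoldHasDim (c.field C h) (c.energySurface C h) (c.critPoint (-1) θ) 2 ∧
      UnstableManifoldHasDim (c.field C h) (c.energySurface C h) (c.critPoint (-1) θ) 1 := by
    intro θ hθ hκ
    exact ⟨c.isSaddle_critPoint C h hneg hθ hκ, c.stableManifoldHasDim_two C h hθ hκ,
      c.unstableManifoldHasDim_critPoint C h 1 θ (c.stableManifoldHasDim_one C h hθ hκ)⟩
  rw [c.Q_eq, c.Qstar_eq, c.Eplus_eq, c.Eminus_eq, c.EplusStar_eq, c.EminusStar_eq]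
  refine ⟨c.θw_mem hB, ?_, ?_, ⟨c.isSource_critPoint C h h0 hκ0, ?_⟩,
    ⟨c.isSink_critPoint C h h0 hκ0, c.stableManifoldHasDim_three C h h0 hκ0⟩,
    fun hμ => ⟨c.isSpiral_critPoint_zero C h hone hμ, c.isSpiral_critPoint_zero C h hneg hμ⟩,
    ?_, ?_⟩
  · ext P
    simp only [Set.mem_ofPred_eq, Set.mem_insert_iff, Set.mem_singleton_iff]
    constructor
    · rintro ⟨hP, hX⟩
      obtain ⟨h1, h2⟩ := c.eq_critPoint_of_equilibrium C h hP hX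
      rcases (c.isCrit_iff hB _).1 h1 with h3 | h3 | h3 <;> rw [h3] at h2 <;> tauto
    · have key : ∀ s θ : ℝ, s ^ 2 = 1 → c.IsCrit θ →
          c.critPoint s θ ∈ c.collisionManifold ∧ c.field C h (c.critPoint s θ) = 0 :=
        fun s θ hs hθ => ⟨c.critPoint_mem_collisionManifold hs hθ, c.field_critPoint C h hs hθ⟩
      rintro (rfl | rfl | rfl | rfl | rfl | rfl)
      exacts [key _ _ hone h0, key _ _ hneg h0, key _ _ hone hp, key _ _ hone hm, key _ _ hneg hp,
        key _ _ hneg hm]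
  · intro P hP hX
    obtain ⟨s, θ, hs, hθ, rfl⟩ := heq P hP hX
    exact ⟨c.critPoint_mem_energySurface C h hs hθ, c.fderiv_energyFn_critPoint_ne_zero C h hs hθ⟩
  · simpa using c.unstableManifoldHasDim_critPoint C h (-1) 0
      (c.stableManifoldHasDim_three C h h0 hκ0)
  · rintro P (rfl | rfl)
    exacts [hsource _ hp hκp, hsource _ hm hκm]
  · rintro P (rfl | rfl)
    exacts [hsink _ hp hκp, hsink _ hm hκm]
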